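/- Let $\omega=e^{2\pi i/3}$, $Q=\mathrm{diag}(1,\omega,\omega^2)$, let $P$ be the $3\times3$ permutation matrix with $1$ in positions $(1,2),(2,3),(3,1)$, and let $X_{rs}=Q^rP^s$ with $L_{rs}=\mathbb C X_{rs}$ for $(r,s)\in I=\mathbb Z_3^2\setminus\{(0,0)\}$ (the Pauli grading of $sl(3,\mathbb C)$). A pair of indices $(rs),(r's')\in I$ is relevant if $sr'-rs'\ne0$ in $\mathbb Z_3$ (equivalently $[L_{rs},L_{r's'}]\neq0$); there are 24 relevant unordered pairs. A contraction matrix is a symmetric complex matrix $\varepsilon=(\varepsilon_{ij})_{i,j\in I}$ whose entries at irrelevant positions are $0$. It is a solution if the bracket $[x,y]_\varepsilon=\varepsilon_{ij}[x,y]$ ($x\in L_i$, $y\in L_j$) satisfies $[x,[y,z]_\varepsilon]_\varepsilon+[z,[x,y]_\varepsilon]_\varepsilon+[y,[z,x]_\varepsilon]_\varepsilon=0$ for all $x\in L_i,y\in L_j,z\in L_k$, $i,j,k\in I$. Let $H_3$ be the group of $2\times 2$ matrices over $\mathbb Z_3$ with determinant $\pm1$, acting on indices by $\pi_A(i)=iA$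 (row vectors); write $e^A$ for an equation $e$ with $A$ applied to all indices. Two solutions are equivalent, $\varepsilon'\sim\varepsilon$, if there are non-zero complex numbers $a_k$ $(k\in I)$ and $A\in H_3$ with $\varepsilon'_{ij}=\frac{a_ia_j}{a_{i+j}}\,\varepsilon_{\pi_A(i)\pi_A(j)}$ for all relevant $i,j$. Let $\nu(\varepsilon)$ be the number of zeros among the 24 relevant entries. A solution $\varepsilon$ is continuous if there are solutions $\varepsilon(t)$, continuous in $0<t\le1$, with $\varepsilon_{ij}(1)=1$, $\varepsilon_{ij}(t)\ne0$ and $\lim_{t\to0}\varepsilon_{ij}(t)=\varepsilon_{ij}$ for all relevant $i,j$; otherwise it is discrete. It is a generalized Inönü–Wigner contraction if one can take $\varepsilon_{ij}(t)=t^{n_i+n_j-n_{i+j}}$ with integers $n_k$. A higher-order identity of order $k$ is an equation $\varepsilon_{p_1}\cdots\varepsilon_{p_k}=\varepsilon_{q_1}\cdots\varepsilon_{q_k}$ with disjoint $\{p_1,\dots,p_k\}$, $\{q_1,\dots,q_k\}$ consisting of relevant pairs, which holds for all solutions without zeros at relevant positions and is violated by some solution with a zero at a relevant position. (1) The solutions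 are exactly the contraction matrices that satisfy the following system of 48 distinct two-term equations, for $A\in SL(2,\mathbb Z_3)$: $$(\varepsilon_{(02)(10)}\varepsilon_{(01)(12)}=\varepsilon_{(01)(10)}\varepsilon_{(02)(11)})^A,\qquad(\varepsilon_{(10)(11)}\varepsilon_{(01)(21)}=\varepsilon_{(01)(11)}\varepsilon_{(10)(12)})^A.$$ (2) Every solution is equivalent to a matrix belonging to exactly one of the 188 entries of the list below (for some admissible values of the parameters, if there are any). Conversely, each listed matrix $\varepsilon^{\nu,i}$ is a solution, with exactly $\nu$ zeros, for all admissible parameters. Of the 188 entries, 175 are non-parametric, 11 depend on one parameter $a$ and 2 depend on two parameters $a,b$. In each parametric entry only finitely many admissible parameter values give matrices equivalent to a given one, so each of these 13 entries yields a continuum of equivalence classes. (3) Every solution with $\nu(\varepsilon)<9$ is equivalent to the trivial solution $\varepsilon^{0,1}$, all of whose relevant entries are $1$. (4) The 24 distinct equations $(\varepsilon_{(01)(10)}\varepsilon_{(02)(11)}=\varepsilon_{(01)(20)}\varepsilon_{(02)(21)})^A$, $A\in SL(2,\mathbb Z_3)$, are higher-order identities of order 2. The following equations, $A\in SL(2,\mathbb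 Z_3)$, 80 distinct ones in all, are higher-order identities of order 3: $$(\varepsilon_{(01)(10)}\varepsilon_{(01)(11)}\varepsilon_{(01)(12)}=\varepsilon_{(01)(20)}\varepsilon_{(01)(22)}\varepsilon_{(01)(21)})^A,\quad(\varepsilon_{(01)(10)}\varepsilon_{(01)(12)}\varepsilon_{(02)(21)}=\varepsilon_{(01)(22)}\varepsilon_{(01)(21)}\varepsilon_{(02)(12)})^A,$$ $$(\varepsilon_{(01)(10)}\varepsilon_{(01)(11)}\varepsilon_{(02)(21)}=\varepsilon_{(01)(22)}\varepsilon_{(01)(21)}\varepsilon_{(02)(10)})^A,\quad(\varepsilon_{(01)(10)}\varepsilon_{(01)(11)}\varepsilon_{(02)(22)}=\varepsilon_{(01)(20)}\varepsilon_{(01)(22)}\varepsilon_{(02)(10)})^A.$$ (5) A listed matrix marked [C] is continuous, and is a generalized Inönü–Wigner contraction; one marked [D] is discrete, and violates at least one of the 104 identities in (4). One marked [*] has the former property if all its parameters are equal to $1$, and the latter for all other admissible values of its parameters. The list. Number the indices $01,02,10,20,11,22,12,21$ as $1,\dots,8$. For each entry $\varepsilon^{\nu,i}$ the list gives, after $(i)$,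 the positions $mn$ (row $m$, column $n$, $m<n$) of the non-zero entries above the diagonal; the entry is $1$, or $a$ or $b$ where this is written after a colon. The parameters are arbitrary non-zero complex numbers, except that in $\varepsilon^{12,2}$ moreover $\mathrm{Re}\,b>0$, or $\mathrm{Re}\,b=0$ and $\mathrm{Im}\,b>0$. The trivial entries are $\varepsilon^{0,1}$ (all 24 relevant entries are $1$) and $\varepsilon^{24,1}=0$, both [C]; the others are as follows. $\nu=9$: (1) 13, 14, 15, 16, 17, 18, 23, 24, 25, 26, 27, 28, 46, 48, 68 [C]. $\nu=12$: (1) 13, 14, 15, 16, 17, 18, 36, 46, 47, 48, 58, 68 [C]; (2) 13, 14:a, 23, 24, 35, 36:b, 37:b, 38, 45:a, 46, 47:b, 48:a [*]. $\nu=15$: (1) 13, 14, 15, 16, 17, 18, 46, 48, 68 [C]; (2) 13, 14, 16, 17, 26, 27, 46, 48, 68 [C]; (3) 13, 14, 16, 17, 36, 46, 47, 48, 68 [C]; (4) 13, 16, 26, 27, 36, 46, 48, 67, 68 [C]; (5) 13:a, 14, 15, 16, 23, 26, 35:b, 36, 46 [*]; (6) 13, 14:a, 23, 24, 35, 36, 37,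 46, 47 [D]; (7) 13:a, 23, 24, 35, 36, 37, 38, 46, 47 [D]. $\nu=16$: (1) 13, 16, 17, 18, 27, 28:a, 48, 68 [*]; (2) 13:a, 14, 15, 16, 23, 26, 35, 36 [D]; (3) 13:a, 14, 15, 16, 23, 26, 35, 46 [D]; (4) 13, 14, 15, 23, 24, 26, 35, 46 [D]; (5) 13, 14, 23, 24, 35, 38, 45, 48 [D]; (6) 13, 23, 24, 35, 36, 37, 46, 47 [D]; (7) 13, 14, 23, 35, 38, 45, 46, 48 [D]. $\nu=17$: (1) 13, 14, 16, 17, 46, 48, 68 [C]; (2) 13, 16, 17, 36, 47, 48, 68 [C]; (3) 13, 16, 17, 18, 27, 48, 68 [D]; (4) 13, 16, 17, 18, 28, 48, 68 [D]; (5) 13, 16, 17, 27, 28, 48, 68 [D]; (6) 13, 16, 26, 27, 46, 48, 68 [C]; (7) 13:a, 14, 15, 16, 23, 26, 35 [*]; (8) 13, 14, 15, 16, 23, 35, 36 [D]; (9) 13, 14, 15, 16, 23, 35, 46 [D]; (10) 13, 14, 15, 16, 26, 35, 36 [D]; (11) 13, 14, 15, 16, 35, 36, 46 [D]; (12) 13,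 14, 16, 23, 26, 35, 46 [D]; (13) 13:a, 14, 16, 23, 35, 36, 46 [D]; (14) 13, 14, 15, 23, 26, 35, 46 [D]; (15) 13, 14, 15, 23, 24, 26, 35 [D]; (16) 13, 14, 15, 24, 26, 35, 46 [D]; (17) 13, 14, 23, 35, 38, 45, 48 [D]. $\nu=18$: (1) 13, 16, 17, 18, 48, 68 [C]; (2) 13, 16, 17, 27, 48, 68 [C]; (3) 13, 16, 17, 28, 48, 68 [D]; (4) 13, 16, 18, 27, 48, 68 [D]; (5) 13, 16, 36, 46, 48, 68 [C]; (6) 13, 14, 15, 16, 23, 35 [D]; (7) 13, 14, 15, 16, 26, 35 [D]; (8) 13, 14, 15, 16, 35, 36 [C]; (9) 13, 14, 15, 16, 35, 46 [D]; (10) 13, 14, 16, 23, 26, 35 [D]; (11) 13, 14, 16, 23, 35, 36 [D]; (12) 13, 14, 16, 23, 35, 46 [D]; (13) 13, 14, 16, 26, 35, 36 [C]; (14) 13, 14, 16, 26, 35, 46 [D]; (15) 13, 14, 16, 35, 36, 46 [D]; (16) 13, 15, 16, 23, 26, 35 [D]; (17) 13, 16, 23, 26, 35, 46 [D]; (18)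 13, 14, 15, 23, 26, 35 [D]; (19) 13, 14, 15, 23, 24, 35 [D]; (20) 13, 14, 15, 26, 35, 46 [D]; (21) 13, 14, 15, 24, 26, 35 [D]; (22) 13, 14, 15, 24, 35, 46 [D]; (23) 13, 15, 24, 26, 35, 46 [D]; (24) 13, 14, 23, 26, 35, 46 [D]; (25) 13, 14:a, 23, 24, 35, 37 [*]; (26) 13, 14, 23, 24, 35, 46 [D]; (27) 13, 23, 24, 35, 37, 38 [D]; (28) 13, 23, 24, 35, 38, 46 [D]; (29) 13, 23:a, 35, 36, 37, 38 [*]; (30) 13, 14, 23:a, 35, 36, 46 [*]; (31) 13, 14, 24, 35, 37, 47 [D]; (32) 13, 24, 35, 38, 46, 47 [D]; (33) 13, 14:a, 35, 36, 37, 47 [*]; (34) 13, 14, 35, 38, 45, 48 [D]; (35) 13, 18, 24, 27, 37, 48 [C]; (36) 13, 14, 23, 24, 26, 35 [D]. $\nu=19$: (1) 13, 16, 17, 48, 68 [C]; (2) 13, 16, 18, 48, 68 [C]; (3) 13, 16, 27, 48, 68 [C]; (4) 13, 16, 46, 48, 68 [C]; (5) 13, 14, 15, 16, 35 [C]; (6)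 13, 14, 16, 23, 35 [D]; (7) 13, 14, 16, 26, 35 [C]; (8) 13, 14, 16, 35, 36 [C]; (9) 13, 14, 16, 35, 46 [D]; (10) 13, 15, 16, 23, 35 [C]; (11) 13, 15, 16, 26, 35 [D]; (12) 13, 15, 16, 35, 36 [C]; (13) 13, 16, 23, 26, 35 [C]; (14) 13, 16, 23, 35, 36 [C]; (15) 13, 16, 23, 35, 46 [D]; (16) 13, 16, 35, 36, 46 [D]; (17) 13, 14, 15, 23, 35 [C]; (18) 13, 14, 15, 26, 35 [D]; (19) 13, 14, 15, 35, 46 [D]; (20) 13, 14, 15, 24, 35 [D]; (21) 13, 15, 26, 35, 46 [D]; (22) 13, 15, 24, 26, 35 [D]; (23) 13, 14, 26, 35, 46 [D]; (24) 13, 23, 26, 35, 46 [D]; (25) 13, 14, 23, 24, 35 [D]; (26) 13, 23, 24, 35, 37 [D]; (27) 13, 23, 24, 35, 38 [D]; (28) 13, 23, 24, 35, 46 [D]; (29) 13, 23, 35, 36, 37 [D]; (30) 13, 14, 23, 35, 36 [D]; (31) 13, 14, 23, 35, 46 [D]; (32) 13, 23, 35, 38, 46 [D]; (33) 13, 14,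 24, 35, 37 [D]; (34) 13, 24, 35, 37, 47 [D]; (35) 13, 14, 24, 35, 47 [D]; (36) 13, 24, 35, 38, 46 [D]; (37) 13, 14, 35, 36, 37 [D]; (38) 13, 14, 35, 37, 47 [D]; (39) 13, 14, 35, 36, 47 [D]; (40) 13, 14, 35, 36, 46 [D]; (41) 13, 14, 23, 26, 46 [C]; (42) 13, 18, 24, 27, 37 [C]; (43) 13, 14, 23, 26, 35 [C]; (44) 13, 14, 24, 26, 35 [D]; (45) 13, 23, 24, 26, 35 [D]. $\nu=20$: (1) 13, 16, 48, 68 [C]; (2) 13, 14, 16, 35 [C]; (3) 13, 15, 16, 35 [C]; (4) 13, 16, 23, 35 [C]; (5) 13, 16, 26, 35 [C]; (6) 13, 16, 35, 36 [C]; (7) 13, 16, 35, 46 [D]; (8) 13, 14, 15, 35 [C]; (9) 13, 15, 26, 35 [D]; (10) 13, 15, 24, 35 [D]; (11) 13, 26, 35, 46 [D]; (12) 13, 23, 24, 35 [D]; (13) 13, 23, 35, 37 [C]; (14) 13, 14, 23, 35 [C]; (15) 13, 23, 35, 36 [C]; (16) 13, 23, 35, 38 [D]; (17) 13, 23, 35,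 46 [D]; (18) 13, 24, 35, 37 [D]; (19) 13, 14, 24, 35 [D]; (20) 13, 24, 35, 38 [D]; (21) 13, 24, 35, 46 [D]; (22) 13, 24, 35, 47 [D]; (23) 13, 14, 35, 37 [C]; (24) 13, 35, 36, 37 [C]; (25) 13, 35, 37, 47 [D]; (26) 13, 14, 35, 47 [D]; (27) 13, 35, 36, 47 [D]; (28) 13, 14, 35, 36 [C]; (29) 13, 14, 35, 46 [D]; (30) 13, 35, 36, 46 [D]; (31) 13, 16, 26, 27 [C]; (32) 13, 14, 26, 27 [C]; (33) 13, 16, 23, 26 [C]; (34) 13, 14, 23, 26 [C]; (35) 13, 14, 26, 46 [C]; (36) 13, 14, 23, 24 [C]; (37) 13, 18, 24, 27 [C]; (38) 13, 18, 24, 37 [C]; (39) 13, 18, 24, 48 [C]; (40) 13, 14, 26, 35 [C]; (41) 13, 23, 26, 35 [C]; (42) 13, 24, 26, 35 [D]. $\nu=21$: (1) 13, 16, 35 [C]; (2) 13, 15, 35 [C]; (3) 13, 23, 35 [C]; (4) 13, 24, 35 [D]; (5) 13, 35, 37 [C]; (6) 13, 35, 47 [D]; (7) 13, 14, 35 [C];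 (8) 13, 35, 36 [C]; (9) 13, 35, 38 [D]; (10) 13, 35, 46 [D]; (11) 13, 26, 27 [C]; (12) 13, 16, 26 [C]; (13) 13, 14, 26 [C]; (14) 13, 23, 26 [C]; (15) 13, 26, 46 [C]; (16) 13, 16, 36 [C]; (17) 13, 14, 23 [C]; (18) 13, 18, 24 [C]; (19) 13, 18, 37 [C]; (20) 13, 27, 48 [C]; (21) 13, 26, 35 [C]. $\nu=22$: (1) 13, 35 [C]; (2) 13, 26 [C]; (3) 13, 16 [C]; (4) 13, 14 [C]; (5) 13, 18 [C]; (6) 13, 24 [C]; (7) 13, 27 [C]. $\nu=23$: (1) 13 [C]. -/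

import Mathlib

open Filter Topology

namespace PauliContraction

/-! ### The Pauli grading of `sl(3,ℂ)` -/

/-- The grading group `ℤ₃ × ℤ₃`. The grading indices are its eight non-zero elements. -/
abbrev G : Type := ZMod 3 × ZMod 3

/-- The primitive cube root of unity `exp (2πi/3)`. -/
noncomputable def ω : ℂ := Complex.exp (2 * Real.pi * Complex.I / 3)

noncomputable def Q : Matrix (Fin 3) (Fin 3) ℂ := !![1, 0, 0; 0, ω, 0; 0, 0, ω ^ 2]

noncomputable def P : Matrix (Fin 3) (Fin 3) ℂ := !![0, 1, 0; 0, 0, 1; 1, 0, 0]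

/-- The generalized Pauli matrix `X_{rs} = Q^r P^s`; for `(r,s) ≠ (0,0)` it spans the grading
subspace `L_{rs}` of `sl(3,ℂ)`. -/
noncomputable def X (p : G) : Matrix (Fin 3) (Fin 3) ℂ := Q ^ p.1.val * P ^ p.2.val

/-- The pair of grading indices `i`, `j` is relevant, that is `[L_i, L_j] ≠ 0`. -/
abbrev Relevant (i j : G) : Prop := i.2 * j.1 - i.1 * j.2 ≠ 0

/-! ### Contraction matrices and the contraction system -/

/-- A contraction matrix is a symmetric matrix whose irrelevant entries are zero. The rows and
columns are indexed by the non-zero elements of `G`; the index `0`, which is in no relevant pair,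
is carried along with zero entries. -/
def IsContractionMatrix (ε : G → G → ℂ) : Prop :=
  (∀ i j, ε i j = ε j i) ∧ ∀ i j, ¬ Relevant i j → ε i j = 0

/-- `[X_i, [X_j, X_k]_ε]_ε`, where `[x, y]_ε = ε_{ij} [x, y]` for `x ∈ L_i`, `y ∈ L_j`. -/
noncomputable def nestedBracket (ε : G → G → ℂ) (i j k : G) : Matrix (Fin 3) (Fin 3) ℂ :=
  (ε j k * ε i (j + k)) • ⁅X i, ⁅X j, X k⁆⁆

/-- The solution set of the contraction system: contraction matrices for which the contracted
bracket satisfies the Jacobi identity on all triples of grading subspaces. -/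
def IsSolution (ε : G → G → ℂ) : Prop :=
  IsContractionMatrix ε ∧ ∀ i j k : G, i ≠ 0 → j ≠ 0 → k ≠ 0 →
    nestedBracket ε i j k + nestedBracket ε k i j + nestedBracket ε j k i = 0

/-! ### The symmetry group of the grading -/

/-- The matrix group `H₃` (as a set of matrices), the symmetry group of the Pauli grading. -/
def H3 : Set (Matrix (Fin 2) (Fin 2) (ZMod 3)) := {A | A.det = 1 ∨ A.det = -1}

/-- The action of a matrix on a grading index, seen as a row vector. -/
def act (A : Matrix (Fin 2) (Fin 2) (ZMod 3)) (p : G) : G :=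
  (p.1 * A 0 0 + p.2 * A 1 0, p.1 * A 0 1 + p.2 * A 1 1)

/-- `ε' = α • ε^π` for a normalization matrix `α_{ij} = a_i a_j / a_{i+j}` and the permutation `π`
of the grading indices given by an element of `H₃`. (The value `a 0` only occurs at irrelevant
positions, where `ε` vanishes.) -/
def Equivalent (ε' ε : G → G → ℂ) : Prop :=
  ∃ a : G → ℂ, (∀ k, a k ≠ 0) ∧ ∃ A ∈ H3, ∀ i j,
    ε' i j = a i * a j / a (i + j) * ε (act A i) (act A j)

/-! ### Equations between monomials in the contraction parameters -/

/-- An equation between two products of contraction parameters, each side given by the list of its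
index pairs. -/
structure MonomialEquation where
  lhs : List (G × G)
  rhs : List (G × G)

namespace MonomialEquation

def Holds (e : MonomialEquation) (ε : G → G → ℂ) : Prop :=
  (e.lhs.map fun p => ε p.1 p.2).prod = (e.rhs.map fun p => ε p.1 p.2).prod

/-- The equation obtained by letting a matrix act on all grading indices. -/
def transform (A : Matrix (Fin 2) (Fin 2) (ZMod 3)) (e : MonomialEquation) : MonomialEquation :=
  ⟨e.lhs.map fun p => (act A p.1, act A p.2), e.rhs.map fun p => (act A p.1, act A p.2)⟩

/-- One side of an equation as a product of independent variables: the multiset of its unordered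
index pairs. -/
def side (l : List (G × G)) : Multiset (Sym2 G) := (l.map fun p => s(p.1, p.2) : List (Sym2 G))

/-- The equation up to the symmetry `ε_{ij} = ε_{ji}`, the order of factors and the order of the two
sides; used to count equations. -/
def unordered (e : MonomialEquation) : Sym2 (Multiset (Sym2 G)) := s(side e.lhs, side e.rhs)

/-- The orbit of a list of representative equations under `SL(2,ℤ₃)`. -/
def orbits (l : List MonomialEquation) : Set MonomialEquation :=
  {e | ∃ A : Matrix (Fin 2) (Fin 2) (ZMod 3), A.det = 1 ∧ ∃ r ∈ l, e = r.transform A}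

end MonomialEquation

open MonomialEquation in
/-- The two-term contraction equations: the orbits of
`ε_{(02)(10)} ε_{(01)(12)} = ε_{(01)(10)} ε_{(02)(11)}` and
`ε_{(10)(11)} ε_{(01)(21)} = ε_{(01)(11)} ε_{(10)(12)}`. -/
def contractionEquations : Set MonomialEquation := orbits
  [⟨[((0, 2), (1, 0)), ((0, 1), (1, 2))], [((0, 1), (1, 0)), ((0, 2), (1, 1))]⟩,
   ⟨[((1, 0), (1, 1)), ((0, 1), (2, 1))], [((0, 1), (1, 1)), ((1, 0), (1, 2))]⟩]

open MonomialEquation in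
/-- The second-order identities. -/
def secondOrderIdentities : Set MonomialEquation := orbits
  [⟨[((0, 1), (1, 0)), ((0, 2), (1, 1))], [((0, 1), (2, 0)), ((0, 2), (2, 1))]⟩]

open MonomialEquation in
/-- The third-order identities. -/
def thirdOrderIdentities : Set MonomialEquation := orbits
  [⟨[((0, 1), (1, 0)), ((0, 1), (1, 1)), ((0, 1), (1, 2))],
    [((0, 1), (2, 0)), ((0, 1), (2, 2)), ((0, 1), (2, 1))]⟩,
   ⟨[((0, 1), (1, 0)), ((0, 1), (1, 2)), ((0, 2), (2, 1))],
    [((0, 1), (2, 2)), ((0, 1), (2, 1)), ((0, 2), (1, 2))]⟩,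
   ⟨[((0, 1), (1, 0)), ((0, 1), (1, 1)), ((0, 2), (2, 1))],
    [((0, 1), (2, 2)), ((0, 1), (2, 1)), ((0, 2), (1, 0))]⟩,
   ⟨[((0, 1), (1, 0)), ((0, 1), (1, 1)), ((0, 2), (2, 2))],
    [((0, 1), (2, 0)), ((0, 1), (2, 2)), ((0, 2), (1, 0))]⟩]

/-- All relevant entries of `ε` are non-zero. -/
def NoZeros (ε : G → G → ℂ) : Prop := ∀ i j, Relevant i j → ε i j ≠ 0

/-- A higher-order identity of order `k`: an equation between two products of `k` relevant
parameters, with disjoint index sets, that holds for all solutions without zeros on relevant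
positions and is violated by some solution with a zero on a relevant position. -/
def IsHigherOrderIdentity (k : ℕ) (e : MonomialEquation) : Prop :=
  e.lhs.length = k ∧ e.rhs.length = k ∧ (∀ p ∈ e.lhs ++ e.rhs, Relevant p.1 p.2) ∧
  Disjoint (MonomialEquation.side e.lhs) (MonomialEquation.side e.rhs) ∧
  (∀ ε, IsSolution ε → NoZeros ε → e.Holds ε) ∧
  ∃ ε, IsSolution ε ∧ ¬ NoZeros ε ∧ ¬ e.Holds ε

/-! ### Continuous and discrete contractions -/

/-- `γ t`, `0 < t ≤ 1`, is a continuous family of solutions without zeros on relevant positions,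
with all relevant entries equal to `1` at `t = 1` and with limit `ε` as `t → 0`. -/
def IsContractionPath (γ : ℝ → G → G → ℂ) (ε : G → G → ℂ) : Prop :=
  (∀ t ∈ Set.Ioc (0 : ℝ) 1, IsSolution (γ t)) ∧
  ∀ i j, Relevant i j →
    ContinuousOn (fun t => γ t i j) (Set.Ioc 0 1) ∧ γ 1 i j = 1 ∧
    (∀ t ∈ Set.Ioc (0 : ℝ) 1, γ t i j ≠ 0) ∧ Tendsto (fun t => γ t i j) (𝓝[>] 0) (𝓝 (ε i j))

def IsContinuousSolution (ε : G → G → ℂ) : Prop := IsSolution ε ∧ ∃ γ, IsContractionPath γ ε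

def IsDiscreteSolution (ε : G → G → ℂ) : Prop := IsSolution ε ∧ ¬ ∃ γ, IsContractionPath γ ε

/-- The matrix with relevant entries `t ^ (n_i + n_j - n_{i+j})`. -/
noncomputable def powerPath (n : G → ℤ) (t : ℝ) (i j : G) : ℂ :=
  if Relevant i j then (t : ℂ) ^ (n i + n j - n (i + j)) else 0

/-- Generalized Inönü–Wigner contractions. -/
def IsGeneralizedInonuWigner (ε : G → G → ℂ) : Prop :=
  IsSolution ε ∧ ∃ n : G → ℤ, IsContractionPath (powerPath n) ε

/-! ### The list of solutions -/

/-- The number of a grading index in the ordering `01, 02, 10, 20, 11, 22, 12, 21` of the rows and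
columns of a contraction matrix. -/
def pos (p : G) : ℕ :=
  match p.1.val, p.2.val with
  | 0, 1 => 1
  | 0, 2 => 2
  | 1, 0 => 3
  | 2, 0 => 4
  | 1, 1 => 5
  | 2, 2 => 6
  | 1, 2 => 7
  | 2, 1 => 8
  | _, _ => 0

/-- The position of an unordered pair of grading indices, as a two-digit number `mn`: row `m` and
column `n`, above the diagonal. -/
def position (i j : G) : ℕ := 10 * min (pos i) (pos j) + max (pos i) (pos j)

/-- The number of zeros among the 24 relevant parameters. -/
noncomputable def numZeros (ε : G → G → ℂ) : ℕ :=
  {p : G × G | Relevant p.1 p.2 ∧ pos p.1 < pos p.2 ∧ ε p.1 p.2 = 0}.ncard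

/-- The admissible values of the complex parameters: non-zero, or non-zero with moreover
`Re b > 0`, or `Re b = 0` and `Im b > 0`. -/
inductive ParameterRange
  | nonzero
  | upperHalfB

/-- The type of a listed solution: continuous, discrete, or continuous exactly when all its
parameters are equal to `1`. -/
inductive Kind
  | continuous
  | discrete
  | continuousAtOne

/-- A listed solution `ε^{ν,i}` with `ν` zeros: the positions of its entries `1`, `a`, `b` above the
diagonal; all other entries above the diagonal are zero. -/
structure Listed where
  ν : ℕ
  i : ℕ
  ones : List ℕ
  as : List ℕ
  bs : List ℕ
  range : ParameterRange
  kind : Kind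

namespace Listed

/-- The contraction matrix for given parameter values. -/
def matrix (s : Listed) (a b : ℂ) (i j : G) : ℂ :=
  if position i j ∈ s.ones then 1
  else if position i j ∈ s.as then a
  else if position i j ∈ s.bs then b
  else 0

/-- The number of parameters on which the listed matrix depends. -/
def numParameters (s : Listed) : ℕ :=
  (if s.as = [] then 0 else 1) + (if s.bs = [] then 0 else 1)

/-- `(a, b)` is an admissible parameter value. A parameter that does not occur in the matrix is
given the dummy value `1`. -/
def Admissible (s : Listed) (a b : ℂ) : Prop :=
  a ≠ 0 ∧ b ≠ 0 ∧ (s.as = [] → a = 1) ∧ (s.bs = [] → b = 1) ∧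
  match s.range with
  | .nonzero => True
  | .upperHalfB => 0 < b.re ∨ (b.re = 0 ∧ 0 < b.im)

/-- The mark of the listed solution at given parameter values is "continuous". -/
def MarkedContinuous (s : Listed) (a b : ℂ) : Prop :=
  match s.kind with
  | .continuous => True
  | .discrete => False
  | .continuousAtOne => a = 1 ∧ b = 1

end Listed

/-- A listed non-parametric continuous solution. -/
def cont (ν i : ℕ) (ones : List ℕ) : Listed := ⟨ν, i, ones, [], [], .nonzero, .continuous⟩

/-- A listed non-parametric discrete solution. -/
def disc (ν i : ℕ) (ones : List ℕ) : Listed := ⟨ν, i, ones, [], [], .nonzero, .discrete⟩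

/-- The list of solutions. The two trivial solutions `ε^{0,1}` (no zeros) and `ε^{24,1}` (only zeros)
are the first and the last entry. -/
def solutionList : List Listed :=
  [cont 0 1 [13, 14, 15, 16, 17, 18, 23, 24, 25, 26, 27, 28, 35, 36, 37, 38, 45, 46, 47, 48, 57, 58, 67, 68],
   cont 9 1 [13, 14, 15, 16, 17, 18, 23, 24, 25, 26, 27, 28, 46, 48, 68],
   cont 12 1 [13, 14, 15, 16, 17, 18, 36, 46, 47, 48, 58, 68],
   ⟨12, 2, [13, 23, 24, 35, 38, 46], [14, 45, 48], [36, 37, 47], .upperHalfB, .continuousAtOne⟩,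
   cont 15 1 [13, 14, 15, 16, 17, 18, 46, 48, 68],
   cont 15 2 [13, 14, 16, 17, 26, 27, 46, 48, 68],
   cont 15 3 [13, 14, 16, 17, 36, 46, 47, 48, 68],
   cont 15 4 [13, 16, 26, 27, 36, 46, 48, 67, 68],
   ⟨15, 5, [14, 15, 16, 23, 26, 36, 46], [13], [35], .nonzero, .continuousAtOne⟩,
   ⟨15, 6, [13, 23, 24, 35, 36, 37, 46, 47], [14], [], .nonzero, .discrete⟩,
   ⟨15, 7, [23, 24, 35, 36, 37, 38, 46, 47], [13], [], .nonzero, .discrete⟩,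
   ⟨16, 1, [13, 16, 17, 18, 27, 48, 68], [28], [], .nonzero, .continuousAtOne⟩,
   ⟨16, 2, [14, 15, 16, 23, 26, 35, 36], [13], [], .nonzero, .discrete⟩,
   ⟨16, 3, [14, 15, 16, 23, 26, 35, 46], [13], [], .nonzero, .discrete⟩,
   disc 16 4 [13, 14, 15, 23, 24, 26, 35, 46],
   disc 16 5 [13, 14, 23, 24, 35, 38, 45, 48],
   disc 16 6 [13, 23, 24, 35, 36, 37, 46, 47],
   disc 16 7 [13, 14, 23, 35, 38, 45, 46, 48],
   cont 17 1 [13, 14, 16, 17, 46, 48, 68],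
   cont 17 2 [13, 16, 17, 36, 47, 48, 68],
   disc 17 3 [13, 16, 17, 18, 27, 48, 68],
   disc 17 4 [13, 16, 17, 18, 28, 48, 68],
   disc 17 5 [13, 16, 17, 27, 28, 48, 68],
   cont 17 6 [13, 16, 26, 27, 46, 48, 68],
   ⟨17, 7, [14, 15, 16, 23, 26, 35], [13], [], .nonzero, .continuousAtOne⟩,
   disc 17 8 [13, 14, 15, 16, 23, 35, 36],
   disc 17 9 [13, 14, 15, 16, 23, 35, 46],
   disc 17 10 [13, 14, 15, 16, 26, 35, 36],
   disc 17 11 [13, 14, 15, 16, 35, 36, 46],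
   disc 17 12 [13, 14, 16, 23, 26, 35, 46],
   ⟨17, 13, [14, 16, 23, 35, 36, 46], [13], [], .nonzero, .discrete⟩,
   disc 17 14 [13, 14, 15, 23, 26, 35, 46],
   disc 17 15 [13, 14, 15, 23, 24, 26, 35],
   disc 17 16 [13, 14, 15, 24, 26, 35, 46],
   disc 17 17 [13, 14, 23, 35, 38, 45, 48],
   cont 18 1 [13, 16, 17, 18, 48, 68],
   cont 18 2 [13, 16, 17, 27, 48, 68],
   disc 18 3 [13, 16, 17, 28, 48, 68],
   disc 18 4 [13, 16, 18, 27, 48, 68],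
   cont 18 5 [13, 16, 36, 46, 48, 68],
   disc 18 6 [13, 14, 15, 16, 23, 35],
   disc 18 7 [13, 14, 15, 16, 26, 35],
   cont 18 8 [13, 14, 15, 16, 35, 36],
   disc 18 9 [13, 14, 15, 16, 35, 46],
   disc 18 10 [13, 14, 16, 23, 26, 35],
   disc 18 11 [13, 14, 16, 23, 35, 36],
   disc 18 12 [13, 14, 16, 23, 35, 46],
   cont 18 13 [13, 14, 16, 26, 35, 36],
   disc 18 14 [13, 14, 16, 26, 35, 46],
   disc 18 15 [13, 14, 16, 35, 36, 46],
   disc 18 16 [13, 15, 16, 23, 26, 35],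
   disc 18 17 [13, 16, 23, 26, 35, 46],
   disc 18 18 [13, 14, 15, 23, 26, 35],
   disc 18 19 [13, 14, 15, 23, 24, 35],
   disc 18 20 [13, 14, 15, 26, 35, 46],
   disc 18 21 [13, 14, 15, 24, 26, 35],
   disc 18 22 [13, 14, 15, 24, 35, 46],
   disc 18 23 [13, 15, 24, 26, 35, 46],
   disc 18 24 [13, 14, 23, 26, 35, 46],
   ⟨18, 25, [13, 23, 24, 35, 37], [14], [], .nonzero, .continuousAtOne⟩,
   disc 18 26 [13, 14, 23, 24, 35, 46],
   disc 18 27 [13, 23, 24, 35, 37, 38],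
   disc 18 28 [13, 23, 24, 35, 38, 46],
   ⟨18, 29, [13, 35, 36, 37, 38], [23], [], .nonzero, .continuousAtOne⟩,
   ⟨18, 30, [13, 14, 35, 36, 46], [23], [], .nonzero, .continuousAtOne⟩,
   disc 18 31 [13, 14, 24, 35, 37, 47],
   disc 18 32 [13, 24, 35, 38, 46, 47],
   ⟨18, 33, [13, 35, 36, 37, 47], [14], [], .nonzero, .continuousAtOne⟩,
   disc 18 34 [13, 14, 35, 38, 45, 48],
   cont 18 35 [13, 18, 24, 27, 37, 48],
   disc 18 36 [13, 14, 23, 24, 26, 35],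
   cont 19 1 [13, 16, 17, 48, 68],
   cont 19 2 [13, 16, 18, 48, 68],
   cont 19 3 [13, 16, 27, 48, 68],
   cont 19 4 [13, 16, 46, 48, 68],
   cont 19 5 [13, 14, 15, 16, 35],
   disc 19 6 [13, 14, 16, 23, 35],
   cont 19 7 [13, 14, 16, 26, 35],
   cont 19 8 [13, 14, 16, 35, 36],
   disc 19 9 [13, 14, 16, 35, 46],
   cont 19 10 [13, 15, 16, 23, 35],
   disc 19 11 [13, 15, 16, 26, 35],
   cont 19 12 [13, 15, 16, 35, 36],
   cont 19 13 [13, 16, 23, 26, 35],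
   cont 19 14 [13, 16, 23, 35, 36],
   disc 19 15 [13, 16, 23, 35, 46],
   disc 19 16 [13, 16, 35, 36, 46],
   cont 19 17 [13, 14, 15, 23, 35],
   disc 19 18 [13, 14, 15, 26, 35],
   disc 19 19 [13, 14, 15, 35, 46],
   disc 19 20 [13, 14, 15, 24, 35],
   disc 19 21 [13, 15, 26, 35, 46],
   disc 19 22 [13, 15, 24, 26, 35],
   disc 19 23 [13, 14, 26, 35, 46],
   disc 19 24 [13, 23, 26, 35, 46],
   disc 19 25 [13, 14, 23, 24, 35],
   disc 19 26 [13, 23, 24, 35, 37],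
   disc 19 27 [13, 23, 24, 35, 38],
   disc 19 28 [13, 23, 24, 35, 46],
   disc 19 29 [13, 23, 35, 36, 37],
   disc 19 30 [13, 14, 23, 35, 36],
   disc 19 31 [13, 14, 23, 35, 46],
   disc 19 32 [13, 23, 35, 38, 46],
   disc 19 33 [13, 14, 24, 35, 37],
   disc 19 34 [13, 24, 35, 37, 47],
   disc 19 35 [13, 14, 24, 35, 47],
   disc 19 36 [13, 24, 35, 38, 46],
   disc 19 37 [13, 14, 35, 36, 37],
   disc 19 38 [13, 14, 35, 37, 47],
   disc 19 39 [13, 14, 35, 36, 47],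
   disc 19 40 [13, 14, 35, 36, 46],
   cont 19 41 [13, 14, 23, 26, 46],
   cont 19 42 [13, 18, 24, 27, 37],
   cont 19 43 [13, 14, 23, 26, 35],
   disc 19 44 [13, 14, 24, 26, 35],
   disc 19 45 [13, 23, 24, 26, 35],
   cont 20 1 [13, 16, 48, 68],
   cont 20 2 [13, 14, 16, 35],
   cont 20 3 [13, 15, 16, 35],
   cont 20 4 [13, 16, 23, 35],
   cont 20 5 [13, 16, 26, 35],
   cont 20 6 [13, 16, 35, 36],
   disc 20 7 [13, 16, 35, 46],
   cont 20 8 [13, 14, 15, 35],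
   disc 20 9 [13, 15, 26, 35],
   disc 20 10 [13, 15, 24, 35],
   disc 20 11 [13, 26, 35, 46],
   disc 20 12 [13, 23, 24, 35],
   cont 20 13 [13, 23, 35, 37],
   cont 20 14 [13, 14, 23, 35],
   cont 20 15 [13, 23, 35, 36],
   disc 20 16 [13, 23, 35, 38],
   disc 20 17 [13, 23, 35, 46],
   disc 20 18 [13, 24, 35, 37],
   disc 20 19 [13, 14, 24, 35],
   disc 20 20 [13, 24, 35, 38],
   disc 20 21 [13, 24, 35, 46],
   disc 20 22 [13, 24, 35, 47],
   cont 20 23 [13, 14, 35, 37],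
   cont 20 24 [13, 35, 36, 37],
   disc 20 25 [13, 35, 37, 47],
   disc 20 26 [13, 14, 35, 47],
   disc 20 27 [13, 35, 36, 47],
   cont 20 28 [13, 14, 35, 36],
   disc 20 29 [13, 14, 35, 46],
   disc 20 30 [13, 35, 36, 46],
   cont 20 31 [13, 16, 26, 27],
   cont 20 32 [13, 14, 26, 27],
   cont 20 33 [13, 16, 23, 26],
   cont 20 34 [13, 14, 23, 26],
   cont 20 35 [13, 14, 26, 46],
   cont 20 36 [13, 14, 23, 24],
   cont 20 37 [13, 18, 24, 27],
   cont 20 38 [13, 18, 24, 37],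
   cont 20 39 [13, 18, 24, 48],
   cont 20 40 [13, 14, 26, 35],
   cont 20 41 [13, 23, 26, 35],
   disc 20 42 [13, 24, 26, 35],
   cont 21 1 [13, 16, 35],
   cont 21 2 [13, 15, 35],
   cont 21 3 [13, 23, 35],
   disc 21 4 [13, 24, 35],
   cont 21 5 [13, 35, 37],
   disc 21 6 [13, 35, 47],
   cont 21 7 [13, 14, 35],
   cont 21 8 [13, 35, 36],
   disc 21 9 [13, 35, 38],
   disc 21 10 [13, 35, 46],
   cont 21 11 [13, 26, 27],
   cont 21 12 [13, 16, 26],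
   cont 21 13 [13, 14, 26],
   cont 21 14 [13, 23, 26],
   cont 21 15 [13, 26, 46],
   cont 21 16 [13, 16, 36],
   cont 21 17 [13, 14, 23],
   cont 21 18 [13, 18, 24],
   cont 21 19 [13, 18, 37],
   cont 21 20 [13, 27, 48],
   cont 21 21 [13, 26, 35],
   cont 22 1 [13, 35],
   cont 22 2 [13, 26],
   cont 22 3 [13, 16],
   cont 22 4 [13, 14],
   cont 22 5 [13, 18],
   cont 22 6 [13, 24],
   cont 22 7 [13, 27],
   cont 23 1 [13],
   cont 24 1 []]

/-- The trivial solution, with all relevant entries equal to `1`. -/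
def trivialSolution (i j : G) : ℂ := if Relevant i j then 1 else 0

end PauliContraction

/-!
The contracted bracket on the Pauli grading of `sl(3, ℂ)`: proof of the classification.

*The contraction system.* Since `[X_i, X_j] = c_{ij} X_{i+j}` with `c_{ij} = 0` exactly for
irrelevant pairs, the contracted Jacobi identity of a triple is a linear relation between three
products of two entries of `ε`, whose coefficients add up to `0` by the Jacobi identity of `sl(3, ℂ)`.
For every triple one of the three coefficients vanishes, so either nothing or the equality of two
products remains. This gives the 48 equations (`isSolution_iff_twoTerm`,
`holds_contractionEquations_iff`); they are compatible with normalization and with `H₃`.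

*Supports.* A two-term equation has no or two vanishing sides. This condition restricts the possible
sets of non-zero entries, which are found by a search evaluated in the kernel (`search_supports`,
`search_sound`): up to `H₃` they are the supports of the 188 listed matrices, which are pairwise
inequivalent (`existsUnique_supportMatches`). As `H₃` is transitive on relevant pairs, the search
need only consider supports containing the position `13`.

*Normal forms.* Fix the support of a listed matrix. There are positions in it at which the entries can
be prescribed freely by choosing the normalization `a_k` and the parameters: taking logarithms, this
is a linear system, and the integer rows of exponents are linearly independent
(`exists_solution_of_independentRows`). From these entries the others follow by the two-term
equations, as three entries of an equation without zeros determine the fourth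
(`exists_freePositions`). Hence a solution is a normalization of the listed matrix with the same
support (`exists_normalForm`). Only for the entry with `Re b > 0` or `Re b = 0 < Im b` must the
parameters be adjusted, by passing from `(a, b)` to `(-a, -b)` (`matrix_neg_parameters`).

*Higher-order identities.* Solutions without zeros are normalizations of the trivial solution, and on
these the identities hold because the indices cancel. By continuity they pass to limits, so a violated
identity excludes a contraction path (`holds_of_isContractionPath`). Conversely, for the continuous
entries exponents of a generalized Inönü–Wigner contraction are given explicitly
(`contractionExponents`). Finally, the quotient of the two sides of an identity is invariant under
normalization. For each parameter there is an identity for which this quotient is a non-zero power of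
it, which leaves finitely many values in an equivalence class (`finite_equivalent_parameters`).
-/

namespace PauliContraction

/-! ### The contracted Jacobi identity as a system of two-term equations -/

theorem isPrimitiveRoot_ω : IsPrimitiveRoot ω 3 := by
  simpa [ω] using Complex.isPrimitiveRoot_exp 3 (by norm_num)

/-- The character `x ↦ ω ^ x` of `ℤ₃`. -/
noncomputable def character (x : ZMod 3) : ℂ := ω ^ x.val

theorem character_injective : Function.Injective character := fun x y h =>
  ZMod.val_injective 3 (isPrimitiveRoot_ω.pow_inj (ZMod.val_lt x) (ZMod.val_lt y) h)

theorem character_ne_zero (x : ZMod 3) : character x ≠ 0 :=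
  pow_ne_zero _ (isPrimitiveRoot_ω.ne_zero (by norm_num))

theorem Q_pow_three : Q ^ 3 = 1 := by
  have h := isPrimitiveRoot_ω.pow_eq_one
  have h' : (ω ^ 2 * ω ^ 2) * ω ^ 2 = 1 := by linear_combination (ω ^ 3 + 1) * h
  ext i j
  fin_cases i <;> fin_cases j <;> simp [Q, pow_succ, Matrix.mul_apply, Fin.sum_univ_three]
  · linear_combination h
  · linear_combination h'

theorem P_pow_three : P ^ 3 = 1 := by
  ext i j
  fin_cases i <;> fin_cases j <;> simp [P, pow_succ, Matrix.mul_apply, Fin.sum_univ_three]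

theorem P_mul_Q : P * Q = ω • (Q * P) := by
  have h := isPrimitiveRoot_ω.pow_eq_one
  ext i j
  fin_cases i <;> fin_cases j <;> simp [P, Q, Matrix.mul_apply, Fin.sum_univ_three]
  · ring
  · linear_combination -h

theorem P_pow_mul_Q (s : ℕ) : P ^ s * Q = ω ^ s • (Q * P ^ s) := by
  induction s with
  | zero => simp
  | succ s ih =>
    rw [pow_succ', mul_assoc, ih, mul_smul_comm, ← mul_assoc, P_mul_Q, smul_mul_assoc, smul_smul,
      mul_assoc, ← pow_succ]

theorem P_pow_mul_Q_pow (s r : ℕ) : P ^ s * Q ^ r = ω ^ (s * r) • (Q ^ r * P ^ s) := by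
  induction r with
  | zero => simp
  | succ r ih =>
    rw [pow_succ, ← mul_assoc, ih, smul_mul_assoc, mul_assoc, P_pow_mul_Q, mul_smul_comm, smul_smul,
      ← mul_assoc, ← pow_add, mul_add_one]

theorem X_mul_X (i j : G) : X i * X j = character (i.2 * j.1) • X (i + j) := by
  have h3 := isPrimitiveRoot_ω.pow_eq_one
  rw [X, X, mul_assoc, ← mul_assoc (P ^ _), P_pow_mul_Q_pow, smul_mul_assoc, mul_smul_comm,
    mul_assoc, ← mul_assoc, ← pow_add, ← pow_add, X, Prod.fst_add, Prod.snd_add, ZMod.val_add,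
    ZMod.val_add, ← pow_eq_pow_mod _ Q_pow_three, ← pow_eq_pow_mod _ P_pow_three, character,
    ZMod.val_mul, ← pow_eq_pow_mod _ h3]

theorem X_ne_zero (i : G) : X i ≠ 0 := by
  intro h
  have h1 := X_mul_X i (-i)
  rw [h, zero_mul, add_neg_cancel] at h1
  have h2 : X 0 = 1 := by simp [X]
  rw [h2] at h1
  exact smul_ne_zero (character_ne_zero _) one_ne_zero h1.symm

/-- The structure constants: `[X_i, X_j] = c_{ij} X_{i+j}`. -/
noncomputable def structureConstant (i j : G) : ℂ := character (i.2 * j.1) - character (j.2 * i.1)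

theorem lie_X (i j : G) : ⁅X i, X j⁆ = structureConstant i j • X (i + j) := by
  rw [Ring.lie_def, X_mul_X, X_mul_X, add_comm j i, structureConstant, sub_smul]

theorem structureConstant_eq_zero_iff (i j : G) : structureConstant i j = 0 ↔ ¬ Relevant i j := by
  rw [structureConstant, sub_eq_zero, character_injective.eq_iff, Relevant, not_not, sub_eq_zero,
    mul_comm j.2]

theorem structureConstant_mul_eq_zero {i j k : G} (h : ¬ (Relevant i j ∧ Relevant k (i + j))) :
    structureConstant i j * structureConstant k (i + j) = 0 := by
  rcases not_and_or.1 h with h | h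
  · rw [(structureConstant_eq_zero_iff _ _).2 h, zero_mul]
  · rw [(structureConstant_eq_zero_iff _ _).2 h, mul_zero]

theorem lie_lie_X (i j k : G) : ⁅X i, ⁅X j, X k⁆⁆ =
    (structureConstant j k * structureConstant i (j + k)) • X (i + j + k) := by
  rw [lie_X, Ring.lie_def, mul_smul_comm, smul_mul_assoc, ← smul_sub, ← Ring.lie_def, lie_X,
    smul_smul, add_assoc]

theorem structureConstant_jacobi (i j k : G) :
    structureConstant j k * structureConstant i (j + k) +
    structureConstant i j * structureConstant k (i + j) +
    structureConstant k i * structureConstant j (k + i) = 0 := by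
  have h : ⁅X i, ⁅X j, X k⁆⁆ + ⁅X j, ⁅X k, X i⁆⁆ + ⁅X k, ⁅X i, X j⁆⁆ = 0 := by
    simp only [Ring.lie_def]
    noncomm_ring
  rw [lie_lie_X, lie_lie_X, lie_lie_X, show j + k + i = i + j + k by abel,
    show k + i + j = i + j + k by abel, ← add_smul, ← add_smul] at h
  have := (smul_eq_zero.1 h).resolve_right (X_ne_zero _)
  linear_combination this

/-- The scalar form of the contracted Jacobi identity. -/
theorem nestedBracket_sum_eq_zero_iff (ε : G → G → ℂ) (i j k : G) :
    nestedBracket ε i j k + nestedBracket ε k i j + nestedBracket ε j k i = 0 ↔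
    ε j k * ε i (j + k) * (structureConstant j k * structureConstant i (j + k)) +
    ε i j * ε k (i + j) * (structureConstant i j * structureConstant k (i + j)) +
    ε k i * ε j (k + i) * (structureConstant k i * structureConstant j (k + i)) = 0 := by
  simp only [nestedBracket, lie_lie_X, show k + i + j = i + j + k by abel,
    show j + k + i = i + j + k by abel, smul_smul, ← add_smul, smul_eq_zero, X_ne_zero, or_false]

/-- The two families of two-term equations, in a form that does not depend on coordinates: the
contracted Jacobi identity for the triples `(j, i, -i)` and `(i + j, i, j)`. -/
def TwoTerm (ε : G → G → ℂ) (i j : G) : Prop :=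
  ε i j * ε (-i) (i + j) = ε (-i) j * ε i (j - i) ∧
  ε i (i + j) * ε j (2 * i + j) = ε j (i + j) * ε i (i + 2 * j)

/-- For every triple one of the three terms of the Jacobi identity vanishes. -/
theorem exists_irrelevant_nestedBracket : ∀ i j k : G,
    ¬ (Relevant j k ∧ Relevant i (j + k)) ∨ ¬ (Relevant i j ∧ Relevant k (i + j)) ∨
    ¬ (Relevant k i ∧ Relevant j (k + i)) := by decide +kernel

set_option synthInstance.maxSize 1000 in
/-- The triples for which only the first term of the Jacobi identity vanishes: for `j = k` the two
others agree by symmetry of `ε`, and the remaining cases give the two families of equations. -/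
theorem triple_of_two_relevant_nestedBrackets : ∀ i j k : G, i ≠ 0 → j ≠ 0 → k ≠ 0 →
    ¬ (Relevant j k ∧ Relevant i (j + k)) → (Relevant i j ∧ Relevant k (i + j)) →
    (Relevant k i ∧ Relevant j (k + i)) →
    j = k ∨ (k = -j ∧ Relevant j i) ∨ (i = j + k ∧ Relevant j k) := by decide +kernel

theorem relevant_neg_self : ∀ i : G, ¬ Relevant i (-i) ∧ ¬ Relevant i i := by decide +kernel

theorem relevant_comm : ∀ i j : G, Relevant i j ↔ Relevant j i := by decide +kernel

theorem relevant_of_relevant : ∀ i j : G, Relevant i j → i ≠ 0 ∧ j ≠ 0 ∧ i + j ≠ 0 ∧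
    Relevant (-i) j ∧ Relevant (-i) (i + j) ∧ Relevant i (j - i) ∧ Relevant i (i + j) ∧
    Relevant j (i + j) ∧ Relevant j (2 * i + j) ∧ Relevant i (i + 2 * j) := by decide +kernel

/-- If the first term of the Jacobi identity vanishes, the coefficients of the two others are opposite,
and the two-term equations make these terms cancel. -/
theorem two_nestedBrackets_of_twoTerm {ε : G → G → ℂ} (h : IsContractionMatrix ε)
    (hT : ∀ i j, Relevant i j → TwoTerm ε i j) {i j k : G} (hi : i ≠ 0) (hj : j ≠ 0) (hk : k ≠ 0)
    (h0 : ¬ (Relevant j k ∧ Relevant i (j + k))) :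
    ε i j * ε k (i + j) * (structureConstant i j * structureConstant k (i + j)) +
    ε k i * ε j (k + i) * (structureConstant k i * structureConstant j (k + i)) = 0 := by
  have hJ := structureConstant_jacobi i j k
  rw [structureConstant_mul_eq_zero h0, zero_add] at hJ
  by_cases h2 : Relevant i j ∧ Relevant k (i + j)
  · by_cases h3 : Relevant k i ∧ Relevant j (k + i)
    · have key : ε i j * ε k (i + j) = ε k i * ε j (k + i) := by
        rcases triple_of_two_relevant_nestedBrackets i j k hi hj hk h0 h2 h3 with
          rfl | ⟨rfl, hr⟩ | ⟨rfl, hr⟩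
        · rw [h.1 i j, add_comm i j]
        · have := (hT j i hr).1
          rw [h.1 i j, add_comm i j, this, neg_add_eq_sub]
        · have := (hT j k hr).2
          rw [h.1 (j + k) j, show j + k + j = 2 * j + k by ring, this,
            show k + (j + k) = j + 2 * k by ring]
      linear_combination (structureConstant i j * structureConstant k (i + j)) * key +
        ε k i * ε j (k + i) * hJ
    · have h3' := structureConstant_mul_eq_zero h3
      rw [h3', add_zero] at hJ
      rw [h3', hJ, mul_zero, mul_zero, add_zero]
  · have h2' := structureConstant_mul_eq_zero h2
    rw [h2', zero_add] at hJ
    rw [h2', hJ, mul_zero, mul_zero, add_zero]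

/-- The contraction system consists of two-term equations: in the Jacobi identity of three Pauli
matrices one term always vanishes, so the other two have opposite coefficients. -/
theorem isSolution_iff_twoTerm (ε : G → G → ℂ) :
    IsSolution ε ↔ IsContractionMatrix ε ∧ ∀ i j, Relevant i j → TwoTerm ε i j := by
  constructor
  · rintro ⟨h, hJ⟩
    refine ⟨h, fun i j hr => ?_⟩
    obtain ⟨hi, hj, hij, r1, r2, r3, r4, r5, r6, r7⟩ := relevant_of_relevant i j hr
    have hne : ∀ {x y : G}, Relevant x y → structureConstant x y ≠ 0 := fun {x y} hxy h0 =>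
      (structureConstant_eq_zero_iff x y).1 h0 hxy
    constructor
    · have h1 := (nestedBracket_sum_eq_zero_iff ε j i (-i)).1
        (hJ j i (-i) hj hi (neg_ne_zero.2 hi))
      have h2 := structureConstant_jacobi j i (-i)
      rw [(structureConstant_eq_zero_iff i (-i)).2 (relevant_neg_self i).1] at h1 h2
      rw [show j + i = i + j by abel, show -i + j = j - i by abel] at h1 h2
      have h3 : structureConstant j i * structureConstant (-i) (i + j) ≠ 0 :=
        mul_ne_zero (hne ((relevant_comm _ _).1 hr)) (hne r2)
      refine mul_left_cancel₀ h3 ?_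
      rw [h.1 i j]
      linear_combination h1 - ε (-i) j * ε i (j - i) * h2
    · have h1 := (nestedBracket_sum_eq_zero_iff ε (i + j) i j).1 (hJ (i + j) i j hij hi hj)
      have h2 := structureConstant_jacobi (i + j) i j
      rw [(structureConstant_eq_zero_iff (i + j) (i + j)).2 (relevant_neg_self _).2] at h1 h2
      rw [show i + j + i = 2 * i + j by ring, show j + (i + j) = i + 2 * j by ring] at h1 h2
      have h3 : structureConstant (i + j) i * structureConstant j (2 * i + j) ≠ 0 :=
        mul_ne_zero (hne ((relevant_comm _ _).1 r4)) (hne r6)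
      refine mul_left_cancel₀ h3 ?_
      rw [h.1 i (i + j)]
      linear_combination h1 - ε j (i + j) * ε i (i + 2 * j) * h2
  · rintro ⟨h, hT⟩
    refine ⟨h, fun i j k hi hj hk => (nestedBracket_sum_eq_zero_iff ε i j k).2 ?_⟩
    rcases exists_irrelevant_nestedBracket i j k with h0 | h0 | h0
    · linear_combination two_nestedBrackets_of_twoTerm h hT hi hj hk h0 +
        ε j k * ε i (j + k) * structureConstant_mul_eq_zero h0
    · linear_combination two_nestedBrackets_of_twoTerm h hT hk hi hj h0 +
        ε i j * ε k (i + j) * structureConstant_mul_eq_zero h0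
    · linear_combination two_nestedBrackets_of_twoTerm h hT hj hk hi h0 +
        ε k i * ε j (k + i) * structureConstant_mul_eq_zero h0

/-! ### The two families as orbits under `SL(2, ℤ₃)` -/

theorem act_rows (A : Matrix (Fin 2) (Fin 2) (ZMod 3)) (p : G) :
    act A p = (p.1 * (A 0 0, A 0 1).1 + p.2 * (A 1 0, A 1 1).1,
      p.1 * (A 0 0, A 0 1).2 + p.2 * (A 1 0, A 1 1).2) := rfl

theorem holds_firstEquation_iff (ε : G → G → ℂ) (A : Matrix (Fin 2) (Fin 2) (ZMod 3)) {j k : G}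
    (hj : (A 0 0, A 0 1) = j) (hk : (A 1 0, A 1 1) = k) :
    (MonomialEquation.transform A
      ⟨[((0, 2), (1, 0)), ((0, 1), (1, 2))], [((0, 1), (1, 0)), ((0, 2), (1, 1))]⟩).Holds ε ↔
      ε (-k) j * ε k (j - k) = ε k j * ε (-k) (j + k) := by
  have h2 : (2 : ZMod 3) = -1 := rfl
  subst hj hk
  simp [MonomialEquation.Holds, MonomialEquation.transform, act_rows, h2, sub_eq_add_neg]

theorem holds_secondEquation_iff (ε : G → G → ℂ) (A : Matrix (Fin 2) (Fin 2) (ZMod 3)) {j k : G}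
    (hj : (A 0 0, A 0 1) = j) (hk : (A 1 0, A 1 1) = k) :
    (MonomialEquation.transform A
      ⟨[((1, 0), (1, 1)), ((0, 1), (2, 1))], [((0, 1), (1, 1)), ((1, 0), (1, 2))]⟩).Holds ε ↔
      ε j (j + k) * ε k (2 * j + k) = ε k (j + k) * ε j (j + 2 * k) := by
  subst hj hk
  simp [MonomialEquation.Holds, MonomialEquation.transform, act_rows, Prod.add_def, Prod.mul_def]

theorem relevant_iff_det : ∀ j k : G, Relevant j k ↔
    j.1 * k.2 - j.2 * k.1 = 1 ∨ k.1 * j.2 - k.2 * j.1 = 1 := by decide +kernel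

theorem holds_contractionEquations_iff {ε : G → G → ℂ} :
    (∀ e ∈ contractionEquations, e.Holds ε) ↔ ∀ i j, Relevant i j → TwoTerm ε i j := by
  constructor
  · intro h
    have h12 : ∀ j k : G, j.1 * k.2 - j.2 * k.1 = 1 →
        ε (-k) j * ε k (j - k) = ε k j * ε (-k) (j + k) ∧
        ε j (j + k) * ε k (2 * j + k) = ε k (j + k) * ε j (j + 2 * k) := fun j k hd =>
      have hA : (!![j.1, j.2; k.1, k.2] : Matrix (Fin 2) (Fin 2) (ZMod 3)).det = 1 := by
        rw [Matrix.det_fin_two_of, hd]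
      ⟨(holds_firstEquation_iff ε _ rfl rfl).1 (h _ ⟨_, hA, _, by simp, rfl⟩),
        (holds_secondEquation_iff ε _ rfl rfl).1 (h _ ⟨_, hA, _, by simp, rfl⟩)⟩
    intro i j hr
    have hd := (relevant_iff_det i j).1 hr
    constructor
    · rcases hd with hd | hd
      · have h1 := (h12 j (-i) (by simp only [Prod.fst_neg, Prod.snd_neg]; linear_combination hd)).1
        rw [neg_neg, sub_neg_eq_add, ← sub_eq_add_neg, add_comm j i] at h1
        exact h1
      · have h1 := (h12 j i hd).1
        rw [add_comm j i] at h1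
        exact h1.symm
    · rcases hd with hd | hd
      · exact (h12 i j hd).2
      · have h1 := (h12 j i hd).2
        rw [add_comm j i, add_comm (2 * j), add_comm j] at h1
        exact h1.symm
  · rintro h e ⟨A, hA, r, hr, rfl⟩
    rw [Matrix.det_fin_two] at hA
    have hrel : Relevant (A 0 0, A 0 1) (A 1 0, A 1 1) := (relevant_iff_det _ _).2 (Or.inl hA)
    simp only [List.mem_cons, List.not_mem_nil, or_false] at hr
    rcases hr with rfl | rfl
    · rw [holds_firstEquation_iff ε A rfl rfl]
      have h1 := (h _ _ ((relevant_comm _ _).1 hrel)).1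
      rw [add_comm (A 1 0, A 1 1)] at h1
      exact h1.symm
    · rw [holds_secondEquation_iff ε A rfl rfl]
      exact (h _ _ hrel).2

/-! ### Normalization and the symmetries of the grading -/

theorem act_add (A : Matrix (Fin 2) (Fin 2) (ZMod 3)) (p q : G) :
    act A (p + q) = act A p + act A q := by
  ext <;> simp only [act, Prod.fst_add, Prod.snd_add] <;> ring

theorem act_neg (A : Matrix (Fin 2) (Fin 2) (ZMod 3)) (p : G) : act A (-p) = -act A p := by
  ext <;> simp only [act, Prod.fst_neg, Prod.snd_neg] <;> ring

theorem act_mul (A B : Matrix (Fin 2) (Fin 2) (ZMod 3)) (p : G) :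
    act (A * B) p = act B (act A p) := by
  ext <;> simp only [act, Matrix.mul_apply, Fin.sum_univ_two] <;> ring

theorem act_one (p : G) : act 1 p = p := by
  ext <;> simp [act]

theorem one_mem_H3 : (1 : Matrix (Fin 2) (Fin 2) (ZMod 3)) ∈ H3 := Or.inl Matrix.det_one

theorem mul_mem_H3 {A B : Matrix (Fin 2) (Fin 2) (ZMod 3)} (hA : A ∈ H3) (hB : B ∈ H3) :
    A * B ∈ H3 := by
  rcases hA with hA | hA <;> rcases hB with hB | hB <;> simp [H3, hA, hB]

theorem isUnit_det_of_mem_H3 {A : Matrix (Fin 2) (Fin 2) (ZMod 3)} (hA : A ∈ H3) :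
    IsUnit A.det := by
  rcases hA with hA | hA <;> rw [hA]
  exacts [isUnit_one, isUnit_one.neg]

theorem inv_mem_H3 {A : Matrix (Fin 2) (Fin 2) (ZMod 3)} (hA : A ∈ H3) : A⁻¹ ∈ H3 := by
  have h : A.det * A⁻¹.det = 1 := by
    rw [← Matrix.det_mul, Matrix.mul_nonsing_inv _ (isUnit_det_of_mem_H3 hA), Matrix.det_one]
  rcases hA with hA | hA <;> rw [hA] at h
  · exact Or.inl (by linear_combination h)
  · exact Or.inr (by linear_combination -h)

theorem act_inv_act {A : Matrix (Fin 2) (Fin 2) (ZMod 3)} (hA : A ∈ H3) (p : G) :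
    act A⁻¹ (act A p) = p := by
  rw [← act_mul, Matrix.mul_nonsing_inv _ (isUnit_det_of_mem_H3 hA), act_one]

theorem act_act_inv {A : Matrix (Fin 2) (Fin 2) (ZMod 3)} (hA : A ∈ H3) (p : G) :
    act A (act A⁻¹ p) = p := by
  rw [← act_mul, Matrix.nonsing_inv_mul _ (isUnit_det_of_mem_H3 hA), act_one]

theorem act_injective {A : Matrix (Fin 2) (Fin 2) (ZMod 3)} (hA : A ∈ H3) :
    Function.Injective (act A) := Function.LeftInverse.injective (act_inv_act hA)

theorem relevant_act_iff {A : Matrix (Fin 2) (Fin 2) (ZMod 3)} (hA : A ∈ H3) (i j : G) :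
    Relevant (act A i) (act A j) ↔ Relevant i j := by
  have h : (act A i).2 * (act A j).1 - (act A i).1 * (act A j).2 =
      A.det * (i.2 * j.1 - i.1 * j.2) := by
    simp only [act, Matrix.det_fin_two]
    ring
  rw [Relevant, Relevant, h, Ne, (isUnit_det_of_mem_H3 hA).mul_right_eq_zero]

/-- The matrix `ε^π` for the permutation `π` of the grading indices induced by `A`. -/
def pullback (A : Matrix (Fin 2) (Fin 2) (ZMod 3)) (ε : G → G → ℂ) (i j : G) : ℂ :=
  ε (act A i) (act A j)

/-- The matrix `α • ε` for the normalization matrix `α_{ij} = a_i a_j / a_{i+j}`. -/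
noncomputable def normalize (a : G → ℂ) (ε : G → G → ℂ) (i j : G) : ℂ :=
  a i * a j / a (i + j) * ε i j

theorem equivalent_iff (ε' ε : G → G → ℂ) : Equivalent ε' ε ↔
    ∃ a : G → ℂ, (∀ k, a k ≠ 0) ∧ ∃ A ∈ H3, ε' = normalize a (pullback A ε) := by
  simp only [Equivalent, funext_iff, normalize, pullback]

theorem IsSolution.pullback {A : Matrix (Fin 2) (Fin 2) (ZMod 3)} (hA : A ∈ H3) {ε : G → G → ℂ}
    (h : IsSolution ε) : IsSolution (pullback A ε) := by
  rw [isSolution_iff_twoTerm] at h ⊢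
  refine ⟨⟨fun i j => h.1.1 _ _, fun i j hij => h.1.2 _ _ (by rwa [relevant_act_iff hA])⟩,
    fun i j hij => ?_⟩
  have := h.2 _ _ ((relevant_act_iff hA i j).2 hij)
  simpa only [TwoTerm, PauliContraction.pullback, act_add, act_neg, sub_eq_add_neg, two_mul] using this

theorem IsSolution.normalize {a : G → ℂ} (ha : ∀ k, a k ≠ 0) {ε : G → G → ℂ}
    (h : IsSolution ε) : IsSolution (normalize a ε) := by
  rw [isSolution_iff_twoTerm] at h ⊢
  refine ⟨⟨fun i j => ?_, fun i j hij => ?_⟩, fun i j hij => ?_⟩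
  · rw [PauliContraction.normalize, PauliContraction.normalize, h.1.1 i j, add_comm i j,
      mul_comm (a i)]
  · rw [PauliContraction.normalize, h.1.2 i j hij, mul_zero]
  · obtain ⟨h1, h2⟩ := h.2 i j hij
    have e1 : -i + (i + j) = j := by abel
    have e2 : i + (j - i) = j := by abel
    have e3 : i + (i + j) = 2 * i + j := by ring
    have e4 : j + (2 * i + j) = 2 * (i + j) := by ring
    have e5 : j + (i + j) = i + 2 * j := by ring
    have e6 : i + (i + 2 * j) = 2 * (i + j) := by ring
    have e7 : -i + j = j - i := by abel
    constructor
    · simp only [PauliContraction.normalize, e1, e2, e7]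
      have := ha i; have := ha j; have := ha (-i); have := ha (i + j); have := ha (j - i)
      field_simp
      linear_combination h1
    · simp only [PauliContraction.normalize, e3, e4, e5, e6]
      have := ha i; have := ha j; have := ha (i + j); have := ha (2 * i + j)
      have := ha (i + 2 * j); have := ha (2 * (i + j))
      field_simp
      linear_combination h2

theorem Equivalent.trans {ε₁ ε₂ ε₃ : G → G → ℂ} (h₁ : Equivalent ε₁ ε₂) (h₂ : Equivalent ε₂ ε₃) :
    Equivalent ε₁ ε₃ := by
  obtain ⟨a, ha, A, hA, h₁⟩ := h₁
  obtain ⟨b, hb, B, hB, h₂⟩ := h₂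
  refine ⟨fun k => a k * b (act A k), fun k => mul_ne_zero (ha _) (hb _), A * B, mul_mem_H3 hA hB,
    fun i j => ?_⟩
  simp only [h₁, h₂, act_add, act_mul]
  ring

theorem Equivalent.symm {ε₁ ε₂ : G → G → ℂ} (h : Equivalent ε₁ ε₂) : Equivalent ε₂ ε₁ := by
  obtain ⟨a, ha, A, hA, h⟩ := h
  refine ⟨fun k => (a (act A⁻¹ k))⁻¹, fun k => inv_ne_zero (ha _), A⁻¹, inv_mem_H3 hA,
    fun i j => ?_⟩
  simp only [h, act_act_inv hA, act_add]
  have := ha (act A⁻¹ i); have := ha (act A⁻¹ j); have := ha (act A⁻¹ i + act A⁻¹ j)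
  field_simp

theorem equivalent_pullback {A : Matrix (Fin 2) (Fin 2) (ZMod 3)} (hA : A ∈ H3) (ε : G → G → ℂ) :
    Equivalent (pullback A ε) ε :=
  ⟨fun _ => 1, fun _ => one_ne_zero, A, hA, fun i j => by simp [pullback]⟩

theorem equivalent_normalize {a : G → ℂ} (ha : ∀ k, a k ≠ 0) (ε : G → G → ℂ) :
    Equivalent (normalize a ε) ε :=
  ⟨a, ha, 1, one_mem_H3, fun i j => by simp [normalize, act_one]⟩

theorem normalize_eq_zero_iff {a : G → ℂ} (ha : ∀ k, a k ≠ 0) (ε : G → G → ℂ) (i j : G) :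
    normalize a ε i j = 0 ↔ ε i j = 0 := by
  rw [normalize, mul_eq_zero, or_iff_right]
  exact div_ne_zero (mul_ne_zero (ha _) (ha _)) (ha _)

/-! ### Positions of the relevant entries -/

/-- The grading index with a given number; the inverse of `pos`. -/
def ofPos (n : ℕ) : G :=
  [(0, 0), (0, 1), (0, 2), (1, 0), (2, 0), (1, 1), (2, 2), (1, 2), (2, 1)].getD n 0

/-- The entry of `ε` at a position `mn`. -/
def entry (ε : G → G → ℂ) (c : ℕ) : ℂ := ε (ofPos (c / 10)) (ofPos (c % 10))

/-- The 24 positions of relevant entries. -/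
def positions : List ℕ :=
  [13, 14, 15, 16, 17, 18, 23, 24, 25, 26, 27, 28, 35, 36, 37, 38, 45, 46, 47, 48, 57, 58, 67, 68]

theorem position_mem_positions : ∀ i j : G, Relevant i j → position i j ∈ positions := by
  decide +kernel

theorem relevant_of_mem_positions : ∀ c ∈ positions,
    Relevant (ofPos (c / 10)) (ofPos (c % 10)) ∧ position (ofPos (c / 10)) (ofPos (c % 10)) = c ∧
    pos (ofPos (c / 10)) = c / 10 ∧ pos (ofPos (c % 10)) = c % 10 ∧ c < 100 ∧ c / 10 < c % 10 := by
  decide +kernel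

theorem ofPos_position : ∀ i j : G, Relevant i j →
    ofPos (position i j / 10) = i ∧ ofPos (position i j % 10) = j ∨
    ofPos (position i j / 10) = j ∧ ofPos (position i j % 10) = i := by decide +kernel

theorem position_comm (i j : G) : position i j = position j i := by
  rw [position, position, min_comm, max_comm]

theorem entry_position {ε : G → G → ℂ} (h : ∀ i j, ε i j = ε j i) {i j : G} (hij : Relevant i j) :
    entry ε (position i j) = ε i j := by
  rcases ofPos_position i j hij with ⟨h1, h2⟩ | ⟨h1, h2⟩ <;> rw [entry, h1, h2]
  exact h _ _

theorem eq_or_swap_of_position_eq {i j i' j' : G} (h : Relevant i j) (h' : Relevant i' j')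
    (he : position i j = position i' j') : i = i' ∧ j = j' ∨ i = j' ∧ j = i' := by
  rcases ofPos_position i j h with ⟨h1, h2⟩ | ⟨h1, h2⟩ <;>
  rcases ofPos_position i' j' h' with ⟨h3, h4⟩ | ⟨h3, h4⟩ <;>
  rw [he] at h1 h2 <;> simp_all

/-- The positions of the relevant entries, in an order suited to a search through all possible
supports of solutions, and for each position the two-term equations between entries of which it is
the last: `(p, q, r, s)` stands for `ε_p ε_q = ε_r ε_s`. -/
def searchPlan : List (ℕ × List (ℕ × ℕ × ℕ × ℕ)) :=
  [(13, []),
   (18, []),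
   (36, []),
   (58, [(13, 58, 18, 36)]),
   (24, []),
   (45, [(18, 45, 24, 58)]),
   (67, []),
   (27, [(13, 67, 27, 36), (24, 67, 27, 45)]),
   (25, []),
   (26, [(25, 36, 26, 58)]),
   (15, [(13, 25, 15, 27)]),
   (16, [(15, 67, 16, 45), (16, 24, 18, 26)]),
   (48, []),
   (46, [(15, 48, 18, 46), (26, 48, 27, 46)]),
   (57, [(15, 67, 46, 57), (16, 45, 46, 57), (27, 58, 48, 57)]),
   (37, [(13, 57, 16, 37), (24, 36, 37, 46), (24, 57, 25, 37)]),
   (35, [(13, 45, 35, 48), (15, 37, 18, 35), (26, 37, 27, 35)]),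
   (68, [(13, 68, 16, 48), (18, 67, 37, 68), (24, 68, 25, 48), (25, 36, 35, 68), (26, 58, 35, 68)]),
   (38, []),
   (28, [(16, 38, 28, 36), (25, 38, 28, 45)]),
   (23, [(15, 38, 23, 58), (23, 57, 28, 35), (23, 67, 26, 38), (23, 68, 28, 46)]),
   (17, [(13, 25, 17, 23), (15, 27, 17, 23), (17, 38, 18, 67), (17, 38, 37, 68)]),
   (47, [(16, 47, 17, 36), (17, 45, 25, 47), (23, 47, 24, 36), (23, 47, 37, 46), (27, 58, 28, 47), (28, 47, 48, 57)]),
   (14, [(13, 45, 14, 38), (14, 28, 16, 24), (14, 28, 18, 26), (14, 38, 35, 48), (14, 57, 17, 35), (14, 58, 15, 47), (14, 67, 26, 47), (14, 68, 17, 46)])]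

/-- The 48 two-term equations, in terms of positions. -/
def twoTermEquations : List (ℕ × ℕ × ℕ × ℕ) := searchPlan.flatMap Prod.snd

/-- The equation `ε_p ε_q = ε_r ε_s` between entries. -/
def EquationHolds (ε : G → G → ℂ) (e : ℕ × ℕ × ℕ × ℕ) : Prop :=
  entry ε e.1 * entry ε e.2.1 = entry ε e.2.2.1 * entry ε e.2.2.2

/-- `e` is the equation `ε_p ε_q = ε_r ε_s` up to the order of factors and of the two sides. -/
abbrev SameEquation (e : ℕ × ℕ × ℕ × ℕ) (p q r s : ℕ) : Prop :=
  (s(e.1, e.2.1) = s(p, q) ∧ s(e.2.2.1, e.2.2.2) = s(r, s)) ∨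
  (s(e.1, e.2.1) = s(r, s) ∧ s(e.2.2.1, e.2.2.2) = s(p, q))

theorem SameEquation.holds_iff {e : ℕ × ℕ × ℕ × ℕ} {p q r s : ℕ} (h : SameEquation e p q r s)
    (ε : G → G → ℂ) : EquationHolds ε e ↔ entry ε p * entry ε q = entry ε r * entry ε s := by
  have key : ∀ {a b c d : ℕ}, s(a, b) = s(c, d) →
      entry ε a * entry ε b = entry ε c * entry ε d := fun {a b c d} h => by
    rcases Sym2.eq_iff.1 h with ⟨rfl, rfl⟩ | ⟨rfl, rfl⟩
    exacts [rfl, mul_comm _ _]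
  rcases h with ⟨h1, h2⟩ | ⟨h1, h2⟩ <;> rw [EquationHolds, key h1, key h2]
  exact eq_comm

theorem exists_twoTermEquation : ∀ i j : G, Relevant i j →
    (∃ e ∈ twoTermEquations, SameEquation e (position i j) (position (-i) (i + j))
      (position (-i) j) (position i (j - i))) ∧
    (∃ e ∈ twoTermEquations, SameEquation e (position i (i + j)) (position j (2 * i + j))
      (position j (i + j)) (position i (i + 2 * j))) := by decide +kernel

theorem twoTermEquation_is_twoTerm : ∀ e ∈ twoTermEquations, ∃ i j : G, Relevant i j ∧
    (SameEquation e (position i j) (position (-i) (i + j)) (position (-i) j) (position i (j - i)) ∨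
    SameEquation e (position i (i + j)) (position j (2 * i + j))
      (position j (i + j)) (position i (i + 2 * j))) := by decide +kernel

theorem isSolution_iff_twoTermEquations {ε : G → G → ℂ} :
    IsSolution ε ↔ IsContractionMatrix ε ∧ ∀ e ∈ twoTermEquations, EquationHolds ε e := by
  rw [isSolution_iff_twoTerm]
  refine and_congr_right fun hε => ?_
  have key : ∀ i j, Relevant i j → (TwoTerm ε i j ↔
      (entry ε (position i j) * entry ε (position (-i) (i + j)) =
        entry ε (position (-i) j) * entry ε (position i (j - i))) ∧
      entry ε (position i (i + j)) * entry ε (position j (2 * i + j)) =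
        entry ε (position j (i + j)) * entry ε (position i (i + 2 * j))) := fun i j hij => by
    obtain ⟨-, -, -, h1, h2, h3, h4, h5, h6, h7⟩ := relevant_of_relevant i j hij
    rw [TwoTerm, entry_position hε.1 hij, entry_position hε.1 h1, entry_position hε.1 h2,
      entry_position hε.1 h3, entry_position hε.1 h4, entry_position hε.1 h5,
      entry_position hε.1 h6, entry_position hε.1 h7]
  constructor
  · intro h e he
    obtain ⟨i, j, hij, hs | hs⟩ := twoTermEquation_is_twoTerm e he
    · exact (hs.holds_iff ε).2 ((key i j hij).1 (h i j hij)).1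
    · exact (hs.holds_iff ε).2 ((key i j hij).1 (h i j hij)).2
  · intro h i j hij
    obtain ⟨⟨e, he, hs⟩, ⟨e', he', hs'⟩⟩ := exists_twoTermEquation i j hij
    exact (key i j hij).2 ⟨(hs.holds_iff ε).1 (h e he), (hs'.holds_iff ε).1 (h e' he')⟩

/-! ### The symmetries as relabelings of positions -/

/-- Index permutations given by the matrices of determinant `1`: the decimal digit of weight
`10 ^ m` is the number of the image of the index with number `m`. -/
def specialSymmetries : List ℕ :=
  [657821340, 435621780, 873421560, 568712430, 784312650, 346512870, 876543210, 127843650,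
   562143780, 438765210, 123465870, 782165340, 654387210, 125687430, 342187560, 785634120,
   651234870, 218734560, 563478120, 431278650, 216578340, 347856120, 871256430, 214356780]

/-- Index permutations given by the matrices of determinant `-1`, as in `specialSymmetries`. -/
def otherSymmetries : List ℕ :=
  [786521430, 348721650, 564321870, 875612340, 653412780, 437812560, 658743120, 215643870,
   781243560, 874365120, 217865430, 341265780, 436587120, 213487650, 561287340, 567834210,
   872134650, 126534780, 345678210, 652178430, 124378560, 783456210, 432156870, 128756340]

def symmetries : List ℕ := specialSymmetries ++ otherSymmetries

/-- `N` is the index permutation given by `A`. -/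
abbrev Encodes (N : ℕ) (A : Matrix (Fin 2) (Fin 2) (ZMod 3)) : Prop :=
  ∀ p : G, N / 10 ^ pos p % 10 = pos (act A p)

/-- The image of a position under an index permutation. -/
def relabel (N c : ℕ) : ℕ :=
  let x := N / 10 ^ (c / 10) % 10
  let y := N / 10 ^ (c % 10) % 10
  bif Nat.ble x y then 10 * x + y else 10 * y + x

theorem relabel_lt (N c : ℕ) : relabel N c < 100 := by
  have h1 := Nat.mod_lt (N / 10 ^ (c / 10)) (show 0 < 10 by norm_num)
  have h2 := Nat.mod_lt (N / 10 ^ (c % 10)) (show 0 < 10 by norm_num)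
  rw [relabel]
  cases Nat.ble (N / 10 ^ (c / 10) % 10) (N / 10 ^ (c % 10) % 10) <;> simp only [cond] <;> omega

theorem relabel_position {N : ℕ} {A : Matrix (Fin 2) (Fin 2) (ZMod 3)} (h : Encodes N A)
    {i j : G} (hij : Relevant i j) :
    relabel N (position i j) = position (act A i) (act A j) := by
  obtain ⟨-, -, h3, h4, -, -⟩ := relevant_of_mem_positions _ (position_mem_positions i j hij)
  have key : ∀ i j : G, N / 10 ^ pos i % 10 = pos (act A i) → N / 10 ^ pos j % 10 = pos (act A j) →
      (bif Nat.ble (N / 10 ^ pos i % 10) (N / 10 ^ pos j % 10) then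
        10 * (N / 10 ^ pos i % 10) + N / 10 ^ pos j % 10 else
        10 * (N / 10 ^ pos j % 10) + N / 10 ^ pos i % 10) = position (act A i) (act A j) := by
    intro i j hi hj
    rw [hi, hj, position]
    cases hb : Nat.ble (pos (act A i)) (pos (act A j))
    · have : ¬ pos (act A i) ≤ pos (act A j) := fun hle => by simp [Nat.ble_eq_true_of_le hle] at hb
      simp only [cond]
      omega
    · have := Nat.le_of_ble_eq_true hb
      simp only [cond]
      omega
  rw [relabel, ← h3, ← h4]
  rcases ofPos_position i j hij with ⟨h1, h2⟩ | ⟨h1, h2⟩ <;> rw [h1, h2]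
  · exact key i j (h i) (h j)
  · rw [position_comm]
    exact key j i (h j) (h i)

theorem exists_encodes_special : ∀ a b c d : ZMod 3, a * d - b * c = 1 →
    ∃ N ∈ specialSymmetries, Encodes N !![a, b; c, d] := by decide +kernel

theorem exists_encodes_other : ∀ a b c d : ZMod 3, a * d - b * c = -1 →
    ∃ N ∈ otherSymmetries, Encodes N !![a, b; c, d] := by decide +kernel

theorem exists_special_of_mem : ∀ N ∈ specialSymmetries, ∃ a b c d : ZMod 3, a * d - b * c = 1 ∧
    Encodes N !![a, b; c, d] := by decide +kernel

theorem exists_other_of_mem : ∀ N ∈ otherSymmetries, ∃ a b c d : ZMod 3, a * d - b * c = -1 ∧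
    Encodes N !![a, b; c, d] := by decide +kernel

theorem exists_special_encodes {A : Matrix (Fin 2) (Fin 2) (ZMod 3)} (hA : A.det = 1) :
    ∃ N ∈ specialSymmetries, Encodes N A := by
  rw [Matrix.det_fin_two] at hA
  rw [Matrix.eta_fin_two A]
  exact exists_encodes_special _ _ _ _ hA

theorem exists_symmetry_encodes {A : Matrix (Fin 2) (Fin 2) (ZMod 3)} (hA : A ∈ H3) :
    ∃ N ∈ symmetries, Encodes N A := by
  rcases hA with hA | hA
  · obtain ⟨N, hN, h⟩ := exists_special_encodes hA
    exact ⟨N, List.mem_append_left _ hN, h⟩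
  · rw [Matrix.det_fin_two] at hA
    rw [Matrix.eta_fin_two A]
    obtain ⟨N, hN, h⟩ := exists_encodes_other _ _ _ _ hA
    exact ⟨N, List.mem_append_right _ hN, h⟩

theorem exists_matrix_of_mem_special {N : ℕ} (hN : N ∈ specialSymmetries) :
    ∃ A : Matrix (Fin 2) (Fin 2) (ZMod 3), A.det = 1 ∧ Encodes N A := by
  obtain ⟨a, b, c, d, hd, h⟩ := exists_special_of_mem N hN
  exact ⟨_, by rw [Matrix.det_fin_two_of, hd], h⟩

theorem exists_matrix_of_mem {N : ℕ} (hN : N ∈ symmetries) : ∃ A ∈ H3, Encodes N A := by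
  rcases List.mem_append.1 hN with hN | hN
  · obtain ⟨A, hA, h⟩ := exists_matrix_of_mem_special hN
    exact ⟨A, Or.inl hA, h⟩
  · obtain ⟨a, b, c, d, hd, h⟩ := exists_other_of_mem N hN
    exact ⟨_, Or.inr (by rw [Matrix.det_fin_two_of, hd]), h⟩

/-! ### The possible supports of solutions -/

/-- The positions of the non-zero entries of a listed matrix. -/
def Listed.support (s : Listed) : List ℕ := s.ones ++ (s.as ++ s.bs)

/-- `k n`. The recursion on `n` makes the kernel evaluate `n` to a numeral before it is passed on. -/
def force {α : Type} (n : ℕ) (k : ℕ → α) : α := Nat.rec (k 0) (fun m _ => k (m + 1)) n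

theorem force_eq {α : Type} (n : ℕ) (k : ℕ → α) : force n k = k n := by cases n <;> rfl

/-- The image of a set of positions under an index permutation, as a bit mask. -/
def supportMask (N : ℕ) (l : List ℕ) : ℕ := l.foldr (fun c M => Nat.lor (2 ^ relabel N c) M) 0

theorem testBit_supportMask (N : ℕ) (l : List ℕ) (c : ℕ) :
    (supportMask N l).testBit c = true ↔ ∃ c' ∈ l, relabel N c' = c := by
  induction l with
  | nil => simp [supportMask]
  | cons a l ih =>
    have h : supportMask N (a :: l) = 2 ^ relabel N a ||| supportMask N l := rfl
    rw [h, Nat.testBit_or, Bool.or_eq_true, ih, Nat.testBit_two_pow]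
    simp

theorem supportMask_lt (N : ℕ) (l : List ℕ) : supportMask N l < 2 ^ 100 := by
  refine Nat.lt_pow_two_of_testBit _ fun i hi => ?_
  by_contra h
  rw [Bool.not_eq_false, testBit_supportMask] at h
  obtain ⟨c, -, rfl⟩ := h
  exact absurd (relabel_lt N c) (by omega)

/-- Feeds `k` with the images under the given index permutations of a support, tagged with a number
`n` in the bits from 100 on. -/
def withImages {α : Type} (n : ℕ) (l : List ℕ) : List ℕ → List ℕ → (List ℕ → α) → α
  | [], acc, k => k acc
  | N :: Ns, acc, k =>
    force (2 ^ 100 * n + supportMask N l) fun m => withImages n l Ns (m :: acc) k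

/-- Feeds `k` with all images of the supports of the given matrices, tagged with the number of the
matrix, starting from `n`. -/
def withAllImages {α : Type} : List Listed → ℕ → List ℕ → (List ℕ → α) → α
  | [], _, acc, k => k acc
  | s :: l, n, acc, k =>
    withImages n s.support symmetries acc fun acc' => withAllImages l (n + 1) acc' k

theorem withImages_eq {α : Type} (n : ℕ) (l Ns acc : List ℕ) (k : List ℕ → α) :
    withImages n l Ns acc k =
      k ((Ns.map fun N => 2 ^ 100 * n + supportMask N l).reverse ++ acc) := by
  induction Ns generalizing acc with
  | nil => rfl
  | cons N Ns ih => rw [withImages, force_eq, ih]; simp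

theorem withAllImages_eq {α : Type} (l : List Listed) (n : ℕ) (acc : List ℕ) (k : List ℕ → α) :
    ∃ items, withAllImages l n acc k = k items ∧ ∀ x, x ∈ items ↔ x ∈ acc ∨
      ∃ i, ∃ h : i < l.length, ∃ N ∈ symmetries,
        x = 2 ^ 100 * (n + i) + supportMask N l[i].support := by
  induction l generalizing n acc with
  | nil => exact ⟨acc, rfl, by simp⟩
  | cons s l ih =>
    rw [withAllImages, withImages_eq]
    obtain ⟨items, h1, h2⟩ := ih (n + 1)
      ((symmetries.map fun N => 2 ^ 100 * n + supportMask N s.support).reverse ++ acc)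
    refine ⟨items, h1, fun x => ?_⟩
    rw [h2, List.mem_append, List.mem_reverse, List.mem_map]
    constructor
    · rintro ((⟨N, hN, rfl⟩ | hx) | ⟨i, hi, N, hN, rfl⟩)
      · exact Or.inr ⟨0, by simp, N, hN, rfl⟩
      · exact Or.inl hx
      · refine Or.inr ⟨i + 1, by simpa using hi, N, hN, ?_⟩
        rw [List.getElem_cons_succ, show n + 1 + i = n + (i + 1) by omega]
    · rintro (hx | ⟨i, hi, N, hN, rfl⟩)
      · exact Or.inl (Or.inr hx)
      · rcases i with _ | i
        · exact Or.inl (Or.inl ⟨N, hN, rfl⟩)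
        · refine Or.inr ⟨i, by simpa using hi, N, hN, ?_⟩
          rw [List.getElem_cons_succ, show n + 1 + i = n + (i + 1) by omega]

/-- Splits a list of bit masks by the bit `c`. -/
def splitByBit (c : ℕ) : List ℕ → List ℕ → List ℕ → (List ℕ → List ℕ → Bool) → Bool
  | [], l0, l1, k => k l0 l1
  | x :: xs, l0, l1, k =>
    bif Nat.beq (x / 2 ^ c % 2) 1 then splitByBit c xs l0 (x :: l1) k
    else splitByBit c xs (x :: l0) l1 k

theorem splitByBit_eq (c : ℕ) (l l0 l1 : List ℕ) (k : List ℕ → List ℕ → Bool) :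
    ∃ m0 m1, splitByBit c l l0 l1 k = k m0 m1 ∧
      (∀ x, x ∈ m0 ↔ x ∈ l0 ∨ x ∈ l ∧ x.testBit c = false) ∧
      (∀ x, x ∈ m1 ↔ x ∈ l1 ∨ x ∈ l ∧ x.testBit c = true) := by
  induction l generalizing l0 l1 with
  | nil => exact ⟨l0, l1, rfl, by simp, by simp⟩
  | cons y l ih =>
    have hy : Nat.beq (y / 2 ^ c % 2) 1 = y.testBit c := by
      rw [Nat.testBit_eq_decide_div_mod_eq]
      rcases Nat.mod_two_eq_zero_or_one (y / 2 ^ c) with h | h <;> rw [h] <;> rfl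
    rw [splitByBit, hy]
    cases hc : y.testBit c
    · obtain ⟨m0, m1, h, h0, h1⟩ := ih (y :: l0) l1
      refine ⟨m0, m1, h, fun x => ?_, fun x => ?_⟩
      · rw [h0, List.mem_cons, List.mem_cons]
        constructor
        · rintro ((rfl | h) | ⟨h, h'⟩)
          exacts [Or.inr ⟨Or.inl rfl, hc⟩, Or.inl h, Or.inr ⟨Or.inr h, h'⟩]
        · rintro (h | ⟨rfl | h, h'⟩)
          exacts [Or.inl (Or.inr h), Or.inl (Or.inl rfl), Or.inr ⟨h, h'⟩]
      · rw [h1, List.mem_cons]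
        refine or_congr_right ⟨fun h => ⟨Or.inr h.1, h.2⟩, ?_⟩
        rintro ⟨rfl | h, h'⟩
        exacts [absurd h' (by simp [hc]), ⟨h, h'⟩]
    · obtain ⟨m0, m1, h, h0, h1⟩ := ih l0 (y :: l1)
      refine ⟨m0, m1, h, fun x => ?_, fun x => ?_⟩
      · rw [h0, List.mem_cons]
        refine or_congr_right ⟨fun h => ⟨Or.inr h.1, h.2⟩, ?_⟩
        rintro ⟨rfl | h, h'⟩
        exacts [absurd h' (by simp [hc]), ⟨h, h'⟩]
      · rw [h1, List.mem_cons, List.mem_cons]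
        constructor
        · rintro ((rfl | h) | ⟨h, h'⟩)
          exacts [Or.inr ⟨Or.inl rfl, hc⟩, Or.inl h, Or.inr ⟨Or.inr h, h'⟩]
        · rintro (h | ⟨rfl | h, h'⟩)
          exacts [Or.inl (Or.inr h), Or.inl (Or.inl rfl), Or.inr ⟨h, h'⟩]

/-- One of the equations has a non-zero side and a zero side, if the entries at the positions in
`M0` vanish and those at the positions in `M1` do not. -/
def violated (M0 M1 : ℕ) : List (ℕ × ℕ × ℕ × ℕ) → Bool
  | [] => false
  | (p, q, r, s) :: l =>
    let L := Nat.lor (2 ^ p) (2 ^ q)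
    let R := Nat.lor (2 ^ r) (2 ^ s)
    (bif Nat.beq (Nat.land M1 L) L then !(Nat.beq (Nat.land M0 R) 0) else
     bif Nat.beq (Nat.land M1 R) R then !(Nat.beq (Nat.land M0 L) 0) else false) || violated M0 M1 l

theorem not_violated {S : ℕ → Bool} {M0 M1 : ℕ} (h0 : ∀ c, M0.testBit c = true → S c = false)
    (h1 : ∀ c, M1.testBit c = true → S c = true) (l : List (ℕ × ℕ × ℕ × ℕ))
    (hl : ∀ e ∈ l, (S e.1 && S e.2.1) = (S e.2.2.1 && S e.2.2.2)) : violated M0 M1 l = false := by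
  have all : ∀ {p q}, Nat.beq (M1 &&& (2 ^ p ||| 2 ^ q)) (2 ^ p ||| 2 ^ q) = true →
      (S p && S q) = true := fun {p q} h => by
    have h := Nat.eq_of_beq_eq_true h
    have hp := congrArg (Nat.testBit · p) h
    have hq := congrArg (Nat.testBit · q) h
    simp [Nat.testBit_and, Nat.testBit_or, Nat.testBit_two_pow_self] at hp hq
    rw [h1 p hp, h1 q hq, Bool.and_self]
  have none : ∀ {p q}, (S p && S q) = true → Nat.beq (M0 &&& (2 ^ p ||| 2 ^ q)) 0 = true :=
    fun {p q} h => by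
    rw [Bool.and_eq_true] at h
    have hz : M0 &&& (2 ^ p ||| 2 ^ q) = 0 := by
      refine Nat.eq_of_testBit_eq fun i => ?_
      rw [Nat.testBit_and, Nat.testBit_or, Nat.testBit_two_pow, Nat.testBit_two_pow,
        Nat.zero_testBit]
      cases hi : M0.testBit i
      · rfl
      · have hS := h0 i hi
        have hp : p ≠ i := fun hpi => by simp [← hpi, h.1] at hS
        have hq : q ≠ i := fun hqi => by simp [← hqi, h.2] at hS
        simp [hp, hq]
    rw [hz]
    rfl
  induction l with
  | nil => rfl
  | cons e l ih =>
    obtain ⟨p, q, r, s⟩ := e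
    have he := hl (p, q, r, s) (by simp)
    dsimp only at he
    have ih := ih fun e he => hl e (List.mem_cons_of_mem _ he)
    change ((bif Nat.beq (M1 &&& (2 ^ p ||| 2 ^ q)) (2 ^ p ||| 2 ^ q) then
      !(Nat.beq (M0 &&& (2 ^ r ||| 2 ^ s)) 0) else
      bif Nat.beq (M1 &&& (2 ^ r ||| 2 ^ s)) (2 ^ r ||| 2 ^ s) then
      !(Nat.beq (M0 &&& (2 ^ p ||| 2 ^ q)) 0) else false) || violated M0 M1 l) = false
    rw [ih, Bool.or_false]
    cases hL : Nat.beq (M1 &&& (2 ^ p ||| 2 ^ q)) (2 ^ p ||| 2 ^ q)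
    · cases hR : Nat.beq (M1 &&& (2 ^ r ||| 2 ^ s)) (2 ^ r ||| 2 ^ s)
      · rfl
      · simp only [cond, none (he ▸ all hR), Bool.not_true]
    · simp only [cond, none (he ▸ all hL), Bool.not_true]

/-- Decides for one position after the other whether it belongs to the support, prunes by the
two-term equations, and keeps the tagged masks that agree with the decisions. In the end there has
to be such a mask, and all of them have to bear the same tag. -/
def search : List (ℕ × List (ℕ × ℕ × ℕ × ℕ)) → ℕ → ℕ → List ℕ → Bool
  | [], _, _, [] => false
  | [], _, _, x :: l => l.all fun y => Nat.beq (y / 2 ^ 100) (x / 2 ^ 100)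
  | (c, es) :: plan, M0, M1, items =>
    splitByBit c items [] [] fun l0 l1 =>
      force (Nat.lor M0 (2 ^ c)) fun M0' =>
      force (Nat.lor M1 (2 ^ c)) fun M1' =>
      (violated M0' M1 es || search plan M0' M1 l0) && (violated M0 M1' es || search plan M0 M1' l1)

theorem search_sound (S : ℕ → Bool) (plan : List (ℕ × List (ℕ × ℕ × ℕ × ℕ))) (M0 M1 : ℕ)
    (items : List ℕ) (h0 : ∀ c, M0.testBit c = true → S c = false)
    (h1 : ∀ c, M1.testBit c = true → S c = true)
    (hS : ∀ e ∈ plan.flatMap Prod.snd, (S e.1 && S e.2.1) = (S e.2.2.1 && S e.2.2.2))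
    (h : search plan M0 M1 items = true) :
    ∃ n, (∃ x ∈ items, x / 2 ^ 100 = n ∧ ∀ c ∈ plan.map Prod.fst, x.testBit c = S c) ∧
      ∀ x ∈ items, (∀ c ∈ plan.map Prod.fst, x.testBit c = S c) → x / 2 ^ 100 = n := by
  induction plan generalizing M0 M1 items with
  | nil =>
    rcases items with _ | ⟨x, l⟩
    · exact absurd h Bool.false_ne_true
    · refine ⟨x / 2 ^ 100, ⟨x, by simp, rfl, by simp⟩, fun y hy _ => ?_⟩
      rcases List.mem_cons.1 hy with rfl | hy
      · rfl
      · exact Nat.eq_of_beq_eq_true (List.all_eq_true.1 h y hy)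
  | cons a plan ih =>
    obtain ⟨c, es⟩ := a
    rw [search] at h
    obtain ⟨l0, l1, hl, hl0, hl1⟩ := splitByBit_eq c items [] [] fun l0 l1 =>
      force (Nat.lor M0 (2 ^ c)) fun M0' =>
      force (Nat.lor M1 (2 ^ c)) fun M1' =>
      (violated M0' M1 es || search plan M0' M1 l0) && (violated M0 M1' es || search plan M0 M1' l1)
    rw [hl, force_eq, force_eq, Bool.and_eq_true] at h
    have hes : ∀ e ∈ es, (S e.1 && S e.2.1) = (S e.2.2.1 && S e.2.2.2) := fun e he =>
      hS e (by simp [he])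
    have hplan : ∀ e ∈ plan.flatMap Prod.snd, (S e.1 && S e.2.1) = (S e.2.2.1 && S e.2.2.2) :=
      fun e he => hS e (by rw [List.flatMap_cons]; exact List.mem_append_right _ he)
    have hor : ∀ (M : ℕ) (b : Bool), S c = b → (∀ c, M.testBit c = true → S c = b) →
        ∀ c', (Nat.lor M (2 ^ c)).testBit c' = true → S c' = b := by
      intro M b hb hM c' hc'
      change (M ||| 2 ^ c).testBit c' = true at hc'
      rw [Nat.testBit_or, Bool.or_eq_true, Nat.testBit_two_pow, decide_eq_true_eq] at hc'
      rcases hc' with hc' | rfl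
      exacts [hM _ hc', hb]
    cases hc : S c
    · have h0' := hor M0 false hc h0
      have h' := h.1
      rw [not_violated h0' h1 es hes, Bool.false_or] at h'
      obtain ⟨n, ⟨x, hx, hxn, hxc⟩, hn⟩ := ih _ M1 l0 h0' h1 hplan h'
      obtain ⟨hx, hxc'⟩ := ((hl0 x).1 hx).resolve_left (by simp)
      refine ⟨n, ⟨x, hx, hxn, fun d hd => ?_⟩, fun y hy hyc => hn y ?_ fun d hd => ?_⟩
      · rcases List.mem_cons.1 hd with rfl | hd
        exacts [hxc'.trans hc.symm, hxc d hd]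
      · exact (hl0 y).2 (Or.inr ⟨hy, (hyc c (by simp)).trans hc⟩)
      · exact hyc d (List.mem_cons_of_mem _ hd)
    · have h1' := hor M1 true hc h1
      have h' := h.2
      rw [not_violated h0 h1' es hes, Bool.false_or] at h'
      obtain ⟨n, ⟨x, hx, hxn, hxc⟩, hn⟩ := ih M0 _ l1 h0 h1' hplan h'
      obtain ⟨hx, hxc'⟩ := ((hl1 x).1 hx).resolve_left (by simp)
      refine ⟨n, ⟨x, hx, hxn, fun d hd => ?_⟩, fun y hy hyc => hn y ?_ fun d hd => ?_⟩
      · rcases List.mem_cons.1 hd with rfl | hd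
        exacts [hxc'.trans hc.symm, hxc d hd]
      · exact (hl1 y).2 (Or.inr ⟨hy, (hyc c (by simp)).trans hc⟩)
      · exact hyc d (List.mem_cons_of_mem _ hd)

/-- The supports that contain the position `13` and are compatible with the two-term equations are
images of the supports of the listed matrices, each of only one. -/
theorem search_supports : (withAllImages solutionList 0 [] fun items =>
    splitByBit 13 items [] [] fun _ l => search searchPlan.tail 0 (2 ^ 13) l) = true := by
  decide +kernel

theorem existsUnique_image_of_support (S : ℕ → Bool) (h13 : S 13 = true)
    (hS : ∀ e ∈ twoTermEquations, (S e.1 && S e.2.1) = (S e.2.2.1 && S e.2.2.2)) :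
    ∃! n : Fin solutionList.length, ∃ N ∈ symmetries, ∀ c ∈ positions,
      S c = true ↔ ∃ c' ∈ (solutionList.get n).support, relabel N c' = c := by
  have h := search_supports
  obtain ⟨items, hi, hitems⟩ := withAllImages_eq solutionList 0 [] fun items =>
    splitByBit 13 items [] [] fun _ l => search searchPlan.tail 0 (2 ^ 13) l
  obtain ⟨l0, l1, hl, -, hl1⟩ := splitByBit_eq 13 items [] [] fun _ l =>
    search searchPlan.tail 0 (2 ^ 13) l
  rw [hi, hl] at h
  obtain ⟨n, ⟨x, hx, hxn, hxS⟩, hn⟩ := search_sound S _ _ _ _ (by simp)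
    (fun c hc => by
      rw [Nat.testBit_two_pow, decide_eq_true_eq] at hc
      rw [← hc, h13])
    (fun e he => hS e (by
      rw [twoTermEquations, show searchPlan = (13, []) :: searchPlan.tail from rfl]
      simpa using he)) h
  have hplan : ∀ c ∈ positions, c = 13 ∨ c ∈ searchPlan.tail.map Prod.fst := by decide +kernel
  have hplan' : ∀ c ∈ searchPlan.tail.map Prod.fst, c ∈ positions := by decide +kernel
  have hpos : ∀ c ∈ positions, c < 100 := fun c hc => (relevant_of_mem_positions c hc).2.2.2.2.1
  have hdiv : ∀ (i N : ℕ) (l : List ℕ), (2 ^ 100 * (0 + i) + supportMask N l) / 2 ^ 100 = i := by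
    intro i N l
    have := supportMask_lt N l
    omega
  have hbit : ∀ (i N : ℕ) (l : List ℕ), ∀ c < 100,
      (2 ^ 100 * (0 + i) + supportMask N l).testBit c = true ↔ ∃ c' ∈ l, relabel N c' = c := by
    intro i N l c hc
    rw [Nat.testBit_two_pow_mul_add _ (supportMask_lt N l), if_pos hc, testBit_supportMask]
  obtain ⟨hx, hx13⟩ := ((hl1 x).1 hx).resolve_left (by simp)
  obtain ⟨i, hilt, N, hN, rfl⟩ := ((hitems x).1 hx).resolve_left (by simp)
  rw [hdiv] at hxn
  subst hxn
  refine ⟨⟨i, hilt⟩, ⟨N, hN, fun c hc => ?_⟩, ?_⟩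
  · rw [List.get_eq_getElem, ← hbit i N _ c (hpos c hc)]
    rcases hplan c hc with rfl | hc
    · simp only [h13, hx13]
    · rw [hxS c hc]
  · rintro ⟨j, hj⟩ ⟨M, hM, hjM⟩
    have hjS : ∀ c ∈ positions,
        (2 ^ 100 * (0 + j) + supportMask M solutionList[j].support).testBit c = S c := by
      intro c hc
      rw [Bool.eq_iff_iff, hbit j M _ c (hpos c hc), hjM c hc, List.get_eq_getElem]
    have hj' := hn (2 ^ 100 * (0 + j) + supportMask M solutionList[j].support)
      ((hl1 _).2 (Or.inr ⟨(hitems _).2 (Or.inr ⟨j, hj, M, hM, rfl⟩), by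
        rw [hjS 13 (by decide), h13]⟩)) fun c hc => hjS c (hplan' c hc)
    rw [hdiv] at hj'
    exact Fin.ext hj'

theorem support_subset_positions : ∀ s ∈ solutionList, ∀ c ∈ s.support, c ∈ positions := by
  decide +kernel

/-- The non-zero entries of `ε` correspond to those of the listed matrix `s` under the index
permutation given by `A`. -/
def SupportMatches (ε : G → G → ℂ) (s : Listed) (A : Matrix (Fin 2) (Fin 2) (ZMod 3)) : Prop :=
  ∀ i j, Relevant i j → (ε (act A i) (act A j) ≠ 0 ↔ position i j ∈ s.support)

theorem supportMatches_iff {ε : G → G → ℂ} (hε : ∀ i j, ε i j = ε j i) {s : Listed}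
    (hs : ∀ c ∈ s.support, c ∈ positions) {A : Matrix (Fin 2) (Fin 2) (ZMod 3)} (hA : A ∈ H3)
    {N : ℕ} (hN : Encodes N A) : SupportMatches ε s A ↔
      ∀ c ∈ positions, entry ε c ≠ 0 ↔ ∃ c' ∈ s.support, relabel N c' = c := by
  have key : ∀ i j, Relevant i j → ((∃ c' ∈ s.support, relabel N c' = position (act A i) (act A j)) ↔
      position i j ∈ s.support) := by
    intro i j hij
    constructor
    · rintro ⟨c, hc, hcN⟩
      obtain ⟨h1, h2, -⟩ := relevant_of_mem_positions c (hs c hc)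
      rw [← h2, relabel_position hN h1] at hcN
      rw [← h2] at hc
      rcases eq_or_swap_of_position_eq ((relevant_act_iff hA _ _).2 h1)
        ((relevant_act_iff hA _ _).2 hij) hcN with ⟨h3, h4⟩ | ⟨h3, h4⟩
      · rwa [← act_injective hA h3, ← act_injective hA h4]
      · rwa [← act_injective hA h3, ← act_injective hA h4, position_comm]
    · exact fun h => ⟨_, h, relabel_position hN hij⟩
  constructor
  · intro h c hc
    obtain ⟨h1, h2, -⟩ := relevant_of_mem_positions c hc
    have hr := (relevant_act_iff (inv_mem_H3 hA) _ _).2 h1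
    have h3 := (h _ _ hr).trans (key _ _ hr).symm
    rw [act_act_inv hA, act_act_inv hA, h2] at h3
    exact h3
  · intro h i j hij
    have hr := (relevant_act_iff hA _ _).2 hij
    rw [← entry_position hε hr, h _ (position_mem_positions _ _ hr), key i j hij]

/-- The support of a solution corresponds to the support of exactly one listed matrix. -/
theorem existsUnique_supportMatches {ε : G → G → ℂ} (hε : IsSolution ε) :
    ∃! n : Fin solutionList.length, ∃ A ∈ H3, SupportMatches ε (solutionList.get n) A := by
  by_cases hz : ∀ i j, Relevant i j → ε i j = 0
  · have hn : ∃ n : Fin solutionList.length, (solutionList.get n).support = [] ∧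
        ∀ m : Fin solutionList.length, (solutionList.get m).support = [] → m = n := by
      decide +kernel
    obtain ⟨n, hn, hm⟩ := hn
    refine ⟨n, ⟨1, one_mem_H3, fun i j hij => ?_⟩, ?_⟩
    · simp only [act_one, hz i j hij, hn]
      simp
    · rintro m ⟨A, hA, h⟩
      refine hm m (List.eq_nil_iff_forall_not_mem.2 fun c hc => ?_)
      obtain ⟨h1, h2, -⟩ := relevant_of_mem_positions c
        (support_subset_positions _ (List.get_mem _ _) c hc)
      exact (h _ _ h1).2 (h2.symm ▸ hc) (hz _ _ ((relevant_act_iff hA _ _).2 h1))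
  · push Not at hz
    obtain ⟨p, q, hpq, hne⟩ := hz
    -- `H₃` acts transitively on the relevant pairs, so the entry at `13` may be assumed non-zero
    obtain ⟨B, hB, hBp, hBq⟩ : ∃ B ∈ H3, act B (0, 1) = p ∧ act B (1, 0) = q := by
      refine ⟨!![q.1, q.2; p.1, p.2], ?_, by simp [act], by simp [act]⟩
      have h1 : ∀ x : ZMod 3, x ≠ 0 → x = 1 ∨ x = -1 := by decide
      rcases h1 _ hpq with h | h
      · exact Or.inl (by rw [Matrix.det_fin_two_of]; linear_combination h)
      · exact Or.inr (by rw [Matrix.det_fin_two_of]; linear_combination h)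
    have hεB := hε.pullback hB
    have hsol := isSolution_iff_twoTermEquations.1 hεB
    have h13 : entry (pullback B ε) 13 ≠ 0 := by
      change ε (act B (0, 1)) (act B (1, 0)) ≠ 0
      rwa [hBp, hBq]
    have hiff : ∀ n : Fin solutionList.length,
        (∃ A ∈ H3, SupportMatches ε (solutionList.get n) A) ↔
        ∃ N ∈ symmetries, ∀ c ∈ positions, decide (entry (pullback B ε) c ≠ 0) = true ↔
          ∃ c' ∈ (solutionList.get n).support, relabel N c' = c := by
      intro n
      have hs := support_subset_positions _ (List.get_mem solutionList n)
      simp only [decide_eq_true_eq]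
      constructor
      · rintro ⟨A, hA, h⟩
        have hAB := mul_mem_H3 hA (inv_mem_H3 hB)
        obtain ⟨N, hN, hNA⟩ := exists_symmetry_encodes hAB
        refine ⟨N, hN, (supportMatches_iff hsol.1.1 hs hAB hNA).1 fun i j hij => ?_⟩
        simp only [pullback, act_mul, act_act_inv hB]
        exact h i j hij
      · rintro ⟨N, hN, h⟩
        obtain ⟨A, hA, hNA⟩ := exists_matrix_of_mem hN
        refine ⟨A * B, mul_mem_H3 hA hB, fun i j hij => ?_⟩
        rw [act_mul, act_mul]
        exact (supportMatches_iff hsol.1.1 hs hA hNA).2 h i j hij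
    simp only [hiff]
    refine existsUnique_image_of_support _ (by simpa using h13) fun e he => ?_
    have h := hsol.2 e he
    rw [EquationHolds] at h
    rw [Bool.eq_iff_iff]
    simp only [Bool.and_eq_true, decide_eq_true_eq, ← mul_ne_zero_iff, h]

/-! ### The entries of the listed matrices as monomials in the parameters -/

/-- The exponent of the parameter `a` in the entry at position `c`. -/
def Listed.degA (s : Listed) (c : ℕ) : ℕ := if c ∈ s.ones then 0 else if c ∈ s.as then 1 else 0

/-- The exponent of the parameter `b` in the entry at position `c`. -/
def Listed.degB (s : Listed) (c : ℕ) : ℕ :=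
  if c ∈ s.ones then 0 else if c ∈ s.as then 0 else if c ∈ s.bs then 1 else 0

theorem Listed.matrix_eq (s : Listed) (a b : ℂ) (i j : G) : s.matrix a b i j =
    if position i j ∈ s.support then a ^ s.degA (position i j) * b ^ s.degB (position i j)
    else 0 := by
  simp only [Listed.matrix, Listed.support, Listed.degA, Listed.degB, List.mem_append]
  split_ifs <;> simp_all

theorem entry_matrix (s : Listed) (a b : ℂ) {c : ℕ} (hc : c ∈ positions) :
    entry (s.matrix a b) c = if c ∈ s.support then a ^ s.degA c * b ^ s.degB c else 0 := by
  rw [entry, Listed.matrix_eq, (relevant_of_mem_positions c hc).2.1]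

/-- The exponents of `a` and `b` in the product of the entries at a list of positions, or `none` if
one of these entries vanishes. -/
def Listed.monomial (s : Listed) : List ℕ → Option (ℕ × ℕ)
  | [] => some (0, 0)
  | c :: l => if c ∈ s.support then
      (s.monomial l).map fun x => (s.degA c + x.1, s.degB c + x.2) else none

/-- The value of a monomial for given parameters. -/
def evalMonomial (a b : ℂ) : Option (ℕ × ℕ) → ℂ
  | none => 0
  | some (x, y) => a ^ x * b ^ y

theorem prod_entry_matrix (s : Listed) (a b : ℂ) {l : List ℕ} (hl : ∀ c ∈ l, c ∈ positions) :
    (l.map (entry (s.matrix a b))).prod = evalMonomial a b (s.monomial l) := by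
  induction l with
  | nil => simp [Listed.monomial, evalMonomial]
  | cons c l ih =>
    rw [List.map_cons, List.prod_cons, ih fun c hc => hl c (List.mem_cons_of_mem _ hc),
      entry_matrix s a b (hl c (by simp)), Listed.monomial]
    split_ifs
    · cases s.monomial l
      · simp [evalMonomial]
      · simp only [evalMonomial, Option.map_some]
        ring
    · simp [evalMonomial]

theorem Listed.Admissible.entry_ne_zero_iff {s : Listed} {a b : ℂ} (h : s.Admissible a b) {c : ℕ}
    (hc : c ∈ positions) : entry (s.matrix a b) c ≠ 0 ↔ c ∈ s.support := by
  rw [entry_matrix s a b hc]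
  split_ifs with hs
  · exact iff_of_true (mul_ne_zero (pow_ne_zero _ h.1) (pow_ne_zero _ h.2.1)) hs
  · exact iff_of_false (by simp) hs

theorem Listed.Admissible.matrix_ne_zero_iff {s : Listed} {a b : ℂ} (h : s.Admissible a b)
    (i j : G) : s.matrix a b i j ≠ 0 ↔ position i j ∈ s.support := by
  rw [Listed.matrix_eq]
  split_ifs with hs
  · exact iff_of_true (mul_ne_zero (pow_ne_zero _ h.1) (pow_ne_zero _ h.2.1)) hs
  · exact iff_of_false (by simp) hs

theorem relevant_of_position_mem : ∀ i j : G, position i j ∈ positions → Relevant i j := by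
  decide +kernel

theorem isContractionMatrix_listed {s : Listed} (hs : s ∈ solutionList) (a b : ℂ) :
    IsContractionMatrix (s.matrix a b) := by
  refine ⟨fun i j => by rw [Listed.matrix, Listed.matrix, position_comm], fun i j hij => ?_⟩
  rw [Listed.matrix_eq, if_neg fun h => hij (relevant_of_position_mem i j
    (support_subset_positions s hs _ h))]

theorem twoTermEquation_mem_positions : ∀ e ∈ twoTermEquations,
    e.1 ∈ positions ∧ e.2.1 ∈ positions ∧ e.2.2.1 ∈ positions ∧ e.2.2.2 ∈ positions := by
  decide +kernel

theorem monomials_of_twoTermEquations : ∀ s ∈ solutionList, ∀ e ∈ twoTermEquations,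
    s.monomial [e.1, e.2.1] = s.monomial [e.2.2.1, e.2.2.2] := by decide +kernel

theorem isSolution_listed {s : Listed} (hs : s ∈ solutionList) (a b : ℂ) :
    IsSolution (s.matrix a b) := by
  refine isSolution_iff_twoTermEquations.2 ⟨isContractionMatrix_listed hs a b, fun e he => ?_⟩
  obtain ⟨h1, h2, h3, h4⟩ := twoTermEquation_mem_positions e he
  have hl := prod_entry_matrix s a b (l := [e.1, e.2.1]) (by simp [h1, h2])
  have hr := prod_entry_matrix s a b (l := [e.2.2.1, e.2.2.2]) (by simp [h3, h4])
  rw [← monomials_of_twoTermEquations s hs e he, ← hl] at hr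
  simpa [EquationHolds] using hr.symm

/-! ### The number of zeros -/

theorem numZeros_eq_ncard_positions {ε : G → G → ℂ} (h : ∀ i j, ε i j = ε j i) :
    numZeros ε = {c | c ∈ positions ∧ entry ε c = 0}.ncard := by
  have hp : ∀ c ∈ positions, position (ofPos (c / 10)) (ofPos (c % 10)) = c := fun c hc =>
    (relevant_of_mem_positions c hc).2.1
  rw [← Set.InjOn.ncard_image (f := fun c => (ofPos (c / 10), ofPos (c % 10)))]
  · rw [numZeros]
    congr 1
    ext ⟨i, j⟩
    constructor
    · rintro ⟨h1, h2, h3⟩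
      refine ⟨position i j, ⟨position_mem_positions i j h1, (entry_position h h1).trans h3⟩, ?_⟩
      rcases ofPos_position i j h1 with ⟨h4, h5⟩ | ⟨h4, h5⟩
      · exact Prod.ext h4 h5
      · obtain ⟨-, -, h6, h7, -, h8⟩ := relevant_of_mem_positions _ (position_mem_positions i j h1)
        rw [h4] at h6
        rw [h5] at h7
        dsimp only at h2
        omega
    · rintro ⟨c, ⟨hc, h0⟩, he⟩
      obtain ⟨rfl, rfl⟩ := Prod.mk.inj he
      obtain ⟨h1, -, h6, h7, -, h8⟩ := relevant_of_mem_positions c hc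
      exact ⟨h1, by rwa [h6, h7], h0⟩
  · rintro c ⟨hc, -⟩ c' ⟨hc', -⟩ he
    obtain ⟨h1, h2⟩ := Prod.mk.inj he
    rw [← hp c hc, h1, h2, hp c' hc']

theorem length_filter_not_mem_support : ∀ s ∈ solutionList,
    (positions.filter fun c => c ∉ s.support).length = s.ν := by decide +kernel

theorem numZeros_listed {s : Listed} (hs : s ∈ solutionList) {a b : ℂ} (h : s.Admissible a b) :
    numZeros (s.matrix a b) = s.ν := by
  rw [numZeros_eq_ncard_positions (isContractionMatrix_listed hs a b).1,
    ← length_filter_not_mem_support s hs,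
    ← List.toFinset_card_of_nodup ((show positions.Nodup by decide).filter _),
    ← Set.ncard_coe_finset]
  congr 1
  ext c
  simp only [Set.mem_ofPred_eq, List.coe_toFinset, List.mem_filter, decide_eq_true_eq]
  exact and_congr_right fun hc => by rw [← h.entry_ne_zero_iff hc, not_not]

theorem numZeros_le_of_equivalent {ε ε' : G → G → ℂ} (hε : ∀ i j, ε i j = ε j i)
    (hε' : ∀ i j, ε' i j = ε' j i) (h : Equivalent ε ε') : numZeros ε ≤ numZeros ε' := by
  obtain ⟨a, ha, A, hA, h⟩ := (equivalent_iff _ _).1 h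
  obtain ⟨N, -, hN⟩ := exists_symmetry_encodes hA
  have hr : ∀ c ∈ positions, relabel N c =
      position (act A (ofPos (c / 10))) (act A (ofPos (c % 10))) := fun c hc => by
    obtain ⟨h1, h2, -⟩ := relevant_of_mem_positions c hc
    rw [← relabel_position hN h1, h2]
  rw [numZeros_eq_ncard_positions hε, numZeros_eq_ncard_positions hε']
  refine Set.ncard_le_ncard_of_injOn (relabel N) ?_ ?_ ((positions.finite_toSet).subset
    fun c hc => hc.1)
  · rintro c ⟨hc, h0⟩
    obtain ⟨h1, -⟩ := relevant_of_mem_positions c hc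
    have h1' := (relevant_act_iff hA _ _).2 h1
    rw [entry, h, normalize_eq_zero_iff ha] at h0
    rw [hr c hc]
    exact ⟨position_mem_positions _ _ h1', (entry_position hε' h1').trans h0⟩
  · rintro c ⟨hc, -⟩ c' ⟨hc', -⟩ he
    obtain ⟨h1, h2, -⟩ := relevant_of_mem_positions c hc
    obtain ⟨h1', h2', -⟩ := relevant_of_mem_positions c' hc'
    rw [hr c hc, hr c' hc'] at he
    rw [← h2, ← h2']
    rcases eq_or_swap_of_position_eq ((relevant_act_iff hA _ _).2 h1)
      ((relevant_act_iff hA _ _).2 h1') he with ⟨h3, h4⟩ | ⟨h3, h4⟩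
    · rw [act_injective hA h3, act_injective hA h4]
    · rw [act_injective hA h3, act_injective hA h4, position_comm]

/-! ### Linear systems with integer coefficients -/

/-- The product of an integer row with a column of complex numbers. -/
def dot : List ℤ → (ℕ → ℂ) → ℂ
  | [], _ => 0
  | x :: r, w => x * w 0 + dot r fun n => w (n + 1)

/-- Removes the first row with non-zero leading coefficient. -/
def pickPivot : List (List ℤ) → Option (List ℤ × List (List ℤ))
  | [] => none
  | r :: rows => if r.headD 0 = 0 then (pickPivot rows).map fun x => (x.1, r :: x.2)
      else some (r, rows)

/-- Eliminates the first unknown from the row `r` by means of the pivot row `p`. -/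
def eliminateHead (p r : List ℤ) : List ℤ :=
  List.zipWith (fun x y => p.headD 0 * x - r.headD 0 * y) r.tail p.tail

/-- Fraction-free Gaussian elimination: `true` if the rows are linearly independent. -/
def independentRows : ℕ → List (List ℤ) → Bool
  | 0, rows => rows.isEmpty
  | n + 1, rows =>
    match pickPivot rows with
    | none => independentRows n (rows.map List.tail)
    | some (p, rest) => independentRows n (rest.map (eliminateHead p))

theorem pickPivot_eq_none (l : List (List ℤ × ℂ)) (h : pickPivot (l.map Prod.fst) = none) :
    ∀ x ∈ l, x.1.headD 0 = 0 := by
  induction l with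
  | nil => simp
  | cons y l ih =>
    rw [List.map_cons, pickPivot] at h
    split_ifs at h with hy
    simp only [Option.map_eq_none_iff] at h
    intro x hx
    rcases List.mem_cons.1 hx with rfl | hx
    exacts [hy, ih h x hx]

theorem pickPivot_eq_some (l : List (List ℤ × ℂ)) {p : List ℤ} {rest : List (List ℤ)}
    (h : pickPivot (l.map Prod.fst) = some (p, rest)) :
    ∃ (u : ℂ) (l' : List (List ℤ × ℂ)), p.headD 0 ≠ 0 ∧ l'.map Prod.fst = rest ∧ ∀ x, x ∈ l ↔ x = (p, u) ∨ x ∈ l' := by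
  induction l generalizing rest with
  | nil => simp [pickPivot] at h
  | cons y l ih =>
    rw [List.map_cons, pickPivot] at h
    split_ifs at h with hy
    · obtain ⟨⟨p', rest'⟩, hp, he⟩ := Option.map_eq_some_iff.1 h
      obtain ⟨rfl, rfl⟩ := Prod.mk.inj he
      obtain ⟨u, l', h1, h2, h3⟩ := ih hp
      refine ⟨u, y :: l', h1, by rw [List.map_cons, h2], fun x => ?_⟩
      rw [List.mem_cons, h3, List.mem_cons]
      tauto
    · obtain ⟨rfl, rfl⟩ := Prod.mk.inj (Option.some.inj h)
      exact ⟨y.2, l, hy, rfl, fun x => List.mem_cons⟩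

theorem dot_eliminateHead (p r : List ℤ) (w : ℕ → ℂ) (h : r.length = p.length) :
    dot (eliminateHead p r) w = p.headD 0 * dot r.tail w - r.headD 0 * dot p.tail w := by
  have key : ∀ (x y : ℤ) (u v : List ℤ) (w : ℕ → ℂ), u.length = v.length →
      dot (List.zipWith (fun a b => x * a - y * b) u v) w = x * dot u w - y * dot v w := by
    intro x y u
    induction u with
    | nil =>
      intro v w h
      rw [List.length_eq_zero_iff.1 h.symm]
      simp [dot]
    | cons a u ih =>
      intro v w h
      rcases v with _ | ⟨b, v⟩
      · simp at h
      · rw [List.zipWith_cons_cons, dot, dot, dot, ih v _ (by simpa using h)]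
        push_cast
        ring
  exact key _ _ _ _ _ (by simp [h])

/-- A linear system with linearly independent integer rows has a solution for all right-hand
sides. -/
theorem exists_solution_of_independentRows (n : ℕ) (l : List (List ℤ × ℂ))
    (hlen : ∀ x ∈ l, x.1.length = n) (h : independentRows n (l.map Prod.fst) = true) :
    ∃ w : ℕ → ℂ, ∀ x ∈ l, dot x.1 w = x.2 := by
  have hdot : ∀ (r : List ℤ) (w : ℕ → ℂ), r ≠ [] →
      dot r w = r.headD 0 * w 0 + dot r.tail fun n => w (n + 1) := fun r w hr => by
    rcases r with _ | ⟨x, r⟩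
    exacts [absurd rfl hr, rfl]
  induction n generalizing l with
  | zero =>
    rw [independentRows, List.isEmpty_iff, List.map_eq_nil_iff] at h
    exact ⟨0, by simp [h]⟩
  | succ n ih =>
    have hne : ∀ x ∈ l, x.1 ≠ [] := fun x hx h0 => by simpa [h0] using hlen x hx
    rw [independentRows] at h
    split at h
    · rename_i hp
      have hz := pickPivot_eq_none l hp
      obtain ⟨w, hw⟩ := ih (l.map fun x => (x.1.tail, x.2)) (by
        intro x hx
        obtain ⟨y, hy, rfl⟩ := List.mem_map.1 hx
        simp [hlen y hy]) (by simpa [Function.comp_def] using h)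
      refine ⟨fun n => w (n - 1), fun x hx => ?_⟩
      rw [hdot _ _ (hne x hx), hz x hx]
      simpa using hw (x.1.tail, x.2) (List.mem_map.2 ⟨x, hx, rfl⟩)
    · rename_i p rest hp
      obtain ⟨u, l', hp0, rfl, hl⟩ := pickPivot_eq_some l hp
      have hpl := hlen (p, u) ((hl _).2 (Or.inl rfl))
      obtain ⟨w, hw⟩ := ih
        (l'.map fun x => (eliminateHead p x.1, p.headD 0 * x.2 - x.1.headD 0 * u)) (by
          intro x hx
          obtain ⟨y, hy, rfl⟩ := List.mem_map.1 hx
          have := hlen y ((hl y).2 (Or.inr hy))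
          dsimp only at hpl
          simp [eliminateHead, this, hpl]) (by simpa [Function.comp_def] using h)
      have hp0' : ((p.headD 0 : ℤ) : ℂ) ≠ 0 := by exact_mod_cast hp0
      refine ⟨fun n => if n = 0 then (u - dot p.tail w) / (p.headD 0 : ℤ) else w (n - 1),
        fun x hx => ?_⟩
      rw [hdot _ _ (hne x hx)]
      simp only [if_true, Nat.add_eq_zero_iff, one_ne_zero, and_false, if_false,
        Nat.add_sub_cancel]
      rcases (hl x).1 hx with rfl | hx'
      · field_simp
        ring
      · have h1 := hw _ (List.mem_map.2 ⟨x, hx', rfl⟩)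
        dsimp only at h1 hpl
        rw [dot_eliminateHead _ _ _ ((hlen x hx).trans hpl.symm)] at h1
        field_simp
        linear_combination h1

/-! ### Normal forms of solutions with a given support -/

/-- The exponents of `a_1, …, a_8` and of the parameters in the entry at position `c` of a
normalized listed matrix. -/
def exponentRow (s : Listed) (c : ℕ) : List ℤ :=
  ([1, 2, 3, 4, 5, 6, 7, 8].map fun d : ℕ => (if d = c / 10 then 1 else 0) +
    (if d = c % 10 then 1 else 0) - (if d = pos (ofPos (c / 10) + ofPos (c % 10)) then 1 else 0)) ++
  [(s.degA c : ℤ), (s.degB c : ℤ)]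

theorem dot_exponentRow (s : Listed) {c : ℕ} (hc : c ∈ positions) (w : ℕ → ℂ) :
    dot (exponentRow s c) w = w (c / 10 - 1) + w (c % 10 - 1) -
      w (pos (ofPos (c / 10) + ofPos (c % 10)) - 1) + s.degA c * w 8 + s.degB c * w 9 := by
  have hb : ∀ c ∈ positions, 1 ≤ c / 10 ∧ c / 10 ≤ 8 ∧ 1 ≤ c % 10 ∧ c % 10 ≤ 8 ∧
      1 ≤ pos (ofPos (c / 10) + ofPos (c % 10)) ∧ pos (ofPos (c / 10) + ofPos (c % 10)) ≤ 8 := by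
    decide +kernel
  have key : ∀ d : ℕ, 1 ≤ d → d ≤ 8 → (if 1 = d then 1 else 0) * w 0 +
      (if 2 = d then 1 else 0) * w 1 + (if 3 = d then 1 else 0) * w 2 +
      (if 4 = d then 1 else 0) * w 3 + (if 5 = d then 1 else 0) * w 4 +
      (if 6 = d then 1 else 0) * w 5 + (if 7 = d then 1 else 0) * w 6 +
      (if 8 = d then 1 else 0) * w 7 = w (d - 1) := by
    intro d h1 h2
    interval_cases d <;> simp
  obtain ⟨h1, h2, h3, h4, h5, h6⟩ := hb c hc
  rw [← key _ h1 h2, ← key _ h3 h4, ← key _ h5 h6]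
  simp only [exponentRow, List.map_cons, List.map_nil, List.cons_append, List.nil_append, dot]
  push_cast
  ring

/-- If three of the positions in the equation `e` belong to `M`, the fourth is added to it. -/
def propagateStep (M : ℕ) (e : ℕ × ℕ × ℕ × ℕ) : ℕ :=
  bif Nat.testBit M e.1 && Nat.testBit M e.2.1 then
    bif Nat.testBit M e.2.2.1 then Nat.lor M (2 ^ e.2.2.2) else
    bif Nat.testBit M e.2.2.2 then Nat.lor M (2 ^ e.2.2.1) else M
  else bif Nat.testBit M e.2.2.1 && Nat.testBit M e.2.2.2 then
    bif Nat.testBit M e.1 then Nat.lor M (2 ^ e.2.1) else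
    bif Nat.testBit M e.2.1 then Nat.lor M (2 ^ e.1) else M
  else M

/-- Feeds `k` with the result of one round of `propagateStep` through a list of equations. -/
def propagate {α : Type} : List (ℕ × ℕ × ℕ × ℕ) → ℕ → (ℕ → α) → α
  | [], M, k => k M
  | e :: es, M, k => force (propagateStep M e) fun M' => propagate es M' k

/-- Three rounds of propagation. -/
def propagateThrice {α : Type} (es : List (ℕ × ℕ × ℕ × ℕ)) (M : ℕ) (k : ℕ → α) : α :=
  propagate es M fun M => propagate es M fun M => propagate es M k

/-- Feeds `k` with the equations all of whose positions belong to `M`. -/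
def withActive (M : ℕ) : List (ℕ × ℕ × ℕ × ℕ) → List (ℕ × ℕ × ℕ × ℕ) →
    (List (ℕ × ℕ × ℕ × ℕ) → Bool) → Bool
  | [], acc, k => k acc
  | e :: es, acc, k =>
    bif Nat.testBit M e.1 && Nat.testBit M e.2.1 && Nat.testBit M e.2.2.1 && Nat.testBit M e.2.2.2
    then withActive M es (e :: acc) k else withActive M es acc k

/-- Feeds `k` with positions chosen greedily so that propagation leads from them to all positions in
the given list. -/
def withFreePositions (es : List (ℕ × ℕ × ℕ × ℕ)) : List ℕ → ℕ → List ℕ → (List ℕ → Bool) → Bool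
  | [], _, F, k => k F
  | c :: cs, M, F, k =>
    bif Nat.testBit M c then withFreePositions es cs M F k
    else propagateThrice es (Nat.lor M (2 ^ c)) fun M' => withFreePositions es cs M' (c :: F) k

/-- The bit mask of a list of positions. -/
def maskOf (l : List ℕ) : ℕ := l.foldr (fun c M => Nat.lor (2 ^ c) M) 0

theorem testBit_maskOf (l : List ℕ) (c : ℕ) : (maskOf l).testBit c = true ↔ c ∈ l := by
  induction l with
  | nil => simp [maskOf]
  | cons a l ih =>
    have h : maskOf (a :: l) = 2 ^ a ||| maskOf l := rfl
    rw [h, Nat.testBit_or, Bool.or_eq_true, ih, Nat.testBit_two_pow, List.mem_cons,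
      decide_eq_true_eq, eq_comm]

/-- There are positions in the support of `s` at which the entries can be prescribed freely by
normalization and choice of the parameters, and these determine all others by the two-term
equations. -/
def hasNormalForm (s : Listed) : Bool :=
  force (maskOf s.support) fun S =>
  withActive S twoTermEquations [] fun es =>
  withFreePositions es (positions.reverse.filter fun c => Nat.testBit S c) 0 [] fun F =>
    independentRows 10 (F.map (exponentRow s)) && F.all (fun c => Nat.testBit S c) &&
    propagateThrice es (maskOf F) fun M => s.support.all fun c => Nat.testBit M c

theorem hasNormalForm_listed : ∀ s ∈ solutionList, hasNormalForm s = true := by decide +kernel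

theorem testBit_lor {M c c' : ℕ} (h : (Nat.lor M (2 ^ c)).testBit c' = true) :
    M.testBit c' = true ∨ c' = c := by
  change (M ||| 2 ^ c).testBit c' = true at h
  rw [Nat.testBit_or, Bool.or_eq_true, Nat.testBit_two_pow, decide_eq_true_eq] at h
  exact h.imp_right Eq.symm

theorem propagateStep_sound {f g : ℕ → ℂ} {e : ℕ × ℕ × ℕ × ℕ}
    (hf : f e.1 * f e.2.1 = f e.2.2.1 * f e.2.2.2) (hg : g e.1 * g e.2.1 = g e.2.2.1 * g e.2.2.2)
    {M : ℕ} (hM : ∀ c, M.testBit c = true → f c = g c ∧ g c ≠ 0) :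
    ∀ c, (propagateStep M e).testBit c = true → f c = g c ∧ g c ≠ 0 := by
  -- the last factor of an equation is determined by the three others, and does not vanish
  have key : ∀ {p q r s : ℕ}, f p * f q = f r * f s → g p * g q = g r * g s →
      M.testBit p = true → M.testBit q = true → M.testBit r = true → f s = g s ∧ g s ≠ 0 := by
    intro p q r s h1 h2 hp hq hr
    obtain ⟨hp, hp0⟩ := hM p hp
    obtain ⟨hq, hq0⟩ := hM q hq
    obtain ⟨hr, hr0⟩ := hM r hr
    rw [hp, hq, hr, h2] at h1
    exact ⟨(mul_left_cancel₀ hr0 h1).symm, right_ne_zero_of_mul (h2 ▸ mul_ne_zero hp0 hq0)⟩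
  have add : ∀ {s : ℕ}, (f s = g s ∧ g s ≠ 0) →
      ∀ c, (Nat.lor M (2 ^ s)).testBit c = true → f c = g c ∧ g c ≠ 0 := by
    intro s hs c hc
    rcases testBit_lor hc with h | rfl
    exacts [hM c h, hs]
  obtain ⟨p, q, r, s⟩ := e
  dsimp only at hf hg
  rw [propagateStep]
  dsimp only
  cases hp : M.testBit p <;> cases hq : M.testBit q <;> cases hr : M.testBit r <;>
    cases hs : M.testBit s <;> simp only [cond, Bool.and_true, Bool.and_false] <;>
    first
    | exact hM
    | exact add (key hf hg hp hq hr)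
    | exact add (key (hf.trans (mul_comm _ _)) (hg.trans (mul_comm _ _)) hp hq hs)
    | exact add (key hf.symm hg.symm hr hs hp)
    | exact add (key (hf.symm.trans (mul_comm _ _)) (hg.symm.trans (mul_comm _ _)) hr hs hq)

theorem propagate_sound {f g : ℕ → ℂ} {es : List (ℕ × ℕ × ℕ × ℕ)}
    (hf : ∀ e ∈ es, f e.1 * f e.2.1 = f e.2.2.1 * f e.2.2.2)
    (hg : ∀ e ∈ es, g e.1 * g e.2.1 = g e.2.2.1 * g e.2.2.2)
    {M : ℕ} (hM : ∀ c, M.testBit c = true → f c = g c ∧ g c ≠ 0) {α : Type} (k : ℕ → α) :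
    ∃ M', propagate es M k = k M' ∧ ∀ c, M'.testBit c = true → f c = g c ∧ g c ≠ 0 := by
  induction es generalizing M with
  | nil => exact ⟨M, rfl, hM⟩
  | cons e es ih =>
    rw [propagate, force_eq]
    exact ih (fun e he => hf e (List.mem_cons_of_mem _ he))
      (fun e he => hg e (List.mem_cons_of_mem _ he))
      (propagateStep_sound (hf e (by simp)) (hg e (by simp)) hM)

theorem propagateThrice_sound {f g : ℕ → ℂ} {es : List (ℕ × ℕ × ℕ × ℕ)}
    (hf : ∀ e ∈ es, f e.1 * f e.2.1 = f e.2.2.1 * f e.2.2.2)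
    (hg : ∀ e ∈ es, g e.1 * g e.2.1 = g e.2.2.1 * g e.2.2.2)
    {M : ℕ} (hM : ∀ c, M.testBit c = true → f c = g c ∧ g c ≠ 0) {α : Type} (k : ℕ → α) :
    ∃ M', propagateThrice es M k = k M' ∧ ∀ c, M'.testBit c = true → f c = g c ∧ g c ≠ 0 := by
  obtain ⟨M1, h1, hM1⟩ := propagate_sound hf hg hM fun M => propagate es M fun M => propagate es M k
  obtain ⟨M2, h2, hM2⟩ := propagate_sound hf hg hM1 fun M => propagate es M k
  obtain ⟨M3, h3, hM3⟩ := propagate_sound hf hg hM2 k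
  exact ⟨M3, h1.trans (h2.trans h3), hM3⟩

theorem withActive_eq (M : ℕ) (es acc : List (ℕ × ℕ × ℕ × ℕ))
    (k : List (ℕ × ℕ × ℕ × ℕ) → Bool) :
    ∃ es', withActive M es acc k = k es' ∧ ∀ e ∈ es', e ∈ acc ∨ e ∈ es := by
  induction es generalizing acc with
  | nil => exact ⟨acc, rfl, fun e he => Or.inl he⟩
  | cons e es ih =>
    rw [withActive]
    cases Nat.testBit M e.1 && Nat.testBit M e.2.1 && Nat.testBit M e.2.2.1 && Nat.testBit M e.2.2.2
    · obtain ⟨es', h, h'⟩ := ih acc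
      exact ⟨es', h, fun x hx => (h' x hx).imp_right (List.mem_cons_of_mem _)⟩
    · obtain ⟨es', h, h'⟩ := ih (e :: acc)
      refine ⟨es', h, fun x hx => ?_⟩
      rcases h' x hx with hx | hx
      · exact (List.mem_cons.1 hx).symm.imp_right fun h => by simp [h]
      · exact Or.inr (List.mem_cons_of_mem _ hx)

theorem propagate_eq {α : Type} (es : List (ℕ × ℕ × ℕ × ℕ)) (M : ℕ) (k : ℕ → α) :
    ∃ M', propagate es M k = k M' := by
  induction es generalizing M with
  | nil => exact ⟨M, rfl⟩
  | cons e es ih =>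
    rw [propagate, force_eq]
    exact ih _

theorem withFreePositions_eq (es : List (ℕ × ℕ × ℕ × ℕ)) (l : List ℕ) (M : ℕ) (F : List ℕ)
    (k : List ℕ → Bool) : ∃ F', withFreePositions es l M F k = k F' := by
  induction l generalizing M F with
  | nil => exact ⟨F, rfl⟩
  | cons c l ih =>
    rw [withFreePositions]
    cases Nat.testBit M c
    · rw [propagateThrice]
      simp only [cond]
      obtain ⟨M1, h1⟩ := propagate_eq es (Nat.lor M (2 ^ c)) fun M => propagate es M fun M =>
        propagate es M fun M' => withFreePositions es l M' (c :: F) k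
      obtain ⟨M2, h2⟩ := propagate_eq es M1 fun M =>
        propagate es M fun M' => withFreePositions es l M' (c :: F) k
      obtain ⟨M3, h3⟩ := propagate_eq es M2 fun M' => withFreePositions es l M' (c :: F) k
      rw [h1, h2, h3]
      exact ih _ _
    · exact ih _ _

/-- What `hasNormalForm` provides: a set `F` of free positions and equations that determine the rest
of the support. -/
theorem exists_freePositions {s : Listed} (hs : s ∈ solutionList) :
    ∃ F : List ℕ, independentRows 10 (F.map (exponentRow s)) = true ∧ (∀ c ∈ F, c ∈ s.support) ∧
      ∀ f g : ℕ → ℂ, (∀ e ∈ twoTermEquations, f e.1 * f e.2.1 = f e.2.2.1 * f e.2.2.2) →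
        (∀ e ∈ twoTermEquations, g e.1 * g e.2.1 = g e.2.2.1 * g e.2.2.2) →
        (∀ c ∈ F, f c = g c ∧ g c ≠ 0) → ∀ c ∈ s.support, f c = g c := by
  have h := hasNormalForm_listed s hs
  rw [hasNormalForm, force_eq] at h
  obtain ⟨es, h1, hes⟩ := withActive_eq (maskOf s.support) twoTermEquations [] fun es =>
    withFreePositions es (positions.reverse.filter fun c => Nat.testBit (maskOf s.support) c) 0 []
    fun F => independentRows 10 (F.map (exponentRow s)) &&
      F.all (fun c => Nat.testBit (maskOf s.support) c) &&
      propagateThrice es (maskOf F) fun M => s.support.all fun c => Nat.testBit M c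
  rw [h1] at h
  obtain ⟨F, h2⟩ := withFreePositions_eq es
    (positions.reverse.filter fun c => Nat.testBit (maskOf s.support) c) 0 []
    fun F => independentRows 10 (F.map (exponentRow s)) &&
      F.all (fun c => Nat.testBit (maskOf s.support) c) &&
      propagateThrice es (maskOf F) fun M => s.support.all fun c => Nat.testBit M c
  rw [h2, Bool.and_eq_true, Bool.and_eq_true] at h
  obtain ⟨⟨hF, hFs⟩, hprop⟩ := h
  refine ⟨F, hF, fun c hc => (testBit_maskOf _ _).1 (List.all_eq_true.1 hFs c hc), ?_⟩
  intro f g hf hg hfg c hc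
  have hmem : ∀ e ∈ es, e ∈ twoTermEquations := fun e he => (hes e he).resolve_left (by simp)
  obtain ⟨M, hM, hMc⟩ := propagateThrice_sound (fun e he => hf e (hmem e he))
    (fun e he => hg e (hmem e he)) (M := maskOf F)
    (fun c hc => hfg c ((testBit_maskOf _ _).1 hc))
    fun M => s.support.all fun c => Nat.testBit M c
  rw [hM] at hprop
  exact (hMc c (List.all_eq_true.1 hprop c hc)).1

theorem matrix_eq_of_unused_parameters (s : Listed) (a b : ℂ) :
    s.matrix (if s.as = [] then 1 else a) (if s.bs = [] then 1 else b) = s.matrix a b := by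
  funext i j
  simp only [Listed.matrix]
  split_ifs <;> simp_all

/-- A solution with the support of a listed matrix is a normalization of this matrix for suitable
parameters. -/
theorem exists_normalForm {s : Listed} (hs : s ∈ solutionList) {ε : G → G → ℂ} (hε : IsSolution ε)
    (hsupp : ∀ c ∈ positions, entry ε c ≠ 0 ↔ c ∈ s.support) :
    ∃ k : G → ℂ, (∀ i, k i ≠ 0) ∧ ∃ a b : ℂ, a ≠ 0 ∧ b ≠ 0 ∧ (s.as = [] → a = 1) ∧
      (s.bs = [] → b = 1) ∧ ε = normalize k (s.matrix a b) := by
  obtain ⟨F, hF, hFs, hdet⟩ := exists_freePositions hs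
  have hpos := support_subset_positions s hs
  obtain ⟨w, hw⟩ := exists_solution_of_independentRows 10
    (F.map fun c => (exponentRow s c, Complex.log (entry ε c))) (by
      intro x hx
      obtain ⟨c, -, rfl⟩ := List.mem_map.1 hx
      rfl) (by rw [List.map_map]; exact hF)
  have hk : ∀ i : G, Complex.exp (w (pos i - 1)) ≠ 0 := fun i => Complex.exp_ne_zero _
  refine ⟨fun i => Complex.exp (w (pos i - 1)), hk,
    if s.as = [] then 1 else Complex.exp (w 8), if s.bs = [] then 1 else Complex.exp (w 9),
    by split_ifs <;> simp, by split_ifs <;> simp, fun h => if_pos h, fun h => if_pos h, ?_⟩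
  rw [matrix_eq_of_unused_parameters]
  have hτ := (isSolution_listed hs (Complex.exp (w 8)) (Complex.exp (w 9))).normalize hk
  rw [isSolution_iff_twoTermEquations] at hτ hε
  have hτe : ∀ c ∈ s.support, entry (normalize (fun i => Complex.exp (w (pos i - 1)))
      (s.matrix (Complex.exp (w 8)) (Complex.exp (w 9)))) c =
      Complex.exp (dot (exponentRow s c) w) := by
    intro c hc
    obtain ⟨-, -, h1, h2, -⟩ := relevant_of_mem_positions c (hpos c hc)
    have he := entry_matrix s (Complex.exp (w 8)) (Complex.exp (w 9)) (hpos c hc)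
    rw [entry, normalize, h1, h2]
    rw [if_pos hc, entry] at he
    rw [he, dot_exponentRow s (hpos c hc), Complex.exp_add, Complex.exp_add,
      Complex.exp_sub, Complex.exp_add, Complex.exp_nat_mul, Complex.exp_nat_mul, mul_assoc]
  have hall := hdet (entry ε) (entry (normalize (fun i => Complex.exp (w (pos i - 1)))
    (s.matrix (Complex.exp (w 8)) (Complex.exp (w 9))))) hε.2 hτ.2 fun c hc => by
      have h1 := hw _ (List.mem_map.2 ⟨c, hc, rfl⟩)
      dsimp only at h1
      rw [hτe c (hFs c hc), h1, Complex.exp_log ((hsupp c (hpos c (hFs c hc))).2 (hFs c hc))]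
      exact ⟨rfl, (hsupp c (hpos c (hFs c hc))).2 (hFs c hc)⟩
  funext i j
  by_cases hij : Relevant i j
  · rw [← entry_position hε.1.1 hij, ← entry_position hτ.1.1 hij]
    by_cases hc : position i j ∈ s.support
    · exact hall _ hc
    · have h1 := (not_congr (hsupp _ (position_mem_positions i j hij))).2 hc
      rw [not_not.1 h1, entry_position hτ.1.1 hij, eq_comm, normalize_eq_zero_iff hk,
        Listed.matrix_eq, if_neg hc]
  · rw [hε.1.2 i j hij, hτ.1.2 i j hij]

/-- A sign change of the matrices `X_i` for the indices number 4 and 6. -/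
def signChange (i : G) : ℤ := if pos i = 4 ∨ pos i = 6 then -1 else 1

theorem signChange_ne_zero : ∀ i, signChange i ≠ 0 := by decide

theorem degA_add_degB_parity : ∀ s ∈ solutionList,
    (match s.range with | .nonzero => true | .upperHalfB => false) = false →
    s.as ≠ [] ∧ s.bs ≠ [] ∧ ∀ i j : G, position i j ∈ s.support →
      signChange i * signChange j * (-1) ^ (s.degA (position i j) + s.degB (position i j)) =
        signChange (i + j) := by decide +kernel

/-- For the entry with restricted parameter range, the parameters `(a, b)` and `(-a, -b)` give
equivalent matrices. -/
theorem matrix_neg_parameters {s : Listed} (hs : s ∈ solutionList)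
    (hr : (match s.range with | .nonzero => true | .upperHalfB => false) = false) (a b : ℂ) :
    s.matrix a b = normalize (fun i => (signChange i : ℂ)) (s.matrix (-a) (-b)) := by
  funext i j
  rw [normalize, Listed.matrix_eq, Listed.matrix_eq]
  split_ifs with hij
  · have h := (degA_add_degB_parity s hs hr).2.2 i j hij
    have h' : (signChange i : ℂ) * signChange j *
        (-1) ^ (s.degA (position i j) + s.degB (position i j)) = signChange (i + j) := by
      exact_mod_cast h
    have h0 : (signChange (i + j) : ℂ) ≠ 0 := by exact_mod_cast signChange_ne_zero (i + j)
    rw [neg_pow a, neg_pow b, div_mul_eq_mul_div, eq_div_iff h0, ← h', pow_add]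
    ring
  · rw [mul_zero]

/-- A solution with the support of a listed matrix is equivalent to this matrix for admissible
parameters. -/
theorem exists_admissible_of_supportMatches {s : Listed} (hs : s ∈ solutionList) {ε : G → G → ℂ}
    (hε : IsSolution ε) {A : Matrix (Fin 2) (Fin 2) (ZMod 3)} (hA : A ∈ H3)
    (h : SupportMatches ε s A) :
    ∃ a b, s.Admissible a b ∧ Equivalent ε (s.matrix a b) := by
  have hεA := hε.pullback hA
  obtain ⟨k, hk, a, b, ha, hb, ha1, hb1, he⟩ := exists_normalForm hs hεA fun c hc => by
    obtain ⟨h1, h2, -⟩ := relevant_of_mem_positions c hc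
    have := h _ _ h1
    rwa [h2] at this
  have hequiv : Equivalent ε (s.matrix a b) := (equivalent_pullback hA ε).symm.trans
    (he ▸ equivalent_normalize hk _)
  cases hr : s.range with
  | nonzero => exact ⟨a, b, ⟨ha, hb, ha1, hb1, by simp only [hr]⟩, hequiv⟩
  | upperHalfB =>
    by_cases hpos : 0 < b.re ∨ (b.re = 0 ∧ 0 < b.im)
    · exact ⟨a, b, ⟨ha, hb, ha1, hb1, by simpa only [hr] using hpos⟩, hequiv⟩
    · have hr' : (match s.range with | .nonzero => true | .upperHalfB => false) = false := by
        rw [hr]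
      obtain ⟨has, hbs, -⟩ := degA_add_degB_parity s hs hr'
      refine ⟨-a, -b, ⟨neg_ne_zero.2 ha, neg_ne_zero.2 hb, fun h => absurd h has,
        fun h => absurd h hbs, ?_⟩, hequiv.trans (matrix_neg_parameters hs hr' a b ▸
          equivalent_normalize (fun i => by exact_mod_cast signChange_ne_zero i) _)⟩
      simp only [hr, Complex.neg_re, Complex.neg_im, neg_pos, neg_eq_zero]
      push Not at hpos
      rcases hpos.1.lt_or_eq with h | h
      · exact Or.inl h
      · refine Or.inr ⟨h, (hpos.2 h).lt_of_ne fun h' => hb (Complex.ext h h')⟩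

theorem supportMatches_of_equivalent {s : Listed} {a b : ℂ} (h : s.Admissible a b)
    {ε : G → G → ℂ} (he : Equivalent ε (s.matrix a b)) : ∃ A ∈ H3, SupportMatches ε s A := by
  obtain ⟨k, hk, A, hA, he⟩ := he.symm
  refine ⟨A, hA, fun i j _ => ?_⟩
  rw [← h.matrix_ne_zero_iff i j, he]
  exact (not_congr (normalize_eq_zero_iff hk (pullback A ε) i j)).symm

/-- Every solution is equivalent to exactly one listed matrix. -/
theorem existsUnique_listed {ε : G → G → ℂ} (hε : IsSolution ε) :
    ∃! n : Fin solutionList.length, ∃ a b, (solutionList.get n).Admissible a b ∧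
      Equivalent ε ((solutionList.get n).matrix a b) := by
  obtain ⟨n, ⟨A, hA, hn⟩, huniq⟩ := existsUnique_supportMatches hε
  refine ⟨n, exists_admissible_of_supportMatches (List.get_mem _ _) hε hA hn, ?_⟩
  rintro m ⟨a, b, hadm, he⟩
  exact huniq m (supportMatches_of_equivalent hadm he)

theorem eq_cont_positions_of_ν_lt :
    ∀ s ∈ solutionList, s.ν < 9 → s = cont 0 1 positions := by
  intro s hs hν
  have h0 : ∀ n : Fin solutionList.length, (solutionList.get n).ν < 9 → n.val = 0 := by
    decide +kernel
  obtain ⟨n, rfl⟩ := List.get_of_mem hs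
  have hn := h0 n hν
  rw [List.get_eq_getElem]
  simp only [hn]
  rfl

theorem matrix_cont_positions (a b : ℂ) : (cont 0 1 positions).matrix a b = trivialSolution := by
  funext i j
  rw [Listed.matrix, trivialSolution, cont]
  by_cases h : Relevant i j
  · rw [if_pos h, if_pos (position_mem_positions i j h)]
  · rw [if_neg h, if_neg fun hp => h (relevant_of_position_mem i j hp)]
    simp

theorem equivalent_trivialSolution_of_numZeros_lt {ε : G → G → ℂ} (hε : IsSolution ε)
    (h : numZeros ε < 9) : Equivalent ε trivialSolution := by
  obtain ⟨n, ⟨a, b, hadm, he⟩, -⟩ := existsUnique_listed hε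
  have hs := List.get_mem solutionList n
  have hν := numZeros_le_of_equivalent (isContractionMatrix_listed hs a b).1 hε.1.1 he.symm
  rw [numZeros_listed hs hadm] at hν
  rwa [eq_cont_positions_of_ν_lt _ hs (hν.trans_lt h), matrix_cont_positions] at he

/-! ### Higher-order identities -/

/-- Representatives of the second-order identities. -/
def secondOrderRepresentatives : List MonomialEquation :=
  [⟨[((0, 1), (1, 0)), ((0, 2), (1, 1))], [((0, 1), (2, 0)), ((0, 2), (2, 1))]⟩]

/-- Representatives of the third-order identities. -/
def thirdOrderRepresentatives : List MonomialEquation :=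
  [⟨[((0, 1), (1, 0)), ((0, 1), (1, 1)), ((0, 1), (1, 2))],
    [((0, 1), (2, 0)), ((0, 1), (2, 2)), ((0, 1), (2, 1))]⟩,
   ⟨[((0, 1), (1, 0)), ((0, 1), (1, 2)), ((0, 2), (2, 1))],
    [((0, 1), (2, 2)), ((0, 1), (2, 1)), ((0, 2), (1, 2))]⟩,
   ⟨[((0, 1), (1, 0)), ((0, 1), (1, 1)), ((0, 2), (2, 1))],
    [((0, 1), (2, 2)), ((0, 1), (2, 1)), ((0, 2), (1, 0))]⟩,
   ⟨[((0, 1), (1, 0)), ((0, 1), (1, 1)), ((0, 2), (2, 2))],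
    [((0, 1), (2, 0)), ((0, 1), (2, 2)), ((0, 2), (1, 0))]⟩]

/-- Representatives of all higher-order identities. -/
def representatives : List MonomialEquation :=
  secondOrderRepresentatives ++ thirdOrderRepresentatives

theorem transform_mem_identities {r : MonomialEquation} (hr : r ∈ representatives)
    {A : Matrix (Fin 2) (Fin 2) (ZMod 3)} (hA : A.det = 1) :
    r.transform A ∈ secondOrderIdentities ∪ thirdOrderIdentities := by
  rcases List.mem_append.1 hr with hr | hr
  exacts [Or.inl ⟨A, hA, r, hr, rfl⟩, Or.inr ⟨A, hA, r, hr, rfl⟩]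

theorem holds_transform_iff (A : Matrix (Fin 2) (Fin 2) (ZMod 3)) (e : MonomialEquation)
    (ε : G → G → ℂ) : (e.transform A).Holds ε ↔ e.Holds (pullback A ε) := by
  simp only [MonomialEquation.Holds, MonomialEquation.transform, List.map_map, Function.comp_def,
    pullback]

/-- The positions of the factors of one side of an equation. -/
def sidePositions (l : List (G × G)) : List ℕ := l.map fun p => position p.1 p.2

theorem mem_positions_of_mem_sidePositions {l : List (G × G)} (h : ∀ p ∈ l, Relevant p.1 p.2) :
    ∀ c ∈ sidePositions l, c ∈ positions := by
  intro c hc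
  obtain ⟨p, hp, rfl⟩ := List.mem_map.1 hc
  exact position_mem_positions _ _ (h p hp)

theorem prod_sidePositions {ε : G → G → ℂ} (hε : ∀ i j, ε i j = ε j i) {l : List (G × G)}
    (hl : ∀ p ∈ l, Relevant p.1 p.2) :
    ((sidePositions l).map (entry ε)).prod = (l.map fun p => ε p.1 p.2).prod := by
  rw [sidePositions, List.map_map]
  congr 1
  exact List.map_congr_left fun p hp => entry_position hε (hl p hp)

theorem relevant_of_mem_representatives : ∀ r ∈ representatives,
    (∀ p ∈ r.lhs, Relevant p.1 p.2) ∧ ∀ p ∈ r.rhs, Relevant p.1 p.2 := by decide +kernel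

/-- A solution without zeros is a normalization of the trivial solution. -/
theorem exists_normalization_of_noZeros {ε : G → G → ℂ} (hε : IsSolution ε) (h : NoZeros ε) :
    ∃ k : G → ℂ, (∀ i, k i ≠ 0) ∧ ∀ i j, Relevant i j → ε i j = k i * k j / k (i + j) := by
  obtain ⟨k, hk, a, b, -, -, -, -, he⟩ := exists_normalForm (s := cont 0 1 positions)
    (by rw [solutionList]; exact List.mem_cons_self) hε fun c hc =>
      iff_of_true (h _ _ (relevant_of_mem_positions c hc).1)
        (by simpa [Listed.support, cont] using hc)
  refine ⟨k, hk, fun i j hij => ?_⟩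
  rw [he, matrix_cont_positions, normalize, trivialSolution, if_pos hij, mul_one]

/-- On normalization matrices the representatives hold since on both sides the indices of the
factors and their sums agree. -/
theorem holds_representative {ε : G → G → ℂ} (hε : IsSolution ε) (h : NoZeros ε) :
    ∀ r ∈ representatives, r.Holds ε := by
  obtain ⟨k, hk, hval⟩ := exists_normalization_of_noZeros hε h
  have h1 : ε (0, 1) (1, 0) = k (0, 1) * k (1, 0) / k (1, 1) := hval _ _ (by decide)
  have h2 : ε (0, 1) (1, 1) = k (0, 1) * k (1, 1) / k (1, 2) := hval _ _ (by decide)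
  have h3 : ε (0, 1) (1, 2) = k (0, 1) * k (1, 2) / k (1, 0) := hval _ _ (by decide)
  have h4 : ε (0, 1) (2, 0) = k (0, 1) * k (2, 0) / k (2, 1) := hval _ _ (by decide)
  have h5 : ε (0, 1) (2, 1) = k (0, 1) * k (2, 1) / k (2, 2) := hval _ _ (by decide)
  have h6 : ε (0, 1) (2, 2) = k (0, 1) * k (2, 2) / k (2, 0) := hval _ _ (by decide)
  have h7 : ε (0, 2) (1, 0) = k (0, 2) * k (1, 0) / k (1, 2) := hval _ _ (by decide)
  have h8 : ε (0, 2) (1, 1) = k (0, 2) * k (1, 1) / k (1, 0) := hval _ _ (by decide)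
  have h9 : ε (0, 2) (1, 2) = k (0, 2) * k (1, 2) / k (1, 1) := hval _ _ (by decide)
  have h10 : ε (0, 2) (2, 1) = k (0, 2) * k (2, 1) / k (2, 0) := hval _ _ (by decide)
  have h11 : ε (0, 2) (2, 2) = k (0, 2) * k (2, 2) / k (2, 1) := hval _ _ (by decide)
  have := hk (0, 1)
  have := hk (0, 2)
  have := hk (1, 0)
  have := hk (1, 1)
  have := hk (1, 2)
  have := hk (2, 0)
  have := hk (2, 1)
  have := hk (2, 2)
  intro r hr
  simp only [representatives, secondOrderRepresentatives, thirdOrderRepresentatives,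
    List.cons_append, List.nil_append, List.mem_cons, List.not_mem_nil, or_false] at hr
  rcases hr with rfl | rfl | rfl | rfl | rfl <;>
    simp only [MonomialEquation.Holds, List.map_cons, List.map_nil, List.prod_cons, List.prod_nil,
      h1, h2, h3, h4, h5, h6, h7, h8, h9, h10, h11] <;> field_simp

theorem NoZeros.pullback {A : Matrix (Fin 2) (Fin 2) (ZMod 3)} (hA : A ∈ H3) {ε : G → G → ℂ}
    (h : NoZeros ε) : NoZeros (pullback A ε) := fun i j hij =>
  h _ _ ((relevant_act_iff hA i j).2 hij)

theorem holds_identity {ε : G → G → ℂ} (hε : IsSolution ε) (h : NoZeros ε) :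
    ∀ e ∈ secondOrderIdentities ∪ thirdOrderIdentities, e.Holds ε := by
  have key : ∀ A : Matrix (Fin 2) (Fin 2) (ZMod 3), A.det = 1 → ∀ r ∈ representatives,
      (r.transform A).Holds ε := fun A hA r hr => (holds_transform_iff A r ε).2
    (holds_representative (hε.pullback (Or.inl hA)) (h.pullback (Or.inl hA)) r hr)
  rintro e (⟨A, hA, r, hr, rfl⟩ | ⟨A, hA, r, hr, rfl⟩)
  exacts [key A hA r (List.mem_append_left _ hr), key A hA r (List.mem_append_right _ hr)]

theorem relevant_map_act {A : Matrix (Fin 2) (Fin 2) (ZMod 3)} (hA : A ∈ H3) {l : List (G × G)}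
    (h : ∀ p ∈ l, Relevant p.1 p.2) :
    ∀ p ∈ l.map fun p => (act A p.1, act A p.2), Relevant p.1 p.2 := by
  intro p hp
  obtain ⟨q, hq, rfl⟩ := List.mem_map.1 hp
  exact (relevant_act_iff hA _ _).2 (h q hq)

theorem sidePositions_map_act {N : ℕ} {A : Matrix (Fin 2) (Fin 2) (ZMod 3)} (hN : Encodes N A)
    {l : List (G × G)} (h : ∀ p ∈ l, Relevant p.1 p.2) :
    sidePositions (l.map fun p => (act A p.1, act A p.2)) = (sidePositions l).map (relabel N) := by
  rw [sidePositions, sidePositions, List.map_map, List.map_map]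
  exact List.map_congr_left fun p hp => (relabel_position hN (h p hp)).symm

/-- Each representative, or rather an equation in its orbit, has one vanishing and one non-vanishing
side for some listed matrix. -/
theorem exists_violation_of_representative : ∀ r ∈ representatives, ∃ s ∈ solutionList,
    ∃ N ∈ specialSymmetries, (s.monomial ((sidePositions r.lhs).map (relabel N))).isSome ≠
      (s.monomial ((sidePositions r.rhs).map (relabel N))).isSome := by
  decide +kernel

theorem evalMonomial_ne {a b : ℂ} (ha : a ≠ 0) (hb : b ≠ 0) {x y : Option (ℕ × ℕ)}
    (h : x.isSome ≠ y.isSome) : evalMonomial a b x ≠ evalMonomial a b y := by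
  rcases x with _ | ⟨x, x'⟩ <;> rcases y with _ | ⟨y, y'⟩
  · exact absurd rfl h
  · exact (mul_ne_zero (pow_ne_zero _ ha) (pow_ne_zero _ hb)).symm
  · exact mul_ne_zero (pow_ne_zero _ ha) (pow_ne_zero _ hb)
  · exact absurd rfl h

theorem holds_listed_iff {s : Listed} (hs : s ∈ solutionList) (a b : ℂ) {e : MonomialEquation}
    (hl : ∀ p ∈ e.lhs, Relevant p.1 p.2) (hr : ∀ p ∈ e.rhs, Relevant p.1 p.2) :
    e.Holds (s.matrix a b) ↔ evalMonomial a b (s.monomial (sidePositions e.lhs)) =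
      evalMonomial a b (s.monomial (sidePositions e.rhs)) := by
  have hsymm := (isContractionMatrix_listed hs a b).1
  rw [MonomialEquation.Holds, ← prod_sidePositions hsymm hl, ← prod_sidePositions hsymm hr,
    prod_entry_matrix s a b (mem_positions_of_mem_sidePositions hl),
    prod_entry_matrix s a b (mem_positions_of_mem_sidePositions hr)]

theorem disjoint_sides_representative : ∀ r ∈ representatives, ∀ x ∈ MonomialEquation.side r.lhs,
    ∀ y ∈ MonomialEquation.side r.rhs, x ≠ y := by decide +kernel

theorem side_map (A : Matrix (Fin 2) (Fin 2) (ZMod 3)) (l : List (G × G)) :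
    MonomialEquation.side (l.map fun p => (act A p.1, act A p.2)) =
      (MonomialEquation.side l).map (Sym2.map (act A)) := by
  simp [MonomialEquation.side, Function.comp_def]

theorem isHigherOrderIdentity_transform {r : MonomialEquation} (hr : r ∈ representatives) {n : ℕ}
    (hl : r.lhs.length = n) (hl' : r.rhs.length = n) {A : Matrix (Fin 2) (Fin 2) (ZMod 3)}
    (hA : A.det = 1) : IsHigherOrderIdentity n (r.transform A) := by
  have hA3 : A ∈ H3 := Or.inl hA
  obtain ⟨h1, h2⟩ := relevant_of_mem_representatives r hr
  refine ⟨by simpa [MonomialEquation.transform] using hl,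
    by simpa [MonomialEquation.transform] using hl', ?_, ?_, ?_, ?_⟩
  · intro p hp
    rw [MonomialEquation.transform, ← List.map_append] at hp
    obtain ⟨q, hq, rfl⟩ := List.mem_map.1 hp
    refine (relevant_act_iff hA3 _ _).2 ?_
    rcases List.mem_append.1 hq with hq | hq
    exacts [h1 q hq, h2 q hq]
  · rw [MonomialEquation.transform, side_map, side_map, Multiset.disjoint_map_map]
    exact fun x hx y hy h => disjoint_sides_representative r hr x hx y hy (Sym2.map.injective (act_injective hA3) h)
  · exact fun ε hε h => holds_identity hε h _ (transform_mem_identities hr hA)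
  · obtain ⟨s, hs, N, hN, hne⟩ := exists_violation_of_representative r hr
    obtain ⟨B, hB, hNB⟩ := exists_matrix_of_mem_special hN
    have hB3 : B ∈ H3 := Or.inl hB
    have hsol := (isSolution_listed hs 1 1).pullback hB3
    have hv : ¬ r.Holds (pullback B (s.matrix 1 1)) := by
      rw [← holds_transform_iff, holds_listed_iff hs 1 1 (relevant_map_act hB3 h1)
        (relevant_map_act hB3 h2), MonomialEquation.transform, sidePositions_map_act hNB h1,
        sidePositions_map_act hNB h2]
      exact evalMonomial_ne one_ne_zero one_ne_zero hne
    have hinv : pullback A (pullback A⁻¹ (pullback B (s.matrix 1 1))) =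
        pullback B (s.matrix 1 1) := by
      funext i j
      rw [pullback, pullback, act_inv_act hA3, act_inv_act hA3]
    refine ⟨pullback A⁻¹ (pullback B (s.matrix 1 1)), hsol.pullback (inv_mem_H3 hA3), fun h => hv ?_,
      by rwa [holds_transform_iff, hinv]⟩
    have h3 := h.pullback hA3
    rw [hinv] at h3
    exact holds_representative hsol h3 r hr

theorem isHigherOrderIdentity_second : ∀ e ∈ secondOrderIdentities, IsHigherOrderIdentity 2 e := by
  rintro e ⟨A, hA, r, hr, rfl⟩
  have h : ∀ r ∈ secondOrderRepresentatives, r.lhs.length = 2 ∧ r.rhs.length = 2 := by decide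
  exact isHigherOrderIdentity_transform (List.mem_append_left _ hr) (h r hr).1 (h r hr).2 hA

theorem isHigherOrderIdentity_third : ∀ e ∈ thirdOrderIdentities, IsHigherOrderIdentity 3 e := by
  rintro e ⟨A, hA, r, hr, rfl⟩
  have h : ∀ r ∈ thirdOrderRepresentatives, r.lhs.length = 3 ∧ r.rhs.length = 3 := by decide
  exact isHigherOrderIdentity_transform (List.mem_append_right _ hr) (h r hr).1 (h r hr).2 hA

/-! ### Violated identities -/

/-- The higher-order identities in terms of positions. -/
def identityPositions : List (List ℕ × List ℕ) :=
  specialSymmetries.flatMap fun N => representatives.map fun r =>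
    ((sidePositions r.lhs).map (relabel N), (sidePositions r.rhs).map (relabel N))

theorem exists_identity_of_mem_identityPositions {x : List ℕ × List ℕ}
    (hx : x ∈ identityPositions) : ∃ e ∈ secondOrderIdentities ∪ thirdOrderIdentities,
      (∀ p ∈ e.lhs, Relevant p.1 p.2) ∧ (∀ p ∈ e.rhs, Relevant p.1 p.2) ∧
      sidePositions e.lhs = x.1 ∧ sidePositions e.rhs = x.2 := by
  obtain ⟨N, hN, hx⟩ := List.mem_flatMap.1 hx
  obtain ⟨r, hr, rfl⟩ := List.mem_map.1 hx
  obtain ⟨A, hA, hNA⟩ := exists_matrix_of_mem_special hN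
  obtain ⟨h1, h2⟩ := relevant_of_mem_representatives r hr
  have hA3 : A ∈ H3 := Or.inl hA
  exact ⟨r.transform A, transform_mem_identities hr hA, relevant_map_act hA3 h1,
    relevant_map_act hA3 h2, sidePositions_map_act hNA h1, sidePositions_map_act hNA h2⟩

/-- The quotient of the two sides of an identity for a listed matrix, as a pair of exponents of the
parameters, or `none` if one of the sides vanishes. -/
def Listed.ratio (s : Listed) (x : List ℕ × List ℕ) : Option (ℤ × ℤ) :=
  match s.monomial x.1, s.monomial x.2 with
  | some y, some z => some ((y.1 : ℤ) - z.1, (y.2 : ℤ) - z.2)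
  | _, _ => none

theorem eval_ratio {s : Listed} {x : List ℕ × List ℕ} {d : ℤ × ℤ} (h : s.ratio x = some d)
    {a b : ℂ} (ha : a ≠ 0) (hb : b ≠ 0) : evalMonomial a b (s.monomial x.1) ≠ 0 ∧
      evalMonomial a b (s.monomial x.2) ≠ 0 ∧
      evalMonomial a b (s.monomial x.1) / evalMonomial a b (s.monomial x.2) =
        a ^ d.1 * b ^ d.2 := by
  rw [Listed.ratio] at h
  split at h
  · rename_i y z hy hz
    rw [hy, hz, ← Option.some.inj h]
    refine ⟨mul_ne_zero (pow_ne_zero _ ha) (pow_ne_zero _ hb),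
      mul_ne_zero (pow_ne_zero _ ha) (pow_ne_zero _ hb), ?_⟩
    simp only [evalMonomial, zpow_sub₀ ha, zpow_sub₀ hb, zpow_natCast]
    field_simp
  · cases h

/-- Some identity has one vanishing and one non-vanishing side. -/
def Listed.violates (s : Listed) : Bool :=
  identityPositions.any fun x => (s.monomial x.1).isSome != (s.monomial x.2).isSome

/-- Some identity amounts to `a ^ d.1 * b ^ d.2 = 1`. -/
def Listed.hasRatio (s : Listed) (d : ℤ × ℤ) : Bool :=
  identityPositions.any fun x => decide (s.ratio x = some d)

theorem exists_violated_of_violates {s : Listed} (hs : s ∈ solutionList) (h : s.violates = true)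
    {a b : ℂ} (ha : a ≠ 0) (hb : b ≠ 0) :
    ∃ e ∈ secondOrderIdentities ∪ thirdOrderIdentities, ¬ e.Holds (s.matrix a b) := by
  obtain ⟨x, hx, hne⟩ := List.any_eq_true.1 h
  obtain ⟨e, he, h1, h2, h3, h4⟩ := exists_identity_of_mem_identityPositions hx
  refine ⟨e, he, ?_⟩
  rw [holds_listed_iff hs a b h1 h2, h3, h4]
  exact evalMonomial_ne ha hb (bne_iff_ne.1 hne)

theorem exists_violated_of_hasRatio {s : Listed} (hs : s ∈ solutionList) {d : ℤ × ℤ}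
    (h : s.hasRatio d = true) {a b : ℂ} (ha : a ≠ 0) (hb : b ≠ 0) (hne : a ^ d.1 * b ^ d.2 ≠ 1) :
    ∃ e ∈ secondOrderIdentities ∪ thirdOrderIdentities, ¬ e.Holds (s.matrix a b) := by
  obtain ⟨x, hx, hd⟩ := List.any_eq_true.1 h
  obtain ⟨e, he, h1, h2, h3, h4⟩ := exists_identity_of_mem_identityPositions hx
  obtain ⟨h5, h6, h7⟩ := eval_ratio (of_decide_eq_true hd) ha hb
  refine ⟨e, he, ?_⟩
  rw [holds_listed_iff hs a b h1 h2, h3, h4]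
  intro heq
  rw [heq, div_self h6] at h7
  exact hne h7.symm

/-- The identities force the parameters to be `1`: they contain `a = 1` and `b = 1`, or else `a b = 1`
and `b² = 1`, where `b = -1` is not admissible. -/
def Listed.forcesOne (s : Listed) : Bool :=
  (s.as.isEmpty || s.hasRatio (1, 0)) && (s.bs.isEmpty || s.hasRatio (0, 1)) ||
  (s.hasRatio (1, 1) && s.hasRatio (0, 2) &&
    match s.range with | .nonzero => false | .upperHalfB => true)

theorem violated_identities_of_kind : ∀ s ∈ solutionList,
    (match s.kind with
    | .continuous => s.as.isEmpty && s.bs.isEmpty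
    | .discrete => s.violates
    | .continuousAtOne => s.forcesOne) = true := by decide +kernel

/-- A listed matrix not marked continuous violates a higher-order identity. -/
theorem exists_violated_identity {s : Listed} (hs : s ∈ solutionList) {a b : ℂ}
    (h : s.Admissible a b) (hc : ¬ s.MarkedContinuous a b) :
    ∃ e ∈ secondOrderIdentities ∪ thirdOrderIdentities, ¬ e.Holds (s.matrix a b) := by
  obtain ⟨ha, hb, ha1, hb1, hrange⟩ := h
  have hkind := violated_identities_of_kind s hs
  rw [Listed.MarkedContinuous] at hc
  cases hk : s.kind with
  | continuous =>
    rw [hk] at hc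
    exact absurd trivial hc
  | discrete =>
    rw [hk] at hkind
    exact exists_violated_of_violates hs hkind ha hb
  | continuousAtOne =>
    rw [hk] at hkind hc
    simp only [Listed.forcesOne, Bool.or_eq_true, Bool.and_eq_true, List.isEmpty_iff] at hkind
    rcases hkind with ⟨hA, hB⟩ | ⟨⟨hAB, hB⟩, hr⟩
    · by_cases ha' : a = 1
      · have hb' : b ≠ 1 := fun hb' => hc ⟨ha', hb'⟩
        exact exists_violated_of_hasRatio hs (hB.resolve_left fun h0 => hb' (hb1 h0)) ha hb
          (by simpa using hb')
      · exact exists_violated_of_hasRatio hs (hA.resolve_left fun h0 => ha' (ha1 h0)) ha hb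
          (by simpa using ha')
    · by_cases hab : a * b = 1
      · refine exists_violated_of_hasRatio hs hB ha hb fun hbb => hc ?_
        have hbb : b ^ 2 = 1 := by
          rw [zpow_zero, one_mul] at hbb
          exact_mod_cast hbb
        have hb' : b = 1 := by
          have hbb : (b - 1) * (b + 1) = 0 := by linear_combination hbb
          rcases mul_eq_zero.1 hbb with h | h
          · exact sub_eq_zero.1 h
          · rw [eq_neg_of_add_eq_zero_left h] at hrange
            cases hs' : s.range with
            | nonzero => simp [hs'] at hr
            | upperHalfB =>
              rw [hs'] at hrange
              norm_num at hrange
        exact ⟨by simpa [hb'] using hab, hb'⟩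
      · exact exists_violated_of_hasRatio hs hAB ha hb (by simpa using hab)

/-! ### Continuous and discrete contractions -/

/-- Along a contraction path the higher-order identities hold, hence also in the limit. -/
theorem holds_of_isContractionPath {γ : ℝ → G → G → ℂ} {ε : G → G → ℂ} (h : IsContractionPath γ ε) :
    ∀ e ∈ secondOrderIdentities ∪ thirdOrderIdentities, e.Holds ε := by
  intro e he
  have hrel : (∀ p ∈ e.lhs, Relevant p.1 p.2) ∧ ∀ p ∈ e.rhs, Relevant p.1 p.2 := by
    have hI : ∃ n, IsHigherOrderIdentity n e := by
      rcases he with he | he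
      exacts [⟨2, isHigherOrderIdentity_second e he⟩, ⟨3, isHigherOrderIdentity_third e he⟩]
    obtain ⟨n, -, -, hI, -⟩ := hI
    exact ⟨fun p hp => hI p (List.mem_append_left _ hp),
      fun p hp => hI p (List.mem_append_right _ hp)⟩
  have hlim : ∀ l : List (G × G), (∀ p ∈ l, Relevant p.1 p.2) →
      Tendsto (fun t => (l.map fun p => γ t p.1 p.2).prod) (𝓝[>] 0)
        (𝓝 (l.map fun p => ε p.1 p.2).prod) := by
    intro l
    induction l with
    | nil => exact fun _ => tendsto_const_nhds
    | cons p l ih =>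
      intro hl
      simp only [List.map_cons, List.prod_cons]
      exact (h.2 p.1 p.2 (hl p (by simp))).2.2.2.mul
        (ih fun q hq => hl q (List.mem_cons_of_mem _ hq))
  refine tendsto_nhds_unique_of_eventuallyEq (hlim e.lhs hrel.1) (hlim e.rhs hrel.2) ?_
  filter_upwards [Ioc_mem_nhdsGT (show (0 : ℝ) < 1 by norm_num)] with t ht
  exact holds_identity (h.1 t ht) (fun i j hij => (h.2 i j hij).2.2.1 t ht) e he

/-- For each continuous listed matrix (with parameters `1`), integers `n_1, …, n_8` that define a
generalized Inönü–Wigner contraction, as decimal digits: `n_m` has weight `10 ^ m`. -/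
def contractionExponents : List ℕ :=
  [0, 121212000, 121212300, 111100110, 121212100, 331524210, 331524510, 110211110,
   331221210, 122433210, 331524310, 111322310, 231423110, 543342210, 122433310, 111322210,
   131322310, 543342510, 311221210, 323221110, 111110110, 442321320, 312221310, 112211110,
   221423310, 132433310, 231533220, 131322210, 543342310, 523342210, 523342510, 332231210,
   332231310, 322231110, 442341320, 332221210, 221211110, 324332110, 322221110, 121322210,
   523342310, 333241310, 433351220, 422341220, 322231310, 333221310, 323231110, 433321220,
   442331320, 312221210, 323231410, 322221310, 211221110, 211211110, 221221110, 332322110,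
   442523220, 222211110, 223322110, 335432220, 234422220, 422321220, 432331220, 322231210,
   333231310, 433331220, 323231210, 322221210, 422331320, 321422220, 331432220, 432422220,
   442432220, 331422220, 111221210, 443422220, 345533220, 112221210, 111211110, 422331220,
   433331320, 432432220, 222231210, 222211210, 122221210, 334422220, 222322110, 222221210,
   111111110]

/-- The exponents `n_i + n_j` and `n_{i+j}` agree at the positions of the support of `s`, and the
first is greater at all others. -/
def Listed.isContractionExponent (s : Listed) (N : ℕ) : Bool :=
  positions.all fun c =>
    let x := N / 10 ^ (c / 10) % 10 + N / 10 ^ (c % 10) % 10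
    let y := N / 10 ^ pos (ofPos (c / 10) + ofPos (c % 10)) % 10
    if c ∈ s.support then Nat.beq x y else Nat.blt y x

theorem exists_contractionExponent : ∀ s ∈ solutionList,
    (match s.kind with | .discrete => true | _ => false) = false →
    ∃ N ∈ contractionExponents, s.isContractionExponent N = true := by decide +kernel

theorem isSolution_trivialSolution : IsSolution trivialSolution := by
  rw [← matrix_cont_positions 1 1]
  exact isSolution_listed (by rw [solutionList]; exact List.mem_cons_self) 1 1

theorem isSolution_powerPath (n : G → ℤ) {t : ℝ} (ht : t ≠ 0) : IsSolution (powerPath n t) := by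
  have ht' : (t : ℂ) ≠ 0 := by exact_mod_cast ht
  have h : powerPath n t = normalize (fun i => (t : ℂ) ^ n i) trivialSolution := by
    funext i j
    rw [powerPath, normalize, trivialSolution]
    split_ifs
    · rw [zpow_sub₀ ht', zpow_add₀ ht', mul_one]
    · rw [mul_zero]
  rw [h]
  exact isSolution_trivialSolution.normalize fun i => zpow_ne_zero _ ht'

theorem isContractionPath_powerPath {n : G → ℤ} {ε : G → G → ℂ}
    (h : ∀ i j, Relevant i j → n i + n j - n (i + j) = 0 ∧ ε i j = 1 ∨
      0 < n i + n j - n (i + j) ∧ ε i j = 0) : IsContractionPath (powerPath n) ε := by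
  refine ⟨fun t ht => isSolution_powerPath n ht.1.ne', fun i j hij => ?_⟩
  simp only [powerPath, if_pos hij]
  refine ⟨?_, by simp, fun t ht => zpow_ne_zero _ (by exact_mod_cast ht.1.ne'), ?_⟩
  · exact Complex.continuous_ofReal.continuousOn.zpow₀ _ fun t ht =>
      Or.inl (by exact_mod_cast ht.1.ne')
  · rcases h i j hij with ⟨h0, h1⟩ | ⟨h0, h1⟩
    · simp [h0, h1]
    · obtain ⟨m, hm⟩ := Int.eq_ofNat_of_zero_le h0.le
      rw [hm, h1]
      have hm0 : m ≠ 0 := by omega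
      have hc : Continuous fun t : ℝ => (t : ℂ) ^ m := by fun_prop
      have ht := hc.tendsto 0
      simp only [Complex.ofReal_zero, zero_pow hm0] at ht
      simpa only [zpow_natCast] using ht.mono_left nhdsWithin_le_nhds

theorem isGeneralizedInonuWigner_listed {s : Listed} (hs : s ∈ solutionList)
    (hk : (match s.kind with | .discrete => true | _ => false) = false) :
    IsGeneralizedInonuWigner (s.matrix 1 1) := by
  obtain ⟨N, -, hN⟩ := exists_contractionExponent s hs hk
  refine ⟨isSolution_listed hs 1 1, fun i => ((N / 10 ^ pos i % 10 : ℕ) : ℤ),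
    isContractionPath_powerPath fun i j hij => ?_⟩
  have hp := position_mem_positions i j hij
  have hc := List.all_eq_true.1 hN _ hp
  obtain ⟨-, -, h3, h4, -, -⟩ := relevant_of_mem_positions _ hp
  have hsum : ofPos (position i j / 10) + ofPos (position i j % 10) = i + j ∧
      N / 10 ^ (position i j / 10) % 10 + N / 10 ^ (position i j % 10) % 10 =
        N / 10 ^ pos i % 10 + N / 10 ^ pos j % 10 := by
    rcases ofPos_position i j hij with ⟨h1, h2⟩ | ⟨h1, h2⟩ <;>
      refine ⟨by rw [h1, h2, add_comm], ?_⟩ <;> rw [← h3, ← h4, h1, h2]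
    rw [add_comm]
  simp only [hsum.1, hsum.2] at hc
  rw [Listed.matrix_eq]
  split_ifs at hc ⊢ with hm
  · have := Nat.eq_of_beq_eq_true hc
    exact Or.inl ⟨by omega, by simp⟩
  · rw [Nat.blt_eq] at hc
    exact Or.inr ⟨by omega, rfl⟩

/-- The marks of the listed matrices are correct. -/
theorem marked_listed {s : Listed} (hs : s ∈ solutionList) {a b : ℂ} (h : s.Admissible a b) :
    (s.MarkedContinuous a b →
      IsContinuousSolution (s.matrix a b) ∧ IsGeneralizedInonuWigner (s.matrix a b)) ∧
    (¬ s.MarkedContinuous a b → IsDiscreteSolution (s.matrix a b) ∧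
      ∃ e ∈ secondOrderIdentities ∪ thirdOrderIdentities, ¬ e.Holds (s.matrix a b)) := by
  refine ⟨fun hc => ?_, fun hc => ?_⟩
  · have hG : a = 1 ∧ b = 1 ∧
        (match s.kind with | .discrete => true | _ => false) = false := by
      have hkind := violated_identities_of_kind s hs
      rw [Listed.MarkedContinuous] at hc
      cases hk : s.kind with
      | continuous =>
        rw [hk] at hkind
        simp only [Bool.and_eq_true, List.isEmpty_iff] at hkind
        exact ⟨h.2.2.1 hkind.1, h.2.2.2.1 hkind.2, rfl⟩
      | discrete => simp [hk] at hc
      | continuousAtOne =>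
        rw [hk] at hc
        exact ⟨hc.1, hc.2, rfl⟩
    obtain ⟨rfl, rfl, hk⟩ := hG
    have hIW := isGeneralizedInonuWigner_listed hs hk
    obtain ⟨hsol, n, hn⟩ := hIW
    exact ⟨⟨hsol, _, hn⟩, hsol, n, hn⟩
  · obtain ⟨e, he, hv⟩ := exists_violated_identity hs h hc
    exact ⟨⟨isSolution_listed hs a b, fun ⟨γ, hγ⟩ => hv (holds_of_isContractionPath hγ e he)⟩,
      e, he, hv⟩

/-! ### Finiteness of the parameters in an equivalence class -/

/-- The quotient of the two sides of a higher-order identity is invariant under normalization. -/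
theorem prod_normalize {k : G → ℂ} (hk : ∀ i, k i ≠ 0) (ε : G → G → ℂ) {e : MonomialEquation}
    (he : e ∈ secondOrderIdentities ∪ thirdOrderIdentities)
    (hl : ∀ p ∈ e.lhs, Relevant p.1 p.2) (hr : ∀ p ∈ e.rhs, Relevant p.1 p.2) :
    ∃ x : ℂ, (e.lhs.map fun p => normalize k ε p.1 p.2).prod =
        x * (e.lhs.map fun p => ε p.1 p.2).prod ∧
      (e.rhs.map fun p => normalize k ε p.1 p.2).prod = x * (e.rhs.map fun p => ε p.1 p.2).prod := by
  have key : ∀ l : List (G × G), (∀ p ∈ l, Relevant p.1 p.2) →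
      (l.map fun p => normalize k ε p.1 p.2).prod =
        (l.map fun p => normalize k trivialSolution p.1 p.2).prod *
          (l.map fun p => ε p.1 p.2).prod := by
    intro l
    induction l with
    | nil => simp
    | cons p l ih =>
      intro h
      simp only [List.map_cons, List.prod_cons]
      rw [ih fun q hq => h q (List.mem_cons_of_mem _ hq), normalize, normalize, trivialSolution,
        if_pos (h p (by simp))]
      ring
  have htriv := holds_identity (isSolution_trivialSolution.normalize hk) (fun i j hij => by
    rw [Ne, normalize_eq_zero_iff hk, trivialSolution, if_pos hij]
    exact one_ne_zero) e he
  rw [MonomialEquation.Holds] at htriv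
  exact ⟨_, key _ hl, by rw [key _ hr, htriv]⟩

/-- For each identity, the quotient of its two sides takes only finitely many values on the matrices
equivalent to a given one. -/
theorem exists_ratio_value {s : Listed} (hs : s ∈ solutionList) (a b : ℂ) {x : List ℕ × List ℕ}
    (hx : x ∈ identityPositions) {d : ℤ × ℤ} (hd : s.ratio x = some d) :
    ∃ v : Matrix (Fin 2) (Fin 2) (ZMod 3) → ℂ, ∀ q : ℂ × ℂ, s.Admissible q.1 q.2 →
      Equivalent (s.matrix q.1 q.2) (s.matrix a b) → ∃ A, q.1 ^ d.1 * q.2 ^ d.2 = v A := by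
  obtain ⟨e, he, h1, h2, h3, h4⟩ := exists_identity_of_mem_identityPositions hx
  refine ⟨fun A => (e.lhs.map fun p => pullback A (s.matrix a b) p.1 p.2).prod /
    (e.rhs.map fun p => pullback A (s.matrix a b) p.1 p.2).prod, fun q hq hequiv => ?_⟩
  obtain ⟨k, hk, A, hA, heq⟩ := (equivalent_iff _ _).1 hequiv
  obtain ⟨hl0, hr0, hv⟩ := eval_ratio hd hq.1 hq.2.1
  have hsymm := (isContractionMatrix_listed hs q.1 q.2).1
  obtain ⟨y, hy, hy'⟩ := prod_normalize hk (pullback A (s.matrix a b)) he h1 h2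
  rw [← heq, ← prod_sidePositions hsymm h1, prod_entry_matrix s _ _ (mem_positions_of_mem_sidePositions h1),
    h3] at hy
  rw [← heq, ← prod_sidePositions hsymm h2, prod_entry_matrix s _ _ (mem_positions_of_mem_sidePositions h2),
    h4] at hy'
  refine ⟨A, ?_⟩
  rw [← hv, hy, hy', mul_div_mul_left]
  rintro rfl
  exact hl0 (by rw [hy, zero_mul])

theorem finite_setOf_zpow_eq {n : ℤ} (hn : n ≠ 0) (c : ℂ) : {x : ℂ | x ^ n = c}.Finite := by
  have key : ∀ (m : ℕ) (c : ℂ), 0 < m → {x : ℂ | x ^ m = c}.Finite := fun m c hm =>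
    (Polynomial.nthRoots m c).toFinset.finite_toSet.subset fun x hx => by
      simpa [Polynomial.mem_nthRoots hm] using hx
  rcases n with m | m
  · simp only [Int.ofNat_eq_natCast, zpow_natCast]
    exact key m c (Nat.pos_of_ne_zero fun h => hn (by simp [h]))
  · simp only [zpow_negSucc, inv_eq_iff_eq_inv]
    exact key (m + 1) _ m.succ_pos

/-- Each parameter of a listed matrix occurs in a higher-order identity, to a non-zero power and
without the other one. -/
theorem exists_pure_ratio : ∀ s ∈ solutionList,
    (s.as = [] ∨ ∃ x ∈ identityPositions, ∃ n ∈ [(-2 : ℤ), -1, 1, 2], s.ratio x = some (n, 0)) ∧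
    (s.bs = [] ∨ ∃ x ∈ identityPositions, ∃ n ∈ [(-2 : ℤ), -1, 1, 2], s.ratio x = some (0, n)) := by
  decide +kernel

theorem finite_equivalent_parameters {s : Listed} (hs : s ∈ solutionList) (a b : ℂ) :
    {q : ℂ × ℂ | s.Admissible q.1 q.2 ∧
      Equivalent (s.matrix q.1 q.2) (s.matrix a b)}.Finite := by
  have hn : ∀ n ∈ [(-2 : ℤ), -1, 1, 2], n ≠ 0 := by decide
  have hfin : ∀ {n : ℤ} (v : Matrix (Fin 2) (Fin 2) (ZMod 3) → ℂ), n ≠ 0 →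
      (⋃ A, {x : ℂ | x ^ n = v A}).Finite := fun v hn =>
    Set.finite_iUnion fun A => finite_setOf_zpow_eq hn (v A)
  obtain ⟨hA, hB⟩ := exists_pure_ratio s hs
  obtain ⟨F₁, hF₁, h₁⟩ : ∃ F : Set ℂ, F.Finite ∧ ∀ q : ℂ × ℂ, s.Admissible q.1 q.2 →
      Equivalent (s.matrix q.1 q.2) (s.matrix a b) → q.1 ∈ F := by
    rcases hA with hA | ⟨x, hx, n, hnm, hr⟩
    · exact ⟨{1}, Set.finite_singleton 1, fun q hq _ => hq.2.2.1 hA⟩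
    · obtain ⟨v, hv⟩ := exists_ratio_value hs a b hx hr
      refine ⟨_, hfin v (hn n hnm), fun q hq he => ?_⟩
      obtain ⟨A, hA⟩ := hv q hq he
      exact Set.mem_iUnion.2 ⟨A, by simpa using hA⟩
  obtain ⟨F₂, hF₂, h₂⟩ : ∃ F : Set ℂ, F.Finite ∧ ∀ q : ℂ × ℂ, s.Admissible q.1 q.2 →
      Equivalent (s.matrix q.1 q.2) (s.matrix a b) → q.2 ∈ F := by
    rcases hB with hB | ⟨x, hx, n, hnm, hr⟩
    · exact ⟨{1}, Set.finite_singleton 1, fun q hq _ => hq.2.2.2.1 hB⟩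
    · obtain ⟨v, hv⟩ := exists_ratio_value hs a b hx hr
      refine ⟨_, hfin v (hn n hnm), fun q hq he => ?_⟩
      obtain ⟨A, hA⟩ := hv q hq he
      exact Set.mem_iUnion.2 ⟨A, by simpa using hA⟩
  exact (hF₁.prod hF₂).subset fun q hq => ⟨h₁ q hq.1 hq.2, h₂ q hq.1 hq.2⟩

/-! ### The numbers of equations -/

/-- The position of an unordered pair of grading indices. -/
def pairPosition : Sym2 G → ℕ := Sym2.lift ⟨position, position_comm⟩

theorem map_pairPosition_side (l : List (G × G)) :
    (MonomialEquation.side l).map pairPosition = (sidePositions l : Multiset ℕ) := by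
  simp [MonomialEquation.side, sidePositions, pairPosition, Function.comp_def]

theorem map_ofPos_sidePositions {l : List (G × G)} (h : ∀ p ∈ l, Relevant p.1 p.2) :
    (sidePositions l : Multiset ℕ).map (fun c => s(ofPos (c / 10), ofPos (c % 10))) =
      MonomialEquation.side l := by
  rw [sidePositions, Multiset.map_coe, List.map_map, MonomialEquation.side]
  congr 1
  refine List.map_congr_left fun p hp => ?_
  rcases ofPos_position p.1 p.2 (h p hp) with ⟨h1, h2⟩ | ⟨h1, h2⟩ <;>
    simp only [Function.comp_apply, h1, h2]
  exact Sym2.eq_swap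

/-- The equations in the orbits of the given representatives, as unordered pairs of multisets of
positions. -/
def orbitPositions (l : List MonomialEquation) : List (Sym2 (Multiset ℕ)) :=
  specialSymmetries.flatMap fun N => l.map fun r =>
    s((((sidePositions r.lhs).map (relabel N) : List ℕ) : Multiset ℕ),
      (((sidePositions r.rhs).map (relabel N) : List ℕ) : Multiset ℕ))

theorem ncard_orbits {l : List MonomialEquation}
    (hl : ∀ r ∈ l, (∀ p ∈ r.lhs, Relevant p.1 p.2) ∧ ∀ p ∈ r.rhs, Relevant p.1 p.2) :
    (MonomialEquation.unordered '' MonomialEquation.orbits l).ncard =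
      (orbitPositions l).toFinset.card := by
  have hinj : Set.InjOn (Sym2.map (Multiset.map pairPosition))
      (MonomialEquation.unordered '' MonomialEquation.orbits l) := by
    refine Set.LeftInvOn.injOn (f₁' := Sym2.map (Multiset.map fun c =>
      s(ofPos (c / 10), ofPos (c % 10)))) ?_
    rintro _ ⟨_, ⟨A, hA, r, hr, rfl⟩, rfl⟩
    obtain ⟨h1, h2⟩ := hl r hr
    have hA3 : A ∈ H3 := Or.inl hA
    rw [MonomialEquation.unordered, MonomialEquation.transform, Sym2.map_mk, Sym2.map_mk,
      map_pairPosition_side, map_pairPosition_side,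
      map_ofPos_sidePositions (relevant_map_act hA3 h1),
      map_ofPos_sidePositions (relevant_map_act hA3 h2)]
  rw [← hinj.ncard_image, ← Set.ncard_coe_finset]
  congr 1
  ext z
  simp only [Set.mem_image, List.coe_toFinset, Set.mem_ofPred_eq, orbitPositions, List.mem_flatMap,
    List.mem_map]
  have key : ∀ {A N r}, r ∈ l → Encodes N A →
      Sym2.map (Multiset.map pairPosition) (MonomialEquation.transform A r).unordered =
      s((((sidePositions r.lhs).map (relabel N) : List ℕ) : Multiset ℕ),
        (((sidePositions r.rhs).map (relabel N) : List ℕ) : Multiset ℕ)) := by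
    intro A N r hr hN
    rw [MonomialEquation.unordered, MonomialEquation.transform, Sym2.map_mk,
      map_pairPosition_side, map_pairPosition_side, sidePositions_map_act hN (hl r hr).1,
      sidePositions_map_act hN (hl r hr).2]
  constructor
  · rintro ⟨_, ⟨_, ⟨A, hA, r, hr, rfl⟩, rfl⟩, rfl⟩
    obtain ⟨N, hN, hNA⟩ := exists_special_encodes hA
    exact ⟨N, hN, r, hr, (key hr hNA).symm⟩
  · rintro ⟨N, hN, r, hr, rfl⟩
    obtain ⟨A, hA, hNA⟩ := exists_matrix_of_mem_special hN
    exact ⟨_, ⟨_, ⟨A, hA, r, hr, rfl⟩, rfl⟩, key hr hNA⟩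

theorem ncard_contractionEquations :
    (MonomialEquation.unordered '' contractionEquations).ncard = 48 := by
  rw [contractionEquations, ncard_orbits (by decide +kernel)]
  decide +kernel

theorem ncard_secondOrderIdentities :
    (MonomialEquation.unordered '' secondOrderIdentities).ncard = 24 := by
  rw [secondOrderIdentities, ncard_orbits (by decide +kernel)]
  decide +kernel

theorem ncard_thirdOrderIdentities :
    (MonomialEquation.unordered '' thirdOrderIdentities).ncard = 80 := by
  rw [thirdOrderIdentities, ncard_orbits (by decide +kernel)]
  decide +kernel

end PauliContraction

open PauliContraction in
theorem mainTheorem1 :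
    -- the contraction system consists of 48 two-term equations
    ((MonomialEquation.unordered '' contractionEquations).ncard = 48 ∧
      ∀ ε, IsSolution ε ↔
        IsContractionMatrix ε ∧ ∀ e ∈ contractionEquations, e.Holds ε) ∧
    -- 188 listed matrices: 175 non-parametric, 11 with one and 2 with two parameters
    (solutionList.length = 188 ∧
      (solutionList.filter fun s => s.numParameters = 0).length = 175 ∧
      (solutionList.filter fun s => s.numParameters = 1).length = 11 ∧
      (solutionList.filter fun s => s.numParameters = 2).length = 2) ∧
    -- each listed matrix is a solution with the indicated number of zeros
    (∀ s ∈ solutionList, ∀ a b, s.Admissible a b →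
      IsSolution (s.matrix a b) ∧ numZeros (s.matrix a b) = s.ν) ∧
    -- every solution is equivalent to exactly one listed matrix
    (∀ ε, IsSolution ε →
      ∃! n : Fin solutionList.length, ∃ a b, (solutionList.get n).Admissible a b ∧
        Equivalent ε ((solutionList.get n).matrix a b)) ∧
    -- the dependence on the parameters is finite-to-one on equivalence classes
    (∀ s ∈ solutionList, ∀ a b, s.Admissible a b →
      {q : ℂ × ℂ | s.Admissible q.1 q.2 ∧
        Equivalent (s.matrix q.1 q.2) (s.matrix a b)}.Finite) ∧
    -- apart from the trivial solution there is none with fewer than 9 zeros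
    (∀ ε, IsSolution ε → numZeros ε < 9 → Equivalent ε trivialSolution) ∧
    -- the second- and third-order identities
    ((∀ e ∈ secondOrderIdentities, IsHigherOrderIdentity 2 e) ∧
      (∀ e ∈ thirdOrderIdentities, IsHigherOrderIdentity 3 e) ∧
      (MonomialEquation.unordered '' secondOrderIdentities).ncard = 24 ∧
      (MonomialEquation.unordered '' thirdOrderIdentities).ncard = 80) ∧
    -- continuous and discrete listed solutions
    (∀ s ∈ solutionList, ∀ a b, s.Admissible a b →
      (s.MarkedContinuous a b →
        IsContinuousSolution (s.matrix a b) ∧ IsGeneralizedInonuWigner (s.matrix a b)) ∧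
      (¬ s.MarkedContinuous a b →
        IsDiscreteSolution (s.matrix a b) ∧
        ∃ e ∈ secondOrderIdentities ∪ thirdOrderIdentities, ¬ e.Holds (s.matrix a b))) := by
  refine ⟨⟨ncard_contractionEquations, fun ε => ?_⟩, ⟨?_, ?_, ?_, ?_⟩, ?_, ?_, ?_, ?_,
    ⟨isHigherOrderIdentity_second, isHigherOrderIdentity_third, ncard_secondOrderIdentities,
      ncard_thirdOrderIdentities⟩, ?_⟩
  · rw [isSolution_iff_twoTerm, holds_contractionEquations_iff]
  · decide +kernel
  · decide +kernel
  · decide +kernel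
  · decide +kernel
  · exact fun s hs a b h => ⟨isSolution_listed hs a b, numZeros_listed hs h⟩
  · exact fun ε hε => existsUnique_listed hε
  · exact fun s hs a b _ => finite_equivalent_parameters hs a b
  · exact fun ε hε h => equivalent_trivialSolution_of_numZeros_lt hε h
  · exact fun s hs a b h => marked_listed hs h
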